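/- **Theorem.** Let $n\ge 1$, let $C\in\mathbb R^{n\times n}$ be symmetric and diagonally dominant with nonnegative diagonal ($\sum_{j\ne i}|C_{ij}|\le C_{ii}$ for all $i$), let $\epsilon\in(0,\tfrac13)$ and $\mathrm{opt}=\max_{w\in\{-1,1\}^n}w^TCw$. Put $\beta=4\,\mathrm{Tr}(C)$, $M=4\log(2n)/\epsilon$, $T=64\log(2n)\,n^2/\epsilon^2$, $p=\epsilon/T$, $\eta=1$, $C_g^u=\beta M n^2$, $\gamma_t=\frac{2}{t+2}$, $\alpha_{GW}=\min_{0<\theta\le\pi}\frac2\pi\frac{\theta}{1-\cos\theta}\approx0.878$, $\phi_M(x)=\frac1M\log\sum_i(e^{Mx_i}+e^{-Mx_i})$. Consider the problem (MaxCut-LSE) $$\max\ \langle C,X\rangle-\beta\,\phi_M(\mathrm{diag}(X)-\mathbb 1)\quad\text{subject to}\quad X\succeq0,\ \mathrm{Tr}(X)\le n ,$$ and write $J(v)=C-\beta\,\mathrm{diag}^*(\nabla\phi_M(v-\mathbb 1))$ for its gradient at $X$ with $\mathrm{diag}(X)=v$. *Frank–Wolfe with Gaussian sampling.* Start from $X_0=I$,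 $z_0\sim\mathcal N(0,I)$. For $t=0,1,\dots$ a linear maximisation oracle runs $K=\lfloor 280\frac n\epsilon\log\frac{2n}\epsilon\rfloor-1$ steps of the power method with an independent Gaussian random start on $J_t+5\mathrm{Tr}(C)I$, $J_t=J(\mathrm{diag}X_t)$, normalises the result to $w_t$, and replaces $w_t$ by $0$ if $w_t^TJ_tw_t<0$; put $H_t=n\,w_tw_t^T$. Given a parameter $\kappa\le1$, stop with output $\hat z=z_t$, $\hat X=X_t$ if the computed gap $\langle H_t-X_t,J_t\rangle$ is at most $\kappa\,\epsilon\mathrm{Tr}(C)$; stop also when $t=\lfloor T\rfloor$ (without calling the oracle again). Otherwise set $z_{t+1}=\sqrt{1-\gamma_t}\,z_t+\sqrt{\gamma_t n}\,\zeta_tw_t$ with independent $\zeta_t\sim\mathcal N(0,1)$, and $X_{t+1}=(1-\gamma_t)X_t+\gamma_tH_t$. (The algorithm stores $z_t$ and $\mathrm{diag}(X_t)$, but not $X_t$.) *Rounding.* With $m=\max_i\hat X_{ii}$ and an independent $\xi\sim\mathcal N\big(0,I-\mathrm{diag}^*(\mathrm{diag}(\hat X)/m)\big)$ return $w=\mathrm{sign}(\hat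 z/\sqrt m+\xi)\in\{-1,1\}^n$, where $\mathrm{sign}(0)=1$ (for $C=0$, where the normalisations can fail, $x/0=0$ is used). Then: 1. For every $v\in\mathbb R^n$ and every $t<\lfloor T\rfloor$, the oracle's direction $H$ for $J(v)$ satisfies $\langle H,J(v)\rangle\ge\max_{Y\succeq0,\,\mathrm{Tr}Y\le n}\langle Y,J(v)\rangle-\frac12\eta\gamma_tC_g^u$ with probability at least $1-p$. 2. If $\kappa\le\frac34$, then with probability at least $1-\epsilon$ the matrix $\hat X$ is an $\epsilon\mathrm{Tr}(C)$-optimal solution of (MaxCut-LSE). 3. For every $\kappa\le1$: $\ \alpha_{GW}(1-3\epsilon)\,\mathrm{opt}\le\mathbb E[w^TCw]\le\mathrm{opt}$. 4. The algorithm stops after at most $T$ iterations. On a machine with vector registers of $n$ real numbers each and 16 scalar registers, on which the random numbers are drawn one after the other and $C$ is accessed only through its trace, in-place products of a vector register with $C$ plus a diagonal matrix, and quadratic forms $x^TCx$ (each of the last two counted as one matrix–vector product), there is a program, depending on $n,\epsilon,\kappa$ but not on $C$, that executes the whole procedure, one iteration per round of its main loop with $z_t$ and $\mathrm{diag}(X_t)$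 held in registers, in at most $T$ rounds, with at most $280\frac n\epsilon\log\frac{2n}\epsilon$ matrix–vector products in each round and none outside the main loop, and with vector registers of at most $3n$ numbers in total. -/

import Mathlib

open MeasureTheory ProbabilityTheory Matrix

noncomputable section

namespace MaxCutFW

/-! ### The maximum cut problem and its penalised relaxation -/

/-- Symmetric, (weakly) diagonally dominant, with nonnegative diagonal. -/
def IsDiagDominant {n : ℕ} (C : Matrix (Fin n) (Fin n) ℝ) : Prop :=
  C.IsSymm ∧ ∀ i, ∑ j ∈ Finset.univ.erase i, |C i j| ≤ C i i

def IsSignVector {n : ℕ} (x : Fin n → ℝ) : Prop := ∀ i, x i = 1 ∨ x i = -1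

/-- `opt`: the maximum of `xᵀ C x` over the finite nonempty set `{-1,1}ⁿ`. -/
def maxCut {n : ℕ} (C : Matrix (Fin n) (Fin n) ℝ) : ℝ :=
  sSup {r | ∃ x : Fin n → ℝ, IsSignVector x ∧ r = x ⬝ᵥ C *ᵥ x}

/-- The Goemans-Williamson constant `min_{0 < θ ≤ π} (2/π) θ / (1 - cos θ) ≈ 0.878`. -/
def alphaGW : ℝ :=
  sInf ((fun θ : ℝ => 2 / Real.pi * (θ / (1 - Real.cos θ))) '' Set.Ioc 0 Real.pi)

/-- `∑ᵢ exp (M xᵢ) + ∑ᵢ exp (M (-xᵢ))`. -/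
def expSum {n : ℕ} (M : ℝ) (x : Fin n → ℝ) : ℝ :=
  ∑ i, Real.exp (M * x i) + ∑ i, Real.exp (M * -x i)

/-- The LogSumExp penalty `φ_M`. -/
def lse {n : ℕ} (M : ℝ) (x : Fin n → ℝ) : ℝ := 1 / M * Real.log (expSum M x)

/-- The gradient of `φ_M`, see `hasDerivAt_lse`. -/
def lseGrad {n : ℕ} (M : ℝ) (x : Fin n → ℝ) : Fin n → ℝ :=
  fun i => (Real.exp (M * x i) - Real.exp (M * -x i)) / expSum M x

/-- `M = 4 log(2n) / ε`. -/
def penaltyM (n : ℕ) (ε : ℝ) : ℝ := 4 * Real.log (2 * n) / ε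

/-- `β = 4 Tr C`. -/
def penaltyBeta {n : ℕ} (C : Matrix (Fin n) (Fin n) ℝ) : ℝ := 4 * C.trace

/-- The objective `⟨C, X⟩ - β φ_M(diag X - 𝟙)` of MaxCut-LSE. -/
def objective {n : ℕ} (C : Matrix (Fin n) (Fin n) ℝ) (ε : ℝ) (X : Matrix (Fin n) (Fin n) ℝ) : ℝ :=
  (Cᵀ * X).trace - penaltyBeta C * lse (penaltyM n ε) (X.diag - 1)

/-- The feasible set `{X ⪰ 0, Tr X ≤ n}` of MaxCut-LSE. -/
def Feasible {n : ℕ} (X : Matrix (Fin n) (Fin n) ℝ) : Prop := X.PosSemidef ∧ X.trace ≤ n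

/-- `X` is a `δ`-optimal solution of MaxCut-LSE. -/
def IsApproxOptimal {n : ℕ} (C : Matrix (Fin n) (Fin n) ℝ) (ε δ : ℝ)
    (X : Matrix (Fin n) (Fin n) ℝ) : Prop :=
  Feasible X ∧ ∀ Y, Feasible Y → objective C ε Y - δ ≤ objective C ε X

/-- The gradient `C - β diag*(∇φ_M(v - 𝟙))` of the objective at any `X` with `diag X = v`, see
`hasDerivAt_objective`. -/
def gradMatrix {n : ℕ} (C : Matrix (Fin n) (Fin n) ℝ) (ε : ℝ) (v : Fin n → ℝ) :
    Matrix (Fin n) (Fin n) ℝ :=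
  C - penaltyBeta C • diagonal (lseGrad (penaltyM n ε) (v - 1))

/-! ### Frank-Wolfe with Gaussian sampling, applied to MaxCut-LSE -/

/-- `T(n, ε) = 64 log(2n) n² / ε²`. -/
def iterBound (n : ℕ) (ε : ℝ) : ℝ := 64 * Real.log (2 * n) * n ^ 2 / ε ^ 2

/-- The bound `280 (n/ε) log(2n/ε)` on the matrix-vector products of one iteration. -/
def matvecBound (n : ℕ) (ε : ℝ) : ℝ := 280 * (n / ε) * Real.log (2 * n / ε)

/-- The upper bound `C_g^u = β M n²` on the curvature constant of MaxCut-LSE. -/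
def curvatureBound {n : ℕ} (C : Matrix (Fin n) (Fin n) ℝ) (ε : ℝ) : ℝ :=
  penaltyBeta C * penaltyM n ε * n ^ 2

/-- The step size `γ = 2 / (t + 2)`. -/
def stepSize (t : ℕ) : ℝ := 2 / (t + 2)

/-- Number of steps of the power method in one call of the linear maximisation oracle (one more
product is spent on the Rayleigh quotient). -/
def powerSteps (n : ℕ) (ε : ℝ) : ℕ := ⌊matvecBound n ε⌋₊ - 1

/-- The power method with start `b`, applied to the positive semidefinite shift `J + 5 Tr(C) I` of
`J = gradMatrix C ε v`; the result is normalised in the Euclidean norm. -/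
def powerVector {n : ℕ} (C : Matrix (Fin n) (Fin n) ℝ) (ε : ℝ) (v b : Fin n → ℝ) : Fin n → ℝ :=
  let y := ((gradMatrix C ε v + (5 * C.trace) • (1 : Matrix (Fin n) (Fin n) ℝ)) ^
    powerSteps n ε) *ᵥ b
  (√(y ⬝ᵥ y))⁻¹ • y

/-- The vector `w` returned by the linear maximisation oracle: the result of the power method if its
Rayleigh quotient is nonnegative, and `0` otherwise. -/
def lmo {n : ℕ} (C : Matrix (Fin n) (Fin n) ℝ) (ε : ℝ) (v b : Fin n → ℝ) : Fin n → ℝ :=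
  let w := powerVector C ε v b
  if 0 ≤ w ⬝ᵥ gradMatrix C ε v *ᵥ w then w else 0

/-- The update direction `H = n w wᵀ`. -/
def direction {n : ℕ} (w : Fin n → ℝ) : Matrix (Fin n) (Fin n) ℝ := (n : ℝ) • vecMulVec w w

/-- Names of the independent standard Gaussian numbers: `inl (σ, j, i)` is the `i`-th coordinate of
the `j`-th vector of the vector stream `σ`, and `inr j` is the `j`-th number of a scalar stream. -/
abbrev Seed (n : ℕ) : Type := (Fin 2 × ℕ × Fin n) ⊕ ℕ

abbrev Tape (n : ℕ) : Type := Seed n → ℝ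

/-- All random numbers are independent and standard Gaussian. -/
def tapeLaw (n : ℕ) : Measure (Tape n) := Measure.infinitePi fun _ => gaussianReal 0 1

def Tape.vector {n : ℕ} (ω : Tape n) (σ : Fin 2) (j : ℕ) : Fin n → ℝ :=
  fun i => ω (Sum.inl (σ, j, i))

def Tape.scalar {n : ℕ} (ω : Tape n) (j : ℕ) : ℝ := ω (Sum.inr j)

/-- The initial sample `z₀ ∼ N(0, I)`. -/
def Tape.initial {n : ℕ} (ω : Tape n) : Fin n → ℝ := ω.vector 0 0

/-- The random start of the power method in iteration `t`. -/
def Tape.start {n : ℕ} (ω : Tape n) (t : ℕ) : Fin n → ℝ := ω.vector 1 t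

/-- The standard Gaussian number `ζ` of the update in iteration `t`. -/
def Tape.zeta {n : ℕ} (ω : Tape n) (t : ℕ) : ℝ := ω.scalar t

/-- The standard Gaussian vector used in the rounding. -/
def Tape.rounding {n : ℕ} (ω : Tape n) : Fin n → ℝ := ω.vector 0 1

/-- The sample `z_t` (first component) and the covariance `X_t` (second component), as long as the
algorithm has not stopped. The algorithm itself stores `z_t` and `diag X_t` only. -/
def iterate {n : ℕ} (C : Matrix (Fin n) (Fin n) ℝ) (ε : ℝ) (ω : Tape n) :
    ℕ → (Fin n → ℝ) × Matrix (Fin n) (Fin n) ℝ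
  | 0 => (ω.initial, 1)
  | t + 1 =>
    let z := (iterate C ε ω t).1
    let X := (iterate C ε ω t).2
    let w := lmo C ε X.diag (ω.start t)
    (√(1 - stepSize t) • z + (√(stepSize t) * ω.zeta t) • (√(n : ℝ) • w),
      (1 - stepSize t) • X + stepSize t • direction w)

/-- The computed Frank-Wolfe gap `⟨q_t - v_t, ∇g(v_t)⟩ = ⟨H_t - X_t, J_t⟩`. -/
def gap {n : ℕ} (C : Matrix (Fin n) (Fin n) ℝ) (ε : ℝ) (ω : Tape n) (t : ℕ) : ℝ :=
  let X := (iterate C ε ω t).2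
  ((gradMatrix C ε X.diag)ᵀ * (direction (lmo C ε X.diag (ω.start t)) - X)).trace

/-- The algorithm stops as soon as the computed gap is at most `κ ε Tr C`, and after `⌊T(n, ε)⌋`
iterations at the latest. -/
def stopTime {n : ℕ} (C : Matrix (Fin n) (Fin n) ℝ) (ε κ : ℝ) (ω : Tape n) : ℕ :=
  sInf {t | t = ⌊iterBound n ε⌋₊ ∨ gap C ε ω t ≤ κ * (ε * C.trace)}

/-- The Gaussian sample returned by the algorithm. -/
def sample {n : ℕ} (C : Matrix (Fin n) (Fin n) ℝ) (ε κ : ℝ) (ω : Tape n) : Fin n → ℝ :=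
  (iterate C ε ω (stopTime C ε κ ω)).1

/-- The covariance matrix of the returned sample. -/
def covariance {n : ℕ} (C : Matrix (Fin n) (Fin n) ℝ) (ε κ : ℝ) (ω : Tape n) :
    Matrix (Fin n) (Fin n) ℝ :=
  (iterate C ε ω (stopTime C ε κ ω)).2

/-- Rounding of a sample `z` with covariance diagonal `v`, with standard Gaussian noise `ξ`:
the signs of `z / √(max v) + ζ`, where `ζ ∼ N(0, I - diag*(v / max v))`. -/
def roundSample {n : ℕ} (z v ξ : Fin n → ℝ) : Fin n → ℝ :=
  fun i => if 0 ≤ z i / √(⨆ j, v j) + √(1 - v i / ⨆ j, v j) * ξ i then 1 else -1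

/-- The random cut produced by the whole procedure. -/
def cut {n : ℕ} (C : Matrix (Fin n) (Fin n) ℝ) (ε κ : ℝ) (ω : Tape n) : Fin n → ℝ :=
  roundSample (sample C ε κ ω) (covariance C ε κ ω).diag ω.rounding

/-! ### A machine model with a count of working memory and of matrix-vector products

A machine has `k` vector registers of `n` numbers each, and `s` scalar registers. The matrix `C` is
read-only problem data: it is accessed through its trace, through in-place products of a vector
register with `C` plus a diagonal matrix, and through the quadratic form of a vector register. -/

/-- Real expressions in variables from `V`. -/
inductive Expr (V : Type) : Type
  | var (x : V)
  | const (c : ℝ)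
  | add (e f : Expr V)
  | sub (e f : Expr V)
  | mul (e f : Expr V)
  | div (e f : Expr V)
  | exp (e : Expr V)
  | sqrt (e : Expr V)
  | ifNonneg (c e f : Expr V)

def Expr.eval {V : Type} (ρ : V → ℝ) : Expr V → ℝ
  | .var x => ρ x
  | .const c => c
  | .add e f => e.eval ρ + f.eval ρ
  | .sub e f => e.eval ρ - f.eval ρ
  | .mul e f => e.eval ρ * f.eval ρ
  | .div e f => e.eval ρ / f.eval ρ
  | .exp e => Real.exp (e.eval ρ)
  | .sqrt e => √(e.eval ρ)
  | .ifNonneg c e f => if 0 ≤ c.eval ρ then e.eval ρ else f.eval ρ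

/-- Programs built from elementary instructions, by composition and by repeating a fixed number of
times. A variable `inl j` of an expression over `Fin k ⊕ Fin s` stands for the current coordinate of
the vector register `j`, a variable `inr a` for the scalar register `a`. -/
inductive Code (k s : ℕ) : Type
  /-- scalar `a` := `e` -/
  | setScalar (a : Fin s) (e : Expr (Fin s))
  /-- every coordinate of vector `i` := `e` (at that coordinate) -/
  | setVector (i : Fin k) (e : Expr (Fin k ⊕ Fin s))
  /-- scalar `a` := the sum of `e` over all coordinates -/
  | sum (a : Fin s) (e : Expr (Fin k ⊕ Fin s))
  /-- scalar `a` := the largest coordinate of vector `i` -/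
  | max (a : Fin s) (i : Fin k)
  /-- scalar `a` := the trace of `C` -/
  | trace (a : Fin s)
  /-- vector `i` := (`C` + the diagonal matrix with entries `e`) times vector `i`; counts as one
  matrix-vector product -/
  | matvec (i : Fin k) (e : Expr (Fin k ⊕ Fin s))
  /-- scalar `a` := `xᵀ C x` for the vector `x` in register `i`; counts as one matrix-vector
  product -/
  | quadForm (a : Fin s) (i : Fin k)
  /-- vector `i` := the next Gaussian vector of stream `σ` -/
  | gaussVector (i : Fin k) (σ : Fin 2)
  /-- scalar `a` := the next Gaussian number -/
  | gaussScalar (a : Fin s)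
  | seq (c d : Code k s)
  | repeatN (m : ℕ) (c : Code k s)

/-- Contents of the registers, number of matrix-vector products so far, and numbers of Gaussian
vectors and Gaussian numbers drawn so far. -/
structure Machine (n k s : ℕ) where
  vec : Fin k → Fin n → ℝ
  scal : Fin s → ℝ
  matvecs : ℕ
  drawnVectors : Fin 2 → ℕ
  drawnScalars : ℕ

def Machine.coord {n k s : ℕ} (m : Machine n k s) (i : Fin n) : Fin k ⊕ Fin s → ℝ :=
  Sum.elim (fun j => m.vec j i) m.scal

def Code.exec {n k s : ℕ} (C : Matrix (Fin n) (Fin n) ℝ) (ω : Tape n) :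
    Code k s → Machine n k s → Machine n k s
  | .setScalar a e, m => { m with scal := Function.update m.scal a (e.eval m.scal) }
  | .setVector i e, m => { m with vec := Function.update m.vec i fun l => e.eval (m.coord l) }
  | .sum a e, m => { m with scal := Function.update m.scal a (∑ l, e.eval (m.coord l)) }
  | .max a i, m => { m with scal := Function.update m.scal a (⨆ l, m.vec i l) }
  | .trace a, m => { m with scal := Function.update m.scal a C.trace }
  | .matvec i e, m =>
    { m with
      vec := Function.update m.vec i ((C + diagonal fun l => e.eval (m.coord l)) *ᵥ m.vec i)
      matvecs := m.matvecs + 1 }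
  | .quadForm a i, m =>
    { m with
      scal := Function.update m.scal a (m.vec i ⬝ᵥ C *ᵥ m.vec i)
      matvecs := m.matvecs + 1 }
  | .gaussVector i σ, m =>
    { m with
      vec := Function.update m.vec i (ω.vector σ (m.drawnVectors σ))
      drawnVectors := Function.update m.drawnVectors σ (m.drawnVectors σ + 1) }
  | .gaussScalar a, m =>
    { m with
      scal := Function.update m.scal a (ω.scalar m.drawnScalars)
      drawnScalars := m.drawnScalars + 1 }
  | .seq c d, m => d.exec C ω (c.exec C ω m)
  | .repeatN r c, m => (c.exec C ω)^[r] m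

/-- A program: an initial part, then the body of the main loop, which is repeated as long as the
scalar register `flag` is nonnegative, but at most `maxRounds` times, then a final part, whose result
is left in the vector register `out`. -/
structure Program (k s : ℕ) where
  init : Code k s
  body : Code k s
  final : Code k s
  maxRounds : ℕ
  flag : Fin s
  out : Fin k

/-- The state of the machine (started with all registers zero) after at most `r` rounds of the main
loop. -/
def Program.after {n k s : ℕ} (P : Program k s) (C : Matrix (Fin n) (Fin n) ℝ) (ω : Tape n) :
    ℕ → Machine n k s
  | 0 => P.init.exec C ω ⟨0, 0, 0, 0, 0⟩
  | r + 1 =>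
    let m := P.after C ω r
    if 0 ≤ m.scal P.flag then P.body.exec C ω m else m

/-- The final state of the machine. -/
def Program.finish {n k s : ℕ} (P : Program k s) (C : Matrix (Fin n) (Fin n) ℝ) (ω : Tape n) :
    Machine n k s :=
  P.final.exec C ω (P.after C ω P.maxRounds)

def Program.output {n k s : ℕ} (P : Program k s) (C : Matrix (Fin n) (Fin n) ℝ) (ω : Tape n) :
    Fin n → ℝ :=
  (P.finish C ω).vec P.out

/-- Storage for vectors, in numbers: `k` registers of length `n`. -/
def Program.vectorMemory {k s : ℕ} (_P : Program k s) (n : ℕ) : ℕ := k * n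

/-! ### The gradients are the gradients -/

theorem expSum_pos {n : ℕ} (hn : 0 < n) (M : ℝ) (x : Fin n → ℝ) : 0 < expSum M x := by
  have : Nonempty (Fin n) := ⟨⟨0, hn⟩⟩
  unfold expSum
  exact add_pos (Finset.sum_pos (fun i _ => Real.exp_pos _) Finset.univ_nonempty)
    (Finset.sum_pos (fun i _ => Real.exp_pos _) Finset.univ_nonempty)

theorem hasDerivAt_lse {n : ℕ} (hn : 0 < n) {M : ℝ} (hM : M ≠ 0) (x d : Fin n → ℝ) :
    HasDerivAt (fun r : ℝ => lse M (x + r • d)) (lseGrad M x ⬝ᵥ d) 0 := by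
  have h1 : ∀ i, HasDerivAt (fun r : ℝ => x i + r * d i) (d i) 0 := fun i => by
    simpa using ((hasDerivAt_id (0 : ℝ)).mul_const (d i)).const_add (x i)
  have h2 : HasDerivAt (fun r : ℝ => expSum M (x + r • d))
      (∑ i, Real.exp (M * x i) * (M * d i) + ∑ i, Real.exp (M * -x i) * (M * -d i)) 0 := by
    refine HasDerivAt.add (HasDerivAt.fun_sum fun i _ => ?_) (HasDerivAt.fun_sum fun i _ => ?_)
    · simpa using ((h1 i).const_mul M).exp
    · simpa using ((h1 i).fun_neg.const_mul M).exp
  have h0 : expSum M (x + (0 : ℝ) • d) ≠ 0 := (expSum_pos hn M _).ne'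
  have h3 := (h2.log h0).const_mul (1 / M)
  unfold lse
  refine h3.congr_deriv ?_
  have hx := (expSum_pos hn M x).ne'
  rw [zero_smul, add_zero]
  unfold lseGrad dotProduct
  rw [← Finset.sum_add_distrib, ← mul_div_assoc, Finset.mul_sum, Finset.sum_div]
  refine Finset.sum_congr rfl fun i _ => ?_
  field_simp
  ring

theorem hasDerivAt_objective {n : ℕ} (hn : 0 < n) (C : Matrix (Fin n) (Fin n) ℝ) {ε : ℝ}
    (hε : 0 < ε) (X D : Matrix (Fin n) (Fin n) ℝ) :
    HasDerivAt (fun r : ℝ => objective C ε (X + r • D)) ((gradMatrix C ε X.diag)ᵀ * D).trace 0 := by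
  have hM : penaltyM n ε ≠ 0 := by
    have h1 : (1 : ℝ) ≤ n := by exact_mod_cast hn
    have : 0 < Real.log (2 * n) := Real.log_pos (by linarith)
    unfold penaltyM
    positivity
  have h1 : HasDerivAt (fun r : ℝ => (Cᵀ * X).trace + r * (Cᵀ * D).trace) (Cᵀ * D).trace 0 := by
    simpa using ((hasDerivAt_id (0 : ℝ)).mul_const (Cᵀ * D).trace).const_add (Cᵀ * X).trace
  have h2 := (hasDerivAt_lse hn hM (X.diag - 1) D.diag).const_mul (penaltyBeta C)
  have h3 := h1.fun_sub h2
  refine (h3.congr_deriv ?_).congr_of_eventuallyEq (Filter.Eventually.of_forall fun r => ?_)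
  · have h4 : (penaltyBeta C • diagonal (lseGrad (penaltyM n ε) (X.diag - 1)) * D).trace =
        penaltyBeta C * lseGrad (penaltyM n ε) (X.diag - 1) ⬝ᵥ D.diag := by
      simp [Matrix.trace, dotProduct, Finset.mul_sum]
    rw [gradMatrix, transpose_sub, transpose_smul, diagonal_transpose, Matrix.sub_mul, trace_sub, h4]
  · simp only [objective, Matrix.mul_add, Matrix.mul_smul, trace_add, trace_smul, smul_eq_mul,
      diag_add, diag_smul]
    congr 3
    abel

end MaxCutFW

end

noncomputable section

namespace MaxCutFW

/-! ### Spectral decompositions and the power method -/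

/-! Every error is measured in units of `ε * C.trace`. This is the right scale because diagonal
dominance gives `Tr C ≤ opt ≤ 2 Tr C`: uniform random signs give the lower bound, the sum of all
absolute entries the upper one.

Oracle: the quadratic form of the gradient is at most `5 Tr C |x|²` in absolute value, so the
shifted matrix is positive semidefinite with spectrum in `[0, 10 Tr C]`. On such a matrix the power
method comes within a factor `1 - δ` of the top eigenvalue without any spectral gap, as long as the
start is not almost orthogonal to a top eigenvector (`power_rayleigh`). For a Gaussian start a
Chernoff bound controls that event (`gaussian_coordinate_small`). With `δ = 0.024 ε / n` a call is
accurate up to `0.24 ε Tr C`, except with probability at most `0.76 ε / T` (`oracleAccurate_prob`).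

Frank-Wolfe: LogSumExp is convex by Jensen's inequality, and smooth in the sup norm with constant
`M` by Hoeffding's lemma. If all calls are accurate, the usual induction gives error `(0.24 + 0.5) ε
Tr C` after `⌊T⌋` steps, while an early stop gives `(κ + 0.24) ε Tr C` (`covariance_approxOptimal`).
A union bound over the calls costs `0.76 ε`.

Rounding: the covariances and the stopping time are functions of the oracle's random starts alone.
Conditionally on these starts the returned sample is therefore exactly Gaussian with covariance `X̂`
(`isCentredGaussian_signArgument`), and the rounding noise completes it to a Gaussian vector with
unit variances. Sheppard's formula and the inequality defining `alphaGW` bound the expected cut by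
the correlation matrix (`IsGaussianVector.goemansWilliamson`). The penalty pays for the division by
the largest variance (`isApproxOptimal_trace_ge`), which leaves a factor `1 - 2.24 ε`. Bad starts do
no harm because `C` is positive semidefinite, and `(1 - 0.76 ε)(1 - 2.24 ε) ≥ 1 - 3 ε`.

Program: the gap needs `X_t` only through its diagonal and the number `⟨C, X_t⟩`, and both satisfy
the Frank-Wolfe recursion. Hence three vector registers suffice. -/

theorem exists_orthogonal_diagonalization {n : ℕ} {A : Matrix (Fin n) (Fin n) ℝ} (hA : A.IsSymm) :
    ∃ (U : Matrix (Fin n) (Fin n) ℝ) (μ : Fin n → ℝ),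
      Uᵀ * U = 1 ∧ U * Uᵀ = 1 ∧ A = U * diagonal μ * Uᵀ := by
  have hH : A.IsHermitian := by
    rw [Matrix.IsHermitian, conjTranspose_eq_transpose_of_trivial]; exact hA
  refine ⟨hH.eigenvectorUnitary, hH.eigenvalues, ?_, ?_, ?_⟩
  · have := Unitary.coe_star_mul_self hH.eigenvectorUnitary
    rwa [star_eq_conjTranspose, conjTranspose_eq_transpose_of_trivial] at this
  · have := Unitary.coe_mul_star_self hH.eigenvectorUnitary
    rwa [Unitary.coe_star, star_eq_conjTranspose, conjTranspose_eq_transpose_of_trivial] at this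
  · conv_lhs => rw [hH.spectral_theorem, Unitary.conjStarAlgAut_apply]
    rw [star_eq_conjTranspose, conjTranspose_eq_transpose_of_trivial]
    rfl

theorem diagonalization_pow {n : ℕ} {A U : Matrix (Fin n) (Fin n) ℝ} {μ : Fin n → ℝ}
    (hU : Uᵀ * U = 1) (hU' : U * Uᵀ = 1) (hA : A = U * diagonal μ * Uᵀ) (m : ℕ) :
    A ^ m = U * diagonal (fun i => μ i ^ m) * Uᵀ := by
  induction m with
  | zero => simp [hU']
  | succ m ih =>
    rw [pow_succ, ih, hA]
    calc U * diagonal (fun i => μ i ^ m) * Uᵀ * (U * diagonal μ * Uᵀ)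
        = U * diagonal (fun i => μ i ^ m) * (Uᵀ * U) * diagonal μ * Uᵀ := by
          simp only [Matrix.mul_assoc]
      _ = _ := by
          rw [hU, Matrix.mul_one, Matrix.mul_assoc U, diagonal_mul_diagonal]
          simp only [pow_succ]

theorem quadForm_diagonalization {n : ℕ} (U : Matrix (Fin n) (Fin n) ℝ) (μ x : Fin n → ℝ) :
    x ⬝ᵥ (U * diagonal μ * Uᵀ) *ᵥ x = ∑ i, μ i * (Uᵀ *ᵥ x) i ^ 2 := by
  rw [← mulVec_mulVec, ← mulVec_mulVec, dotProduct_mulVec, ← mulVec_transpose, dotProduct]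
  refine Finset.sum_congr rfl fun i _ => ?_
  rw [mulVec_diagonal]
  ring

theorem sum_sq_transpose_mulVec {n : ℕ} {U : Matrix (Fin n) (Fin n) ℝ} (hU' : U * Uᵀ = 1)
    (x : Fin n → ℝ) : ∑ i, (Uᵀ *ᵥ x) i ^ 2 = x ⬝ᵥ x := by
  have h := quadForm_diagonalization U (fun _ => 1) x
  rw [show diagonal (fun _ : Fin n => (1 : ℝ)) = 1 from diagonal_one, Matrix.mul_one, hU',
    one_mulVec] at h
  simp [h]

theorem pow_mulVec_dotProduct {n : ℕ} {A : Matrix (Fin n) (Fin n) ℝ} (hA : A.IsSymm) (K : ℕ)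
    (x y : Fin n → ℝ) : (A ^ K *ᵥ x) ⬝ᵥ y = x ⬝ᵥ A ^ K *ᵥ y := by
  have h : (A ^ K)ᵀ = A ^ K := by rw [transpose_pow, hA.eq]
  rw [dotProduct_comm, dotProduct_mulVec, ← mulVec_transpose, h, dotProduct_comm]

/-- The Rayleigh quotient reached by the power method on a positive semidefinite matrix. -/
theorem power_rayleigh {n : ℕ} {A U : Matrix (Fin n) (Fin n) ℝ} {μ : Fin n → ℝ}
    (hU : Uᵀ * U = 1) (hU' : U * Uᵀ = 1) (hA : A = U * diagonal μ * Uᵀ) (hμ : ∀ i, 0 ≤ μ i)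
    {k : Fin n} {K : ℕ} {δ r : ℝ} (hδ1 : δ ≤ 1)
    (hr : (1 - δ) ^ (2 * K + 1) ≤ r * δ) (b : Fin n → ℝ)
    (hb : r * ∑ i ∈ Finset.univ.erase k, (Uᵀ *ᵥ b) i ^ 2 ≤ (Uᵀ *ᵥ b) k ^ 2) (hδ : 0 < δ) :
    (1 - δ) * μ k * ((A ^ K *ᵥ b) ⬝ᵥ (A ^ K *ᵥ b)) ≤ (A ^ K *ᵥ b) ⬝ᵥ A *ᵥ (A ^ K *ᵥ b) := by
  have hsymm : A.IsSymm := by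
    rw [hA, Matrix.IsSymm, transpose_mul, transpose_mul, diagonal_transpose, transpose_transpose,
      Matrix.mul_assoc]
  set c := Uᵀ *ᵥ b with hc
  have h1 : (A ^ K *ᵥ b) ⬝ᵥ (A ^ K *ᵥ b) = ∑ i, μ i ^ (2 * K) * c i ^ 2 := by
    rw [pow_mulVec_dotProduct hsymm, mulVec_mulVec, ← pow_add, diagonalization_pow hU hU' hA,
      quadForm_diagonalization]
    simp only [two_mul]
    rfl
  have h2 : (A ^ K *ᵥ b) ⬝ᵥ A *ᵥ (A ^ K *ᵥ b) = ∑ i, μ i ^ (2 * K + 1) * c i ^ 2 := by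
    rw [pow_mulVec_dotProduct hsymm, mulVec_mulVec, mulVec_mulVec, ← pow_succ, ← pow_add,
      diagonalization_pow hU hU' hA, quadForm_diagonalization]
    rw [show K + 1 + K = 2 * K + 1 by ring]
  have hδ0 : 0 ≤ 1 - δ := by linarith
  -- Coordinates with `μ i ≥ (1 - δ) μ k` contribute nonnegatively. For the others both powers are
  -- bounded by powers of `(1 - δ) μ k`, so no gap between eigenvalues is needed.
  have hterm : ∀ i, -(((1 - δ) * μ k) ^ (2 * K + 1)) * c i ^ 2 ≤
      μ i ^ (2 * K + 1) * c i ^ 2 - (1 - δ) * μ k * (μ i ^ (2 * K) * c i ^ 2) := by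
    intro i
    have hm : 0 ≤ (1 - δ) * μ k := mul_nonneg hδ0 (hμ k)
    have : -(((1 - δ) * μ k) ^ (2 * K + 1)) ≤ μ i ^ (2 * K) * (μ i - (1 - δ) * μ k) := by
      have hp := pow_nonneg (hμ i) (2 * K)
      rcases le_total ((1 - δ) * μ k) (μ i) with h | h
      · have := mul_nonneg hp (sub_nonneg.2 h)
        have := pow_nonneg hm (2 * K + 1)
        linarith
      · have h3 : μ i ^ (2 * K) ≤ ((1 - δ) * μ k) ^ (2 * K) := pow_le_pow_left₀ (hμ i) h _
        have h4 : μ i ^ (2 * K) * ((1 - δ) * μ k) ≤ ((1 - δ) * μ k) ^ (2 * K) * ((1 - δ) * μ k) :=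
          mul_le_mul_of_nonneg_right h3 hm
        have h5 := mul_nonneg hp (hμ i)
        rw [pow_succ]
        linarith
    have := mul_le_mul_of_nonneg_right this (sq_nonneg (c i))
    rw [pow_succ (μ i)]
    linarith
  rw [h1, h2, Finset.mul_sum, ← sub_nonneg, ← Finset.sum_sub_distrib,
    ← Finset.add_sum_erase _ _ (Finset.mem_univ k)]
  have hs := Finset.sum_le_sum fun i (_ : i ∈ Finset.univ.erase k) => hterm i
  rw [← Finset.mul_sum] at hs
  set S := ∑ i ∈ Finset.univ.erase k, c i ^ 2
  have hS : 0 ≤ S := Finset.sum_nonneg fun i _ => sq_nonneg _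
  have hmk : 0 ≤ μ k ^ (2 * K + 1) := pow_nonneg (hμ k) _
  -- Coordinate `k` gains `δ μ k ^ (2K+1) (c k)²`, which pays for the losses of all the others.
  have h6 : (1 - δ) ^ (2 * K + 1) * S ≤ δ * c k ^ 2 := by
    calc (1 - δ) ^ (2 * K + 1) * S ≤ r * δ * S := mul_le_mul_of_nonneg_right hr hS
      _ = δ * (r * S) := by ring
      _ ≤ δ * c k ^ 2 := mul_le_mul_of_nonneg_left hb hδ.le
  have h7 := mul_le_mul_of_nonneg_left h6 hmk
  have h8 : ((1 - δ) * μ k) ^ (2 * K + 1) * S = μ k ^ (2 * K + 1) * ((1 - δ) ^ (2 * K + 1) * S) := by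
    rw [mul_pow]; ring
  have h9 : μ k ^ (2 * K + 1) * c k ^ 2 - (1 - δ) * μ k * (μ k ^ (2 * K) * c k ^ 2) =
      μ k ^ (2 * K + 1) * (δ * c k ^ 2) := by rw [pow_succ]; ring
  rw [h9]
  linarith

theorem power_ne_zero {n : ℕ} {A U : Matrix (Fin n) (Fin n) ℝ} {μ : Fin n → ℝ}
    (hU : Uᵀ * U = 1) (hU' : U * Uᵀ = 1) (hA : A = U * diagonal μ * Uᵀ) {k : Fin n}
    (hk : 0 < μ k) (K : ℕ) {b : Fin n → ℝ} (hb : (Uᵀ *ᵥ b) k ≠ 0) :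
    0 < (A ^ K *ᵥ b) ⬝ᵥ (A ^ K *ᵥ b) := by
  have h : Uᵀ *ᵥ (A ^ K *ᵥ b) = fun i => μ i ^ K * (Uᵀ *ᵥ b) i := by
    rw [diagonalization_pow hU hU' hA, mulVec_mulVec, Matrix.mul_assoc U, ← Matrix.mul_assoc, hU,
      Matrix.one_mul, ← mulVec_mulVec]
    ext i
    rw [mulVec_diagonal]
  rw [← sum_sq_transpose_mulVec hU', h]
  refine Finset.sum_pos' (fun i _ => sq_nonneg _) ⟨k, Finset.mem_univ _, ?_⟩
  have := hk.ne'
  positivity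

/-- In the eigenbasis the trace is a combination of the eigenvalues whose weights, the diagonal
entries of `Uᵀ Y U`, are nonnegative and sum to `Tr Y`. -/
theorem trace_mul_le_of_diagonalization {n : ℕ} {A U : Matrix (Fin n) (Fin n) ℝ} {μ : Fin n → ℝ}
    (hU' : U * Uᵀ = 1) (hA : A = U * diagonal μ * Uᵀ) {m : ℝ}
    (hm : ∀ i, μ i ≤ m) {Y : Matrix (Fin n) (Fin n) ℝ} (hY : Y.PosSemidef) :
    (A * Y).trace ≤ m * Y.trace := by
  have hP : (Uᵀ * Y * U).PosSemidef := by
    have := hY.conjTranspose_mul_mul_same U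
    rwa [conjTranspose_eq_transpose_of_trivial] at this
  have h1 : (A * Y).trace = ∑ i, μ i * (Uᵀ * Y * U) i i := by
    have : (A * Y).trace = (diagonal μ * (Uᵀ * Y * U)).trace := by
      rw [hA, Matrix.mul_assoc, Matrix.mul_assoc, trace_mul_comm]
      simp only [Matrix.mul_assoc]
    rw [this]
    simp [Matrix.trace, diagonal_mul]
  have h2 : Y.trace = ∑ i, (Uᵀ * Y * U) i i := by
    have : Y.trace = (Uᵀ * Y * U).trace := by
      rw [trace_mul_comm, ← Matrix.mul_assoc, hU', Matrix.one_mul]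
    exact this
  rw [h1, h2, Finset.mul_sum]
  exact Finset.sum_le_sum fun i _ => mul_le_mul_of_nonneg_right (hm i) hP.diag_nonneg

/-! ### Diagonally dominant matrices -/

section DiagDominant

variable {n : ℕ} {C : Matrix (Fin n) (Fin n) ℝ}

theorem IsDiagDominant.diag_nonneg (hC : IsDiagDominant C) (i : Fin n) : 0 ≤ C i i :=
  (Finset.sum_nonneg fun _ _ => abs_nonneg _).trans (hC.2 i)

theorem IsDiagDominant.trace_nonneg (hC : IsDiagDominant C) : 0 ≤ C.trace :=
  Finset.sum_nonneg fun i _ => hC.diag_nonneg i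

/-- Symmetry moves the entry to row `j`, where dominance is applied. Bounding a row by the diagonal
entries of its columns is what later compares a whole row with the trace. -/
theorem IsDiagDominant.abs_entry_le (hC : IsDiagDominant C) {i j : Fin n} (hij : i ≠ j) :
    |C i j| ≤ C j j := by
  have h := hC.2 j
  rw [← hC.1.apply i j]
  exact (Finset.single_le_sum (f := fun i => |C j i|) (fun _ _ => abs_nonneg _)
    (Finset.mem_erase.2 ⟨hij, Finset.mem_univ i⟩)).trans h

theorem quadForm_eq_sum (A : Matrix (Fin n) (Fin n) ℝ) (x : Fin n → ℝ) :
    x ⬝ᵥ A *ᵥ x = ∑ i, ∑ j, A i j * (x i * x j) := by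
  simp only [dotProduct, mulVec, Finset.mul_sum]
  exact Finset.sum_congr rfl fun i _ => Finset.sum_congr rfl fun j _ => by ring

/-- Sum over all entries of `C`, split into diagonal and off-diagonal part. -/
theorem sum_sum_eq_diag_add (f : Fin n → Fin n → ℝ) :
    ∑ i, ∑ j, f i j = ∑ i, (f i i + ∑ j ∈ Finset.univ.erase i, f i j) :=
  Finset.sum_congr rfl fun i _ => (Finset.add_sum_erase _ _ (Finset.mem_univ i)).symm

/-- Each `|x i * x j|` is split by the arithmetic-geometric mean inequality, and symmetry of `C`
turns both halves into the same sum. -/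
theorem IsDiagDominant.sum_abs_mul_le (hC : IsDiagDominant C) (x : Fin n → ℝ) :
    |∑ i, ∑ j ∈ Finset.univ.erase i, C i j * (x i * x j)| ≤
      ∑ i, (∑ j ∈ Finset.univ.erase i, |C i j|) * x i ^ 2 := by
  have h1 : |∑ i, ∑ j ∈ Finset.univ.erase i, C i j * (x i * x j)| ≤
      ∑ i, ∑ j ∈ Finset.univ.erase i, (|C i j| * x i ^ 2 / 2 + |C i j| * x j ^ 2 / 2) := by
    refine (Finset.abs_sum_le_sum_abs _ _).trans (Finset.sum_le_sum fun i _ => ?_)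
    refine (Finset.abs_sum_le_sum_abs _ _).trans (Finset.sum_le_sum fun j _ => ?_)
    rw [abs_mul]
    have : |x i * x j| ≤ (x i ^ 2 + x j ^ 2) / 2 := by
      rw [abs_le]; constructor <;> nlinarith [sq_nonneg (x i + x j), sq_nonneg (x i - x j)]
    have := mul_le_mul_of_nonneg_left this (abs_nonneg (C i j))
    linarith
  have h2 : ∑ i, ∑ j ∈ Finset.univ.erase i, |C i j| * x j ^ 2 / 2 =
      ∑ i, ∑ j ∈ Finset.univ.erase i, |C i j| * x i ^ 2 / 2 := by
    rw [Finset.sum_comm' (t' := Finset.univ) (s' := fun j => Finset.univ.erase j)]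
    · refine Finset.sum_congr rfl fun i _ => Finset.sum_congr rfl fun j _ => ?_
      rw [hC.1.apply]
    · intro i j; simp [eq_comm, and_comm]
  refine h1.trans (le_of_eq ?_)
  simp only [Finset.sum_add_distrib]
  rw [h2, ← Finset.sum_add_distrib]
  refine Finset.sum_congr rfl fun i _ => ?_
  rw [← Finset.sum_add_distrib, Finset.sum_mul]
  exact Finset.sum_congr rfl fun j _ => by ring

theorem IsDiagDominant.quadForm_nonneg (hC : IsDiagDominant C) (x : Fin n → ℝ) :
    0 ≤ x ⬝ᵥ C *ᵥ x := by
  rw [quadForm_eq_sum, sum_sum_eq_diag_add, Finset.sum_add_distrib]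
  have h1 := (abs_le.1 (hC.sum_abs_mul_le x)).1
  have h2 : ∑ i, (∑ j ∈ Finset.univ.erase i, |C i j|) * x i ^ 2 ≤ ∑ i, C i i * (x i * x i) :=
    Finset.sum_le_sum fun i _ => by
      rw [← sq]; exact mul_le_mul_of_nonneg_right (hC.2 i) (sq_nonneg _)
  linarith

theorem IsDiagDominant.quadForm_le (hC : IsDiagDominant C) (x : Fin n → ℝ) :
    x ⬝ᵥ C *ᵥ x ≤ C.trace * (x ⬝ᵥ x) := by
  rw [quadForm_eq_sum, sum_sum_eq_diag_add, Finset.sum_add_distrib]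
  have h1 := (abs_le.1 (hC.sum_abs_mul_le x)).2
  have h2 : ∑ i, (C i i * (x i * x i) + (∑ j ∈ Finset.univ.erase i, |C i j|) * x i ^ 2) ≤
      C.trace * (x ⬝ᵥ x) := by
    rw [dotProduct, Finset.mul_sum]
    refine Finset.sum_le_sum fun i _ => ?_
    -- Every off-diagonal entry of row `i` is bounded by the diagonal entry of its own column, so
    -- the whole row is bounded by the trace.
    have : C i i + ∑ j ∈ Finset.univ.erase i, |C i j| ≤ C.trace := by
      rw [Matrix.trace, ← Finset.add_sum_erase _ _ (Finset.mem_univ i)]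
      exact add_le_add le_rfl (Finset.sum_le_sum fun j hj => hC.abs_entry_le (Finset.ne_of_mem_erase hj).symm)
    have := mul_le_mul_of_nonneg_right this (sq_nonneg (x i))
    linarith
  rw [Finset.sum_add_distrib] at h2
  linarith

theorem IsDiagDominant.sum_abs_le (hC : IsDiagDominant C) :
    ∑ i, ∑ j, |C i j| ≤ 2 * C.trace := by
  rw [sum_sum_eq_diag_add, Matrix.trace, Finset.mul_sum]
  refine Finset.sum_le_sum fun i _ => ?_
  rw [abs_of_nonneg (hC.diag_nonneg i)]
  have := hC.2 i
  simp only [diag_apply]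
  linarith

end DiagDominant

/-! ### The shifted gradient -/

theorem expSum_eq_sum {n : ℕ} (M : ℝ) (x : Fin n → ℝ) :
    expSum M x = ∑ i, (Real.exp (M * x i) + Real.exp (M * -x i)) := by
  rw [expSum, Finset.sum_add_distrib]

theorem abs_lseGrad_le_one {n : ℕ} (M : ℝ) (x : Fin n → ℝ) (i : Fin n) : |lseGrad M x i| ≤ 1 := by
  have hpos : 0 < expSum M x := expSum_pos (Fin.pos i) M x
  rw [lseGrad, abs_div, abs_of_pos hpos, div_le_one hpos, expSum_eq_sum]
  have h1 := Finset.single_le_sum (f := fun i => Real.exp (M * x i) + Real.exp (M * -x i))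
    (fun i _ => by positivity) (Finset.mem_univ i)
  refine le_trans ?_ h1
  have := Real.exp_pos (M * x i)
  have := Real.exp_pos (M * -x i)
  rw [abs_le]
  constructor <;> linarith

section Gradient

variable {n : ℕ} {C : Matrix (Fin n) (Fin n) ℝ}

theorem gradMatrix_isSymm (hC : IsDiagDominant C) (ε : ℝ) (v : Fin n → ℝ) :
    (gradMatrix C ε v).IsSymm := by
  rw [Matrix.IsSymm, gradMatrix, transpose_sub, transpose_smul, diagonal_transpose, hC.1.eq]

theorem quadForm_gradMatrix (C : Matrix (Fin n) (Fin n) ℝ) (ε : ℝ) (v x : Fin n → ℝ) :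
    x ⬝ᵥ gradMatrix C ε v *ᵥ x = x ⬝ᵥ C *ᵥ x -
      penaltyBeta C * ∑ i, lseGrad (penaltyM n ε) (v - 1) i * x i ^ 2 := by
  rw [gradMatrix, sub_mulVec, dotProduct_sub, smul_mulVec, dotProduct_smul, smul_eq_mul]
  congr 2
  simp only [dotProduct, mulVec_diagonal]
  exact Finset.sum_congr rfl fun i _ => by ring

/-- `C` contributes between `0` and `Tr C |x|²`, and the penalty at most `4 Tr C |x|²` in absolute
value because its gradient has coordinates in `[-1, 1]`. This explains the shift `5 Tr C`. -/
theorem abs_quadForm_gradMatrix_le (hC : IsDiagDominant C) (ε : ℝ) (v x : Fin n → ℝ) :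
    |x ⬝ᵥ gradMatrix C ε v *ᵥ x| ≤ 5 * C.trace * (x ⬝ᵥ x) := by
  have h1 : |∑ i, lseGrad (penaltyM n ε) (v - 1) i * x i ^ 2| ≤ x ⬝ᵥ x := by
    refine (Finset.abs_sum_le_sum_abs _ _).trans (Finset.sum_le_sum fun i _ => ?_)
    rw [abs_mul, abs_of_nonneg (sq_nonneg (x i)), ← sq]
    exact mul_le_of_le_one_left (sq_nonneg _) (abs_lseGrad_le_one _ _ _)
  have h2 := hC.quadForm_nonneg x
  have h3 := hC.quadForm_le x
  have h4 := hC.trace_nonneg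
  rw [quadForm_gradMatrix, penaltyBeta]
  obtain ⟨h5, h6⟩ := abs_le.1 h1
  have h7 := mul_le_mul_of_nonneg_left h5 h4
  have h8 := mul_le_mul_of_nonneg_left h6 h4
  rw [abs_le]
  constructor <;> nlinarith

theorem trace_transpose_mul_direction (A : Matrix (Fin n) (Fin n) ℝ) (w : Fin n → ℝ) :
    (Aᵀ * direction w).trace = n * (w ⬝ᵥ A *ᵥ w) := by
  rw [direction, Matrix.mul_smul, trace_smul, smul_eq_mul]
  congr 1
  rw [mul_vecMulVec, trace_vecMulVec, dotProduct_mulVec, mulVec_transpose]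

theorem direction_posSemidef (w : Fin n → ℝ) : (direction w).PosSemidef := by
  have := posSemidef_vecMulVec_self_star w
  rw [star_trivial] at this
  exact this.smul (Nat.cast_nonneg n)

theorem lmo_quadForm_nonneg (C : Matrix (Fin n) (Fin n) ℝ) (ε : ℝ) (v b : Fin n → ℝ) :
    0 ≤ lmo C ε v b ⬝ᵥ gradMatrix C ε v *ᵥ lmo C ε v b := by
  unfold lmo
  simp only
  split_ifs with h
  · exact h
  · simp

theorem quadForm_powerVector_le_lmo (C : Matrix (Fin n) (Fin n) ℝ) (ε : ℝ) (v b : Fin n → ℝ) :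
    powerVector C ε v b ⬝ᵥ gradMatrix C ε v *ᵥ powerVector C ε v b ≤
      lmo C ε v b ⬝ᵥ gradMatrix C ε v *ᵥ lmo C ε v b := by
  unfold lmo
  simp only
  split_ifs with h
  · exact le_rfl
  · simpa using (not_le.1 h).le

/-- Only an inequality: if the power method returns zero, the inverse of the norm is `0` and so is
the normalised vector. -/
theorem powerVector_dotProduct_self_le (C : Matrix (Fin n) (Fin n) ℝ) (ε : ℝ) (v b : Fin n → ℝ) :
    powerVector C ε v b ⬝ᵥ powerVector C ε v b ≤ 1 := by
  unfold powerVector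
  simp only
  generalize ((gradMatrix C ε v + (5 * C.trace) • (1 : Matrix (Fin n) (Fin n) ℝ)) ^
    powerSteps n ε) *ᵥ b = y
  have hy : 0 ≤ y ⬝ᵥ y := Finset.sum_nonneg fun i _ => mul_self_nonneg _
  rw [smul_dotProduct, dotProduct_smul, smul_eq_mul, smul_eq_mul, ← mul_assoc, ← mul_inv,
    Real.mul_self_sqrt hy]
  exact inv_mul_le_one

theorem lmo_dotProduct_self_le (C : Matrix (Fin n) (Fin n) ℝ) (ε : ℝ) (v b : Fin n → ℝ) :
    lmo C ε v b ⬝ᵥ lmo C ε v b ≤ 1 := by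
  unfold lmo
  simp only
  split_ifs with h
  · exact powerVector_dotProduct_self_le C ε v b
  · simp

theorem direction_lmo_feasible (C : Matrix (Fin n) (Fin n) ℝ) (ε : ℝ) (v b : Fin n → ℝ) :
    Feasible (direction (lmo C ε v b)) := by
  refine ⟨direction_posSemidef _, ?_⟩
  have h := trace_transpose_mul_direction 1 (lmo C ε v b)
  rw [transpose_one, Matrix.one_mul, one_mulVec] at h
  rw [h]
  exact mul_le_of_le_one_right (Nat.cast_nonneg n) (lmo_dotProduct_self_le C ε v b)

/-- The direction returned for the gradient at `v` with random start `b` is optimal up to `δ`. -/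
def OracleAccurate (C : Matrix (Fin n) (Fin n) ℝ) (ε δ : ℝ) (v b : Fin n → ℝ) : Prop :=
  ∀ Y, Feasible Y → ((gradMatrix C ε v)ᵀ * Y).trace - δ ≤
    ((gradMatrix C ε v)ᵀ * direction (lmo C ε v b)).trace

/-- Outside of an event for an orthogonal image of the random start, the oracle is accurate. -/
theorem exists_orthogonal_oracleAccurate (hn : 0 < n) (hC : IsDiagDominant C) (ε : ℝ)
    (v : Fin n → ℝ) {δ r : ℝ} (hδ : 0 < δ) (hδ1 : δ ≤ 1)
    (hr : (1 - δ) ^ (2 * powerSteps n ε + 1) ≤ r * δ) (hr0 : 0 < r) :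
    ∃ (U : Matrix (Fin n) (Fin n) ℝ) (k : Fin n), Uᵀ * U = 1 ∧ U * Uᵀ = 1 ∧
      ∀ b, r * ∑ i ∈ Finset.univ.erase k, (Uᵀ *ᵥ b) i ^ 2 < (Uᵀ *ᵥ b) k ^ 2 →
        OracleAccurate C ε (10 * n * δ * C.trace) v b := by
  set J := gradMatrix C ε v with hJ
  set s := 5 * C.trace with hs
  set A := J + s • (1 : Matrix (Fin n) (Fin n) ℝ) with hAdef
  have hJs : J.IsSymm := gradMatrix_isSymm hC ε v
  have hAs : A.IsSymm := by
    rw [Matrix.IsSymm, hAdef, transpose_add, transpose_smul, transpose_one, hJs.eq]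
  obtain ⟨U, μ, hU, hU', hA⟩ := exists_orthogonal_diagonalization hAs
  have hquad : ∀ x, x ⬝ᵥ A *ᵥ x = x ⬝ᵥ J *ᵥ x + s * (x ⬝ᵥ x) := fun x => by
    rw [hAdef, add_mulVec, dotProduct_add, smul_mulVec, one_mulVec, dotProduct_smul, smul_eq_mul]
  -- Testing the bound on the quadratic form of `J` with the eigenvectors `U *ᵥ Pi.single i 1`.
  have hev : ∀ i, 0 ≤ μ i ∧ μ i ≤ 2 * s := fun i => by
    have h1 := quadForm_diagonalization U μ (U *ᵥ Pi.single i 1)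
    have h2 := sum_sq_transpose_mulVec hU' (U *ᵥ Pi.single i 1)
    have h0 : Uᵀ *ᵥ (U *ᵥ Pi.single i 1) = Pi.single i 1 := by
      rw [mulVec_mulVec, hU, one_mulVec]
    rw [h0] at h1 h2
    rw [← hA, hquad] at h1
    have h3 := abs_le.1 (abs_quadForm_gradMatrix_le hC ε v (U *ᵥ Pi.single i 1))
    rw [← hJ, ← hs] at h3
    simp only [Pi.single_apply, ite_pow, one_pow, ne_eq, OfNat.ofNat_ne_zero, not_false_eq_true,
      zero_pow, mul_ite, mul_one, mul_zero, Finset.sum_ite_eq', Finset.mem_univ, if_true] at h1 h2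
    rw [← h2] at h1 h3
    constructor <;> linarith [h3.1, h3.2]
  have : Nonempty (Fin n) := ⟨⟨0, hn⟩⟩
  obtain ⟨k, hk⟩ := Finite.exists_max μ
  refine ⟨U, k, hU, hU', fun b hb Y hY => ?_⟩
  have hJY : (J * Y).trace ≤ (μ k - s) * Y.trace := by
    have h1 := trace_mul_le_of_diagonalization hU' hA hk hY.1
    rw [hAdef, Matrix.add_mul, trace_add, Matrix.smul_mul, Matrix.one_mul, trace_smul,
      smul_eq_mul] at h1
    linarith
  have htr : 0 ≤ Y.trace := hY.1.trace_nonneg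
  have hs0 : 0 ≤ s := mul_nonneg (by norm_num) hC.trace_nonneg
  have hn' : (0 : ℝ) ≤ n := Nat.cast_nonneg n
  rw [trace_transpose_mul_direction, ← hJ, hJs.eq]
  -- If the gradient has no positive eigenvalue, its pairing with every feasible matrix is at most
  -- `0`, and the truncated oracle is never negative.
  rcases le_or_gt (μ k) s with hks | hks
  · have h1 := mul_nonneg hn' (lmo_quadForm_nonneg C ε v b)
    have h2 : (μ k - s) * Y.trace ≤ 0 := mul_nonpos_of_nonpos_of_nonneg (by linarith) htr
    have h3 : 0 ≤ 10 * n * δ * C.trace := by have := hC.trace_nonneg; positivity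
    rw [← hJ] at h1
    linarith
  · have hk0 : 0 < μ k := hs0.trans_lt hks
    have hck : (Uᵀ *ᵥ b) k ≠ 0 := fun h => by
      rw [h] at hb
      have : 0 ≤ r * ∑ i ∈ Finset.univ.erase k, (Uᵀ *ᵥ b) i ^ 2 :=
        mul_nonneg hr0.le (Finset.sum_nonneg fun _ _ => sq_nonneg _)
      linarith [zero_pow (M₀ := ℝ) (two_ne_zero)]
    have h1 := power_rayleigh hU hU' hA (fun i => (hev i).1) hδ1 hr b hb.le hδ
    have h2 := power_ne_zero hU hU' hA hk0 (powerSteps n ε) hck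
    have h3 : (1 - δ) * μ k ≤ powerVector C ε v b ⬝ᵥ A *ᵥ powerVector C ε v b ∧
        powerVector C ε v b ⬝ᵥ powerVector C ε v b = 1 := by
      unfold powerVector
      simp only [← hJ, ← hs, ← hAdef]
      set y := A ^ powerSteps n ε *ᵥ b
      have hq : (√(y ⬝ᵥ y))⁻¹ * (√(y ⬝ᵥ y))⁻¹ = (y ⬝ᵥ y)⁻¹ := by
        rw [← mul_inv, Real.mul_self_sqrt h2.le]
      rw [mulVec_smul, smul_dotProduct, dotProduct_smul, smul_dotProduct, dotProduct_smul]
      simp only [smul_eq_mul, ← mul_assoc]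
      rw [hq]
      refine ⟨?_, inv_mul_cancel₀ h2.ne'⟩
      rw [inv_mul_eq_div, le_div_iff₀ h2]
      exact h1
    have h4 := quadForm_powerVector_le_lmo C ε v b
    rw [hquad, h3.2] at h3
    have h5 : (J * Y).trace ≤ (μ k - s) * n :=
      hJY.trans (mul_le_mul_of_nonneg_left hY.2 (by linarith))
    have h6 : n * ((1 - δ) * μ k - s) ≤ n * (lmo C ε v b ⬝ᵥ J *ᵥ lmo C ε v b) :=
      mul_le_mul_of_nonneg_left (by rw [← hJ] at h4; linarith [h3.1]) hn'
    -- The relative error `δ` refers to the shifted eigenvalue, which is at most `2 s = 10 Tr C`;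
    -- hence the accuracy `10 n δ Tr C`.
    have h7 : n * δ * μ k ≤ n * δ * (2 * s) :=
      mul_le_mul_of_nonneg_left (hev k).2 (by positivity)
    rw [hs] at *
    linarith

end Gradient

end MaxCutFW

namespace MaxCutFW

/-! ### Standard Gaussian vectors -/

/-- Rotation invariance: the coordinates of the random start in an eigenbasis are again independent
standard Gaussians. -/
theorem pi_gaussian_map_orthogonal {n : ℕ} {U : Matrix (Fin n) (Fin n) ℝ} (hU' : U * Uᵀ = 1) :
    (Measure.pi fun _ : Fin n => gaussianReal 0 1).map (fun b => Uᵀ *ᵥ b) =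
      Measure.pi fun _ : Fin n => gaussianReal 0 1 := by
  let f : EuclideanSpace ℝ (Fin n) →ₗᵢ[ℝ] EuclideanSpace ℝ (Fin n) :=
    { toLinearMap := toLpLin 2 2 Uᵀ
      norm_map' := fun x => by
        rw [← sq_eq_sq₀ (norm_nonneg _) (norm_nonneg _), EuclideanSpace.real_norm_sq_eq,
          EuclideanSpace.real_norm_sq_eq]
        have := sum_sq_transpose_mulVec hU' (WithLp.ofLp x)
        rw [dotProduct] at this
        simp only [← sq] at this
        exact this }
  let g := f.toLinearIsometryEquiv rfl
  have h1 : (stdGaussian (EuclideanSpace ℝ (Fin n))).map g = stdGaussian _ := stdGaussian_map g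
  have hm : Measurable (fun b : Fin n → ℝ => Uᵀ *ᵥ b) :=
    (Continuous.matrix_mulVec continuous_const continuous_id).measurable
  have hcomp : g ∘ (WithLp.toLp 2 : (Fin n → ℝ) → EuclideanSpace ℝ (Fin n)) =
      WithLp.toLp 2 ∘ fun b => Uᵀ *ᵥ b := rfl
  rw [← map_pi_eq_stdGaussian, Measure.map_map (by fun_prop) (by fun_prop), hcomp,
    ← Measure.map_map (by fun_prop) hm] at h1
  have h2 := congrArg (fun μ => Measure.map WithLp.ofLp μ) h1
  simp only at h2
  rw [Measure.map_map (by fun_prop) (by fun_prop), Measure.map_map (by fun_prop) (by fun_prop)] at h2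
  rw [Measure.map_map (by fun_prop) (by fun_prop)] at h2
  simpa [Function.comp_def, Measure.map_id'] using h2

theorem exp_mul_sq_mul_gaussianPDF (a x : ℝ) :
    gaussianPDFReal 0 1 x • Real.exp (a * x ^ 2) =
      (√(2 * Real.pi))⁻¹ * Real.exp (-(1 / 2 - a) * x ^ 2) := by
  rw [gaussianPDFReal, smul_eq_mul, mul_assoc, ← Real.exp_add]
  simp only [NNReal.coe_one, mul_one, sub_zero]
  congr 2
  ring

theorem integral_exp_mul_sq_gaussian {a : ℝ} (ha : a < 1 / 2) :
    ∫ x, Real.exp (a * x ^ 2) ∂gaussianReal 0 1 = (√(1 - 2 * a))⁻¹ := by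
  rw [integral_gaussianReal_eq_integral_smul one_ne_zero]
  simp only [exp_mul_sq_mul_gaussianPDF]
  rw [integral_const_mul, integral_gaussian, ← Real.sqrt_inv, ← Real.sqrt_inv, ← Real.sqrt_mul']
  · congr 1
    have := Real.pi_pos
    have h : 1 / 2 - a ≠ 0 := by linarith
    have h' : 1 - 2 * a ≠ 0 := by intro h2; apply h; linarith
    field_simp
  · have := Real.pi_pos
    have h : 0 < 1 / 2 - a := by linarith
    positivity

theorem integrable_exp_mul_sq_gaussian {a : ℝ} (ha : a < 1 / 2) :
    Integrable (fun x => Real.exp (a * x ^ 2)) (gaussianReal 0 1) := by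
  rw [gaussianReal_of_var_ne_zero _ one_ne_zero, integrable_withDensity_iff_integrable_smul']
  · simp only [toReal_gaussianPDF, exp_mul_sq_mul_gaussianPDF]
    exact (integrable_exp_neg_mul_sq (by linarith)).const_mul _
  · exact measurable_gaussianPDF _ _
  · exact Filter.Eventually.of_forall fun x => gaussianPDF_lt_top

/-- A single coordinate of a standard Gaussian vector is rarely small compared with the others. -/
theorem gaussian_coordinate_small {n : ℕ} (k : Fin n) {r : ℝ} (hr : 0 < r) :
    (Measure.pi fun _ : Fin n => gaussianReal 0 1).real
      {c | c k ^ 2 ≤ r * ∑ i ∈ Finset.univ.erase k, c i ^ 2} ≤ 2 * √(r * n) := by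
  have hn : (1 : ℝ) ≤ n := by exact_mod_cast Fin.pos k
  -- Parameter of the Chernoff bound. Since `s r = 1 / (4 n)`, the exponential moments of the other
  -- `n - 1` coordinates stay bounded together, while coordinate `k` contributes `(1 + 2 s)^(-1/2) ≤
  -- √(2 r n)`.
  set s : ℝ := 1 / (4 * r * n) with hs
  have hs0 : 0 < s := by positivity
  set a : Fin n → ℝ := fun i => if i = k then -s else s * r with ha
  have hsr : s * r = 1 / (4 * n) := by rw [hs]; field_simp
  have hsr' : 1 / (4 * (n : ℝ)) ≤ 1 / 4 := by
    rw [div_le_div_iff₀ (by positivity) (by norm_num)]; linarith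
  have ha2 : ∀ i, a i < 1 / 2 := fun i => by
    simp only [ha]; split_ifs <;> linarith
  have hint : Integrable (fun c : Fin n → ℝ => ∏ i, Real.exp (a i * c i ^ 2))
      (Measure.pi fun _ : Fin n => gaussianReal 0 1) :=
    Integrable.fintype_prod fun i => integrable_exp_mul_sq_gaussian (ha2 i)
  have hprod : ∀ c : Fin n → ℝ, ∏ i, Real.exp (a i * c i ^ 2) =
      Real.exp (s * (r * ∑ i ∈ Finset.univ.erase k, c i ^ 2 - c k ^ 2)) := fun c => by
    rw [← Real.exp_sum, ← Finset.add_sum_erase _ _ (Finset.mem_univ k)]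
    congr 1
    have : ∑ i ∈ Finset.univ.erase k, a i * c i ^ 2 =
        ∑ i ∈ Finset.univ.erase k, s * r * c i ^ 2 :=
      Finset.sum_congr rfl fun i hi => by simp [ha, Finset.ne_of_mem_erase hi]
    rw [this, ← Finset.mul_sum]
    simp only [ha, if_true]
    ring
  have hmarkov := mul_meas_ge_le_integral_of_nonneg
    (Filter.Eventually.of_forall fun c => Finset.prod_nonneg fun i _ => (Real.exp_pos _).le) hint 1
  rw [one_mul, integral_fintype_prod_eq_prod (fun i x => Real.exp (a i * x ^ 2))] at hmarkov
  refine (le_trans (measureReal_mono ?_) hmarkov).trans ?_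
  · intro c hc
    simp only [Set.mem_ofPred_eq] at hc ⊢
    rw [hprod, ← Real.exp_zero]
    exact Real.exp_le_exp.2 (mul_nonneg hs0.le (by linarith))
  · simp only [fun i => integral_exp_mul_sq_gaussian (ha2 i)]
    rw [← Finset.mul_prod_erase _ _ (Finset.mem_univ k)]
    have h1 : ∏ i ∈ Finset.univ.erase k, (√(1 - 2 * a i))⁻¹ = (√((1 - 1 / (2 * n)) ^ (n - 1)))⁻¹ := by
      have : ∀ i ∈ Finset.univ.erase k, (√(1 - 2 * a i))⁻¹ = (√(1 - 1 / (2 * n)))⁻¹ := fun i hi => by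
        simp only [ha, if_neg (Finset.ne_of_mem_erase hi), hsr]
        congr 3
        field_simp
        ring
      rw [Finset.prod_congr rfl this, Finset.prod_const, Finset.card_erase_of_mem (Finset.mem_univ k),
        Finset.card_univ, Fintype.card_fin, inv_pow, Real.sqrt_eq_rpow, Real.sqrt_eq_rpow,
        ← Real.rpow_natCast, ← Real.rpow_natCast, ← Real.rpow_mul, ← Real.rpow_mul, mul_comm (1 / 2 : ℝ)]
      all_goals
        rw [sub_nonneg, div_le_one (by positivity)]; linarith
    -- Bernoulli's inequality: the other coordinates together cost at most a factor `√2`.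
    have h2 : (1 : ℝ) / 2 ≤ (1 - 1 / (2 * n)) ^ (n - 1) := by
      have h3 := one_add_mul_le_pow (a := -(1 / (2 * (n : ℝ)))) (by
        rw [neg_le_neg_iff, div_le_iff₀ (by positivity)]; linarith) (n - 1)
      rw [Nat.cast_sub (Fin.pos k), Nat.cast_one, ← sub_eq_add_neg] at h3
      refine le_trans ?_ h3
      have : ((n : ℝ) - 1) * -(1 / (2 * n)) = -(1 / 2) + 1 / (2 * n) := by field_simp; ring
      rw [this]
      have : 0 < 1 / (2 * (n : ℝ)) := by positivity
      linarith
    have h4 : (√((1 - 1 / (2 * (n : ℝ))) ^ (n - 1)))⁻¹ ≤ √2 := by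
      rw [← Real.sqrt_inv]
      refine Real.sqrt_le_sqrt ?_
      rw [inv_le_comm₀ (by linarith) (by norm_num)]
      linarith
    have h5 : (√(1 - 2 * a k))⁻¹ ≤ √(2 * (r * n)) := by
      rw [← Real.sqrt_inv]
      refine Real.sqrt_le_sqrt ?_
      simp only [ha, if_true]
      rw [inv_le_comm₀ (by linarith) (by positivity)]
      have : (2 * (r * (n : ℝ)))⁻¹ = 2 * s := by rw [hs]; field_simp; norm_num
      rw [this]
      linarith
    rw [h1]
    calc _ ≤ √(2 * (r * n)) * √2 := mul_le_mul h5 h4 (by positivity) (by positivity)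
      _ = 2 * √(r * n) := by
        rw [Real.sqrt_mul (by norm_num), mul_right_comm, Real.mul_self_sqrt (by norm_num)]

/-! ### The accuracy of the oracle -/

section Constants

variable {n : ℕ} {ε : ℝ}

theorem log_two_mul_pos (hn : 0 < n) : 0 < Real.log (2 * n) := by
  have h1 : (1 : ℝ) ≤ n := by exact_mod_cast hn
  exact Real.log_pos (by linarith)

theorem iterBound_pos (hn : 0 < n) (hε : 0 < ε) : 0 < iterBound n ε := by
  have := log_two_mul_pos hn
  have : (0 : ℝ) < n := by exact_mod_cast hn
  unfold iterBound
  positivity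

/-- `24` is the threshold from which `T / (4 (T + 1)) ≥ 0.24`, the comparison made in
`stepSize_mul_curvatureBound_ge`. -/
theorem iterBound_ge (hn : 0 < n) (hε : 0 < ε) (hε3 : ε < 1 / 3) : 24 ≤ iterBound n ε := by
  have h1 : (1 : ℝ) ≤ n := by exact_mod_cast hn
  have h2 : (1 : ℝ) / 2 ≤ Real.log (2 * n) :=
    (by linarith [Real.log_two_gt_d9] : (1 : ℝ) / 2 ≤ Real.log 2).trans
      (Real.log_le_log (by norm_num) (by linarith))
  rw [iterBound, le_div_iff₀ (by positivity)]
  have h3 : ε ^ 2 ≤ 1 / 9 := by nlinarith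
  have h4 : (1 : ℝ) ≤ (n : ℝ) ^ 2 := one_le_pow₀ h1
  nlinarith

theorem log_ratio_ge (hn : 0 < n) (hε : 0 < ε) (hε3 : ε < 1 / 3) :
    5 / 3 ≤ Real.log (2 * n / ε) := by
  have h1 : (1 : ℝ) ≤ n := by exact_mod_cast hn
  have h2 : (6 : ℝ) ≤ 2 * n / ε := by rw [le_div_iff₀ hε]; linarith
  refine le_trans ?_ (Real.log_le_log (by norm_num) h2)
  rw [Real.le_log_iff_exp_le (by norm_num)]
  have h3 := Real.exp_one_lt_d9
  -- Cubing reduces the claim to `e ^ 5 ≤ 6 ^ 3`.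
  have h4 : Real.exp (5 / 3) ^ 3 = Real.exp 1 ^ 5 := by
    rw [← Real.exp_nat_mul, ← Real.exp_nat_mul]; norm_num
  have h5 : Real.exp 1 ^ 5 ≤ 2.7182818286 ^ 5 := pow_le_pow_left₀ (Real.exp_pos 1).le h3.le 5
  refine le_of_pow_le_pow_left₀ (n := 3) (by norm_num) (by norm_num) ?_
  rw [h4]
  refine h5.trans (by norm_num)

/-- The product `560 * 0.024 = 13.44` leaves a surplus `0.44 L`, which absorbs the floor and the
product reserved for the Rayleigh quotient. -/
theorem powerSteps_ge (hn : 0 < n) (hε : 0 < ε) (hε3 : ε < 1 / 3) :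
    13 * Real.log (2 * n / ε) ≤ 24 / 1000 * ε / n * (2 * powerSteps n ε + 1 : ℕ) := by
  have h1 : (1 : ℝ) ≤ n := by exact_mod_cast hn
  have hL := log_ratio_ge hn hε hε3
  set L := Real.log (2 * n / ε) with hLdef
  have h3 : matvecBound n ε - 2 ≤ powerSteps n ε := by
    have h4 := Nat.lt_floor_add_one (matvecBound n ε)
    have h5 : (⌊matvecBound n ε⌋₊ : ℝ) ≤ (powerSteps n ε : ℝ) + 1 := by
      rw [powerSteps]; exact_mod_cast (by omega : ⌊matvecBound n ε⌋₊ ≤ ⌊matvecBound n ε⌋₊ - 1 + 1)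
    linarith
  have h6 : (560 * (n / ε) * L - 3 : ℝ) ≤ (2 * powerSteps n ε + 1 : ℕ) := by
    push_cast
    rw [matvecBound, ← hLdef] at h3
    linarith
  have h7 : 24 / 1000 * ε / n * (560 * (n / ε) * L - 3) ≤
      24 / 1000 * ε / n * (2 * powerSteps n ε + 1 : ℕ) :=
    mul_le_mul_of_nonneg_left h6 (by positivity)
  refine le_trans ?_ h7
  have h8 : 24 / 1000 * ε / n * (560 * (n / ε) * L - 3) = 13.44 * L - 72 / 1000 * (ε / n) := by
    field_simp; ring
  have h9 : ε / n ≤ 1 := by rw [div_le_one (by linarith)]; linarith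
  rw [h8]
  linarith

theorem one_sub_pow_le (hn : 0 < n) (hε : 0 < ε) (hε3 : ε < 1 / 3) :
    (1 - 24 / 1000 * ε / n) ^ (2 * powerSteps n ε + 1) ≤ (ε / (2 * n)) ^ 13 := by
  have h1 : (1 : ℝ) ≤ n := by exact_mod_cast hn
  have h0 : 0 ≤ 1 - 24 / 1000 * ε / n := by
    rw [sub_nonneg, div_le_one (by linarith)]; linarith
  have h2 : 1 - 24 / 1000 * ε / n ≤ Real.exp (-(24 / 1000 * ε / n)) :=
    Real.one_sub_le_exp_neg _
  refine (pow_le_pow_left₀ h0 h2 _).trans ?_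
  have h3 : ε / (2 * n) = Real.exp (-Real.log (2 * n / ε)) := by
    rw [Real.exp_neg, Real.exp_log (by positivity), inv_div]
  rw [h3, ← Real.exp_nat_mul, ← Real.exp_nat_mul]
  refine Real.exp_le_exp.2 ?_
  have := powerSteps_ge hn hε hε3
  push_cast at this ⊢
  linarith

end Constants

/-- Everything is expressed in `x = ε / (2 n)`. The choice of `δ` makes `10 n δ = 0.24 ε`, and `r`
is the smallest ratio that the power method tolerates with `K` steps. The failure probability `2 √(r
n)` is then of order `√(x ^ 11 ε)`, far below the target of order `x ^ 3`. -/
theorem oracleAccurate_prob {n : ℕ} (hn : 0 < n) {ε : ℝ} (hε : 0 < ε) (hε3 : ε < 1 / 3)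
    {C : Matrix (Fin n) (Fin n) ℝ} (hC : IsDiagDominant C) (v : Fin n → ℝ) :
    (Measure.pi fun _ : Fin n => gaussianReal 0 1).real
      {b | ¬ OracleAccurate C ε (24 / 100 * (ε * C.trace)) v b} ≤
      76 / 100 * (ε / iterBound n ε) := by
  have hn1 : (1 : ℝ) ≤ n := by exact_mod_cast hn
  set x : ℝ := ε / (2 * n) with hx
  have hx0 : 0 < x := by positivity
  have hnx : n * x = ε / 2 := by rw [hx]; field_simp
  have hx6 : x ≤ 1 / 6 := by rw [hx, div_le_iff₀ (by positivity)]; linarith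
  set δ : ℝ := 24 / 1000 * ε / n with hδdef
  have hδx : δ = 48 / 1000 * x := by rw [hδdef, hx]; field_simp; norm_num
  have hδ : 0 < δ := by positivity
  set r : ℝ := x ^ 13 / δ with hrdef
  have hr0 : 0 < r := by positivity
  have hr : (1 - δ) ^ (2 * powerSteps n ε + 1) ≤ r * δ := by
    rw [hrdef, div_mul_cancel₀ _ hδ.ne']
    exact one_sub_pow_le hn hε hε3
  obtain ⟨U, k, -, hU', hgood⟩ :=
    exists_orthogonal_oracleAccurate hn hC ε v hδ (by linarith) hr hr0
  have hδeq : 10 * n * δ * C.trace = 24 / 100 * (ε * C.trace) := by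
    rw [hδdef]; field_simp; ring
  rw [hδeq] at hgood
  have hm : Measurable (fun b : Fin n → ℝ => Uᵀ *ᵥ b) :=
    (Continuous.matrix_mulVec continuous_const continuous_id).measurable
  have hS : MeasurableSet {c : Fin n → ℝ | c k ^ 2 ≤ r * ∑ i ∈ Finset.univ.erase k, c i ^ 2} :=
    measurableSet_le (by fun_prop) (by fun_prop)
  have h1 : (Measure.pi fun _ : Fin n => gaussianReal 0 1).real
      {b | ¬ OracleAccurate C ε (24 / 100 * (ε * C.trace)) v b} ≤ 2 * √(r * n) := by
    refine le_trans ?_ (gaussian_coordinate_small k hr0)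
    conv_rhs => rw [← pi_gaussian_map_orthogonal hU', map_measureReal_apply hm hS]
    refine measureReal_mono fun b hb => ?_
    by_contra h
    exact hb (hgood b (not_le.1 h))
  refine h1.trans ?_
  have hrn : r * n = 125 / 12 * x ^ 11 * ε := by
    rw [hrdef, hδx]
    have : (n : ℝ) = ε / 2 / x := by rw [← hnx]; field_simp
    rw [this]
    field_simp
    ring
  -- From `log (2 n) ≤ n` one gets `ε / T ≥ x ^ 3 / 8`, and `0.095 = 0.76 / 8`.
  have hq : x ^ 3 / 10 * (95 / 100) ≤ 76 / 100 * (ε / iterBound n ε) := by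
    have hlog : Real.log (2 * n) ≤ n := by
      have h := Real.log_le_sub_one_of_pos (show (0 : ℝ) < n by linarith)
      rw [Real.log_mul (by norm_num) (by positivity)]
      linarith [Real.log_two_lt_d9]
    have hlp := log_two_mul_pos hn
    have : ε / iterBound n ε = ε ^ 3 / (64 * Real.log (2 * n) * n ^ 2) := by
      rw [iterBound]; field_simp
    rw [this, hx]
    have h2 : ε ^ 3 / (64 * n * n ^ 2) ≤ ε ^ 3 / (64 * Real.log (2 * n) * n ^ 2) := by
      gcongr
    have h3 : (ε / (2 * n)) ^ 3 / 10 * (95 / 100) = 76 / 100 * (ε ^ 3 / (64 * n * n ^ 2)) := by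
      field_simp; norm_num
    rw [h3]
    linarith
  refine le_trans ?_ hq
  have h4 : r * n ≤ (x ^ 3 / 10 * (95 / 200)) ^ 2 := by
    rw [hrn]
    have h5 : x ^ 5 ≤ (1 / 6) ^ 5 := pow_le_pow_left₀ hx0.le hx6 5
    have h6 : x ^ 11 = x ^ 6 * x ^ 5 := by ring
    have h7 : x ^ 5 * ε ≤ (1 / 6) ^ 5 * (1 / 3) := mul_le_mul h5 hε3.le hε.le (by norm_num)
    have h8 := mul_le_mul_of_nonneg_left h7 (pow_nonneg hx0.le 6)
    rw [h6]
    have h9 := pow_pos hx0 6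
    nlinarith
  calc 2 * √(r * n) ≤ 2 * √((x ^ 3 / 10 * (95 / 200)) ^ 2) := by gcongr
    _ = _ := by rw [Real.sqrt_sq (by positivity)]; ring

/-- The definition of `T` is tuned to this identity, the only link between curvature and number of
iterations that the convergence proof needs. -/
theorem curvatureBound_eq {n : ℕ} {ε : ℝ} (hε : 0 < ε) (hn : 0 < n)
    (C : Matrix (Fin n) (Fin n) ℝ) :
    curvatureBound C ε = ε * C.trace * iterBound n ε / 4 := by
  have : (0 : ℝ) < n := by exact_mod_cast hn
  rw [curvatureBound, penaltyBeta, penaltyM, iterBound]; field_simp; ring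

/-- The step size is smallest at the last oracle call, where `t + 2 ≤ T + 1`. The tolerance there is
still `T / (4 (T + 1)) ≥ 0.24` in units of `ε Tr C`. -/
theorem stepSize_mul_curvatureBound_ge {n : ℕ} (hn : 0 < n) {ε : ℝ} (hε : 0 < ε) (hε3 : ε < 1 / 3)
    {C : Matrix (Fin n) (Fin n) ℝ} (hC : IsDiagDominant C) {t : ℕ} (ht : t < ⌊iterBound n ε⌋₊) :
    24 / 100 * (ε * C.trace) ≤ 1 / 2 * 1 * stepSize t * curvatureBound C ε := by
  have hT := iterBound_ge hn hε hε3
  have htr := hC.trace_nonneg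
  have h1 : (t : ℝ) + 1 ≤ iterBound n ε := by
    have : ((t + 1 : ℕ) : ℝ) ≤ iterBound n ε :=
      (Nat.cast_le.2 ht).trans (Nat.floor_le (by linarith))
    exact_mod_cast this
  have ht0 : (0 : ℝ) ≤ t := Nat.cast_nonneg t
  rw [curvatureBound_eq hε hn, stepSize]
  have h3 : 1 / 2 * 1 * (2 / ((t : ℝ) + 2)) * (ε * C.trace * iterBound n ε / 4) =
      (ε * C.trace) * (iterBound n ε / (4 * (t + 2))) := by field_simp
  rw [h3, mul_comm]
  refine mul_le_mul_of_nonneg_left ?_ (by positivity)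
  rw [le_div_iff₀ (by positivity)]
  linarith

end MaxCutFW

namespace MaxCutFW

/-! ### Convexity and smoothness of the LogSumExp penalty -/

/-- Hoeffding's lemma for a finitely supported distribution. -/
theorem sum_mul_exp_le {ι : Type*} [Fintype ι] {p y : ι → ℝ} (hp : ∀ i, 0 ≤ p i)
    (hp1 : ∑ i, p i = 1) {D : ℝ} (hy : ∀ i, |y i| ≤ D) (hD : 0 ≤ D) (s : ℝ) :
    ∑ i, p i * Real.exp (s * y i) ≤ Real.exp (s * ∑ i, p i * y i + s ^ 2 * D ^ 2 / 2) := by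
  let _ : MeasurableSpace ι := ⊤
  let μ : Measure ι := ∑ i, ENNReal.ofReal (p i) • Measure.dirac i
  have hint : ∀ f : ι → ℝ, ∫ i, f i ∂μ = ∑ i, p i * f i := fun f => by
    rw [integral_finsetSum_measure]
    · refine Finset.sum_congr rfl fun i _ => ?_
      rw [integral_smul_measure, integral_dirac, ENNReal.toReal_ofReal (hp i), smul_eq_mul]
    · intro i _
      exact (integrable_dirac (by simp)).smul_measure ENNReal.ofReal_ne_top
  have hprob : IsProbabilityMeasure μ := ⟨by
    simp only [μ, Measure.coe_finsetSum, Finset.sum_apply, Measure.smul_apply, smul_eq_mul,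
      measure_univ, mul_one]
    rw [← ENNReal.ofReal_sum_of_nonneg fun i _ => hp i, hp1, ENNReal.ofReal_one]⟩
  have h := (hasSubgaussianMGF_of_mem_Icc (μ := μ) (X := y) (a := -D) (b := D)
    (measurable_from_top).aemeasurable
    (Filter.Eventually.of_forall fun i => abs_le.1 (hy i))).mgf_le s
  rw [mgf, hint, hint] at h
  -- The values lie in an interval of length `2 D`, so the variance proxy is `D ^ 2`.
  have hc : (((‖D - -D‖₊ / 2) ^ 2 : NNReal) : ℝ) = D ^ 2 := by
    push_cast
    rw [Real.norm_of_nonneg (by linarith)]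
    ring
  rw [hc] at h
  set m := ∑ i, p i * y i
  have h2 : ∑ i, p i * Real.exp (s * y i) =
      Real.exp (s * m) * ∑ i, p i * Real.exp (s * (y i - m)) := by
    rw [Finset.mul_sum]
    refine Finset.sum_congr rfl fun i _ => ?_
    rw [mul_left_comm, ← Real.exp_add]
    congr 2
    ring
  rw [h2, Real.exp_add]
  refine mul_le_mul_of_nonneg_left (h.trans (le_of_eq ?_)) (Real.exp_pos _).le
  congr 1
  ring

theorem exp_sum_mul_le {ι : Type*} [Fintype ι] {p y : ι → ℝ} (hp : ∀ i, 0 ≤ p i)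
    (hp1 : ∑ i, p i = 1) : Real.exp (∑ i, p i * y i) ≤ ∑ i, p i * Real.exp (y i) := by
  have := convexOn_exp.map_sum_le (t := Finset.univ) (w := p) (p := y) (fun i _ => hp i) hp1
    (fun _ _ => Set.mem_univ _)
  simpa only [smul_eq_mul] using this

section LSE

variable {n : ℕ}

/-- The weights `exp (± M xᵢ) / expSum M x` of the `2 n` terms of `expSum`. -/
def lseWeight (M : ℝ) (x : Fin n → ℝ) : Fin n ⊕ Fin n → ℝ :=
  Sum.elim (fun i => Real.exp (M * x i) / expSum M x) fun i => Real.exp (M * -x i) / expSum M x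

theorem lseWeight_nonneg (M : ℝ) (x : Fin n → ℝ) (j) : 0 ≤ lseWeight M x j := by
  have h : 0 ≤ expSum M x := by unfold expSum; positivity
  rcases j with i | i <;> exact div_nonneg (Real.exp_pos _).le h

theorem sum_lseWeight (hn : 0 < n) (M : ℝ) (x : Fin n → ℝ) : ∑ j, lseWeight M x j = 1 := by
  rw [Fintype.sum_sum_type]
  simp only [lseWeight, Sum.elim_inl, Sum.elim_inr, ← Finset.sum_div]
  rw [← add_div]
  exact div_self (expSum_pos hn M x).ne'

theorem sum_lseWeight_mul (M : ℝ) (x d : Fin n → ℝ) :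
    ∑ j, lseWeight M x j * Sum.elim d (-d) j = lseGrad M x ⬝ᵥ d := by
  rw [Fintype.sum_sum_type, dotProduct, ← Finset.sum_add_distrib]
  refine Finset.sum_congr rfl fun i _ => ?_
  simp only [lseWeight, lseGrad, Sum.elim_inl, Sum.elim_inr, Pi.neg_apply]
  ring

/-- This makes the increment of LogSumExp a cumulant generating function, evaluated at `M`, of the
weights at `x`. Jensen and Hoeffding bound it from below and above. -/
theorem sum_lseWeight_mul_exp (M : ℝ) (x d : Fin n → ℝ) :
    ∑ j, lseWeight M x j * Real.exp (M * Sum.elim d (-d) j) = expSum M (x + d) / expSum M x := by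
  rw [Fintype.sum_sum_type, expSum, add_div, Finset.sum_div, Finset.sum_div]
  congr 1 <;> refine Finset.sum_congr rfl fun i _ => ?_
  · simp only [lseWeight, Sum.elim_inl, Pi.add_apply]
    rw [div_mul_eq_mul_div, ← Real.exp_add]
    ring_nf
  · simp only [lseWeight, Sum.elim_inr, Pi.add_apply, Pi.neg_apply]
    rw [div_mul_eq_mul_div, ← Real.exp_add]
    ring_nf

theorem lse_add (hn : 0 < n) (M : ℝ) (x d : Fin n → ℝ) :
    lse M (x + d) - lse M x = 1 / M * Real.log (expSum M (x + d) / expSum M x) := by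
  rw [lse, lse, Real.log_div (expSum_pos hn _ _).ne' (expSum_pos hn _ _).ne']
  ring

theorem lse_add_ge (hn : 0 < n) {M : ℝ} (hM : 0 < M) (x d : Fin n → ℝ) :
    lse M x + lseGrad M x ⬝ᵥ d ≤ lse M (x + d) := by
  have h := exp_sum_mul_le (p := lseWeight M x) (y := fun j => M * Sum.elim d (-d) j)
    (lseWeight_nonneg M x) (sum_lseWeight hn M x)
  rw [sum_lseWeight_mul_exp] at h
  simp only [mul_left_comm _ M, ← Finset.mul_sum] at h
  rw [sum_lseWeight_mul, ← Real.le_log_iff_exp_le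
    (div_pos (expSum_pos hn _ _) (expSum_pos hn _ _))] at h
  have h2 := lse_add hn M x d
  have h3 := mul_le_mul_of_nonneg_left h (one_div_pos.2 hM).le
  rw [one_div_mul_eq_div, mul_div_cancel_left₀ _ hM.ne'] at h3
  linarith

/-- Hoeffding's lemma sees only the range of `± d i`, so the smoothness is in the sup norm, with no
factor depending on the dimension. -/
theorem lse_add_le (hn : 0 < n) {M : ℝ} (hM : 0 < M) (x d : Fin n → ℝ) {D : ℝ}
    (hd : ∀ i, |d i| ≤ D) :
    lse M (x + d) ≤ lse M x + lseGrad M x ⬝ᵥ d + M * D ^ 2 / 2 := by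
  have hD : 0 ≤ D := (abs_nonneg _).trans (hd ⟨0, hn⟩)
  have h := sum_mul_exp_le (p := lseWeight M x) (y := Sum.elim d (-d))
    (lseWeight_nonneg M x) (sum_lseWeight hn M x) (D := D) (by
      rintro (i | i)
      · exact hd i
      · simpa using hd i) hD M
  rw [sum_lseWeight_mul_exp, sum_lseWeight_mul, ← Real.log_le_iff_le_exp
    (div_pos (expSum_pos hn _ _) (expSum_pos hn _ _))] at h
  have h2 := lse_add hn M x d
  have h3 := mul_le_mul_of_nonneg_left h (one_div_pos.2 hM).le
  have h4 : 1 / M * (M * lseGrad M x ⬝ᵥ d + M ^ 2 * D ^ 2 / 2) =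
      lseGrad M x ⬝ᵥ d + M * D ^ 2 / 2 := by field_simp
  linarith

theorem abs_le_lse {M : ℝ} (hM : 0 < M) (x : Fin n → ℝ) (i : Fin n) : |x i| ≤ lse M x := by
  have h : Real.exp (M * |x i|) ≤ expSum M x := by
    rw [expSum_eq_sum]
    refine le_trans ?_ (Finset.single_le_sum
      (f := fun i => Real.exp (M * x i) + Real.exp (M * -x i))
      (fun i _ => by positivity) (Finset.mem_univ i))
    have := Real.exp_pos (M * x i)
    have := Real.exp_pos (M * -x i)
    rcases abs_choice (x i) with h | h <;> rw [h] <;> linarith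
  rw [← Real.le_log_iff_exp_le (expSum_pos (Fin.pos i) _ _)] at h
  rw [lse, one_div_mul_eq_div, le_div_iff₀ hM, mul_comm]
  exact h

theorem lse_zero (M : ℝ) : lse M (0 : Fin n → ℝ) = 1 / M * Real.log (2 * n) := by
  rw [lse, expSum]
  simp
  ring_nf
  simp

end LSE

/-! ### Frank-Wolfe -/

section FrankWolfe

variable {n : ℕ} {C : Matrix (Fin n) (Fin n) ℝ} {ε : ℝ}

theorem penaltyM_pos (hn : 0 < n) (hε : 0 < ε) : 0 < penaltyM n ε := by
  have := log_two_mul_pos hn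
  unfold penaltyM
  positivity

theorem trace_gradMatrix_mul (C : Matrix (Fin n) (Fin n) ℝ) (ε : ℝ) (v : Fin n → ℝ)
    (D : Matrix (Fin n) (Fin n) ℝ) :
    ((gradMatrix C ε v)ᵀ * D).trace =
      (Cᵀ * D).trace - penaltyBeta C * lseGrad (penaltyM n ε) (v - 1) ⬝ᵥ D.diag := by
  have h4 : (penaltyBeta C • diagonal (lseGrad (penaltyM n ε) (v - 1)) * D).trace =
      penaltyBeta C * lseGrad (penaltyM n ε) (v - 1) ⬝ᵥ D.diag := by
    simp [Matrix.trace, dotProduct, Finset.mul_sum]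
  rw [gradMatrix, transpose_sub, transpose_smul, diagonal_transpose, Matrix.sub_mul, trace_sub, h4]

theorem objective_le_linearization (hn : 0 < n) (hε : 0 < ε) (hC : IsDiagDominant C)
    (X Y : Matrix (Fin n) (Fin n) ℝ) :
    objective C ε Y ≤ objective C ε X + ((gradMatrix C ε X.diag)ᵀ * (Y - X)).trace := by
  have h := lse_add_ge hn (penaltyM_pos hn hε) (X.diag - 1) (Y - X).diag
  have h2 : X.diag - 1 + (Y - X).diag = Y.diag - 1 := by rw [diag_sub]; abel
  rw [h2] at h
  have hβ : 0 ≤ penaltyBeta C := mul_nonneg (by norm_num) hC.trace_nonneg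
  have h3 := mul_le_mul_of_nonneg_left h hβ
  rw [trace_gradMatrix_mul, Matrix.mul_sub, trace_sub, objective, objective]
  linarith

/-- The penalty depends on the diagonal only, so only the diagonal of the displacement enters the
second-order error. -/
theorem linearization_le_objective (hn : 0 < n) (hε : 0 < ε) (hC : IsDiagDominant C)
    (X D : Matrix (Fin n) (Fin n) ℝ) {B : ℝ} (hB : ∀ i, |D i i| ≤ B) :
    objective C ε X + ((gradMatrix C ε X.diag)ᵀ * D).trace -
      penaltyBeta C * (penaltyM n ε * B ^ 2 / 2) ≤ objective C ε (X + D) := by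
  have h := lse_add_le hn (penaltyM_pos hn hε) (X.diag - 1) D.diag (D := B) hB
  have h2 : X.diag - 1 + D.diag = (X + D).diag - 1 := by rw [diag_add]; abel
  rw [h2] at h
  have hβ : 0 ≤ penaltyBeta C := mul_nonneg (by norm_num) hC.trace_nonneg
  have h3 := mul_le_mul_of_nonneg_left h hβ
  rw [trace_gradMatrix_mul, objective, objective, Matrix.mul_add, trace_add]
  linarith

theorem Feasible.diag_le {X : Matrix (Fin n) (Fin n) ℝ} (hX : Feasible X) (i : Fin n) :
    X i i ≤ n :=
  (Finset.single_le_sum (f := fun i => X i i) (fun _ _ => hX.1.diag_nonneg)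
    (Finset.mem_univ i)).trans hX.2

theorem Feasible.convex {X Y : Matrix (Fin n) (Fin n) ℝ} (hX : Feasible X) (hY : Feasible Y)
    {γ : ℝ} (h0 : 0 ≤ γ) (h1 : γ ≤ 1) : Feasible ((1 - γ) • X + γ • Y) := by
  refine ⟨(hX.1.smul (sub_nonneg.2 h1)).add (hY.1.smul h0), ?_⟩
  rw [trace_add, trace_smul, trace_smul, smul_eq_mul, smul_eq_mul]
  have := mul_le_mul_of_nonneg_left hX.2 (sub_nonneg.2 h1)
  have := mul_le_mul_of_nonneg_left hY.2 h0
  linarith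

theorem stepSize_nonneg (t : ℕ) : 0 ≤ stepSize t := by unfold stepSize; positivity

theorem stepSize_le_one (t : ℕ) : stepSize t ≤ 1 := by
  have : (0 : ℝ) ≤ t := Nat.cast_nonneg t
  rw [stepSize, div_le_one (by linarith)]
  linarith

/-- The covariance recursion of the algorithm. -/
theorem iterate_succ_snd (C : Matrix (Fin n) (Fin n) ℝ) (ε : ℝ) (ω : Tape n) (t : ℕ) :
    (iterate C ε ω (t + 1)).2 = (1 - stepSize t) • (iterate C ε ω t).2 +
      stepSize t • direction (lmo C ε (iterate C ε ω t).2.diag (ω.start t)) := rfl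

theorem iterate_feasible (C : Matrix (Fin n) (Fin n) ℝ) (ε : ℝ) (ω : Tape n) (t : ℕ) :
    Feasible (iterate C ε ω t).2 := by
  induction t with
  | zero => exact ⟨PosSemidef.one, by simp [iterate]⟩
  | succ t ih =>
    exact ih.convex (direction_lmo_feasible _ _ _ _) (stepSize_nonneg t) (stepSize_le_one t)

/-- The oracle call of iteration `t` is accurate up to `0.24 ε Tr C`. -/
def AccurateAt (C : Matrix (Fin n) (Fin n) ℝ) (ε : ℝ) (ω : Tape n) (t : ℕ) : Prop :=
  OracleAccurate C ε (24 / 100 * (ε * C.trace)) (iterate C ε ω t).2.diag (ω.start t)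

theorem frankWolfe_step (hn : 0 < n) (hε : 0 < ε) (hC : IsDiagDominant C) {ω : Tape n} {t : ℕ}
    (ht : AccurateAt C ε ω t) {Y : Matrix (Fin n) (Fin n) ℝ} (hY : Feasible Y) :
    objective C ε Y - objective C ε (iterate C ε ω (t + 1)).2 ≤
      (1 - stepSize t) * (objective C ε Y - objective C ε (iterate C ε ω t).2) +
        stepSize t * (24 / 100 * (ε * C.trace)) + stepSize t ^ 2 * curvatureBound C ε / 2 := by
  have hX := iterate_feasible C ε ω t
  rw [iterate_succ_snd]
  set X := (iterate C ε ω t).2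
  set H := direction (lmo C ε X.diag (ω.start t))
  set γ := stepSize t
  have hγ : 0 ≤ γ := stepSize_nonneg t
  have hH : Feasible H := direction_lmo_feasible _ _ _ _
  have h1 : ((gradMatrix C ε X.diag)ᵀ * Y).trace - 24 / 100 * (ε * C.trace) ≤
    ((gradMatrix C ε X.diag)ᵀ * H).trace := ht Y hY
  have h2 := objective_le_linearization hn hε hC X Y
  -- Diagonal entries of feasible matrices lie in `[0, n]`. This is the source of the factor `n ^ 2`
  -- in the curvature bound.
  have h3 := linearization_le_objective hn hε hC X (γ • (H - X)) (B := γ * n) fun i => by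
    rw [Matrix.smul_apply, Matrix.sub_apply, smul_eq_mul, abs_mul, abs_of_nonneg hγ]
    refine mul_le_mul_of_nonneg_left ?_ hγ
    have := hX.diag_le i
    have := hH.diag_le i
    have := hX.1.diag_nonneg (i := i)
    have := hH.1.diag_nonneg (i := i)
    rw [abs_le]; constructor <;> linarith
  have h4 : (1 - γ) • X + γ • H = X + γ • (H - X) := by
    rw [sub_smul, one_smul, smul_sub]; abel
  rw [h4]
  rw [Matrix.mul_smul, trace_smul, smul_eq_mul, Matrix.mul_sub, trace_sub] at h3
  rw [Matrix.mul_sub, trace_sub] at h2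
  have h5 : penaltyBeta C * (penaltyM n ε * (γ * n) ^ 2 / 2) =
      γ ^ 2 * curvatureBound C ε / 2 := by rw [curvatureBound]; ring
  rw [h5] at h3
  have h6 := mul_le_mul_of_nonneg_left h1 hγ
  have h7 := mul_le_mul_of_nonneg_left h2 hγ
  linarith

/-- The oracle error does not accumulate, because each step averages the old error with the new one.
The estimate begins after one step: `stepSize 0 = 1` makes the starting matrix irrelevant. -/
theorem frankWolfe_convergence (hn : 0 < n) (hε : 0 < ε) (hC : IsDiagDominant C) {ω : Tape n}
    {Y : Matrix (Fin n) (Fin n) ℝ} (hY : Feasible Y) (t : ℕ) (h : ∀ s < t + 1, AccurateAt C ε ω s) :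
    objective C ε Y - objective C ε (iterate C ε ω (t + 1)).2 ≤
      24 / 100 * (ε * C.trace) + 2 * curvatureBound C ε / ((t + 1 : ℕ) + 2) := by
  have hcurv : 0 ≤ curvatureBound C ε := by
    rw [curvatureBound_eq hε hn]
    have := hC.trace_nonneg
    have := iterBound_pos hn hε
    positivity
  induction t with
  | zero =>
    have h1 := frankWolfe_step hn hε hC (h 0 (by norm_num)) hY
    have h2 : stepSize 0 = 1 := by norm_num [stepSize]
    rw [h2] at h1
    norm_num at h1 ⊢
    linarith
  | succ t ih =>
    have h1 := frankWolfe_step hn hε hC (h (t + 1) (by omega)) hY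
    have h2 := ih fun s hs => h s (by omega)
    have h3 := mul_le_mul_of_nonneg_left h2 (sub_nonneg.2 (stepSize_le_one (t + 1)))
    have h4 : (1 - stepSize (t + 1)) * (2 * curvatureBound C ε / ((t + 1 : ℕ) + 2)) +
        stepSize (t + 1) ^ 2 * curvatureBound C ε / 2 ≤
        2 * curvatureBound C ε / ((t + 1 + 1 : ℕ) + 2) := by
      have ht : (0 : ℝ) ≤ t := Nat.cast_nonneg t
      rw [stepSize]
      push_cast
      have h5 : (1 - 2 / ((t : ℝ) + 1 + 2)) * (2 * curvatureBound C ε / ((t : ℝ) + 1 + 2)) +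
          (2 / ((t : ℝ) + 1 + 2)) ^ 2 * curvatureBound C ε / 2 =
          2 * curvatureBound C ε * ((t + 2) / (t + 3) ^ 2) := by
        have : (t : ℝ) + 1 + 2 ≠ 0 := by linarith
        have : (t : ℝ) + 3 ≠ 0 := by linarith
        rw [show (t : ℝ) + 1 + 2 = t + 3 by ring]
        field_simp
        ring
      rw [h5, div_eq_mul_one_div (2 * curvatureBound C ε)]
      refine mul_le_mul_of_nonneg_left ?_ (by linarith)
      -- What remains is `(t + 2)(t + 4) ≤ (t + 3)²`.
      rw [div_le_div_iff₀ (by positivity) (by linarith)]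
      nlinarith
    linarith

/-- If all oracle calls are accurate, the returned covariance is approximately optimal. -/
theorem covariance_approxOptimal (hn : 0 < n) (hε : 0 < ε) (hε3 : ε < 1 / 3)
    (hC : IsDiagDominant C) {κ : ℝ} {ω : Tape n}
    (h : ∀ t < ⌊iterBound n ε⌋₊, AccurateAt C ε ω t) {a : ℝ} (ha1 : 74 / 100 ≤ a)
    (haκ : κ + 24 / 100 ≤ a) : IsApproxOptimal C ε (a * (ε * C.trace)) (covariance C ε κ ω) := by
  have hT := iterBound_ge hn hε hε3
  have hεC : 0 ≤ ε * C.trace := mul_nonneg hε.le hC.trace_nonneg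
  refine ⟨iterate_feasible _ _ _ _, fun Y hY => ?_⟩
  have hmem : stopTime C ε κ ω ∈
      {t | t = ⌊iterBound n ε⌋₊ ∨ gap C ε ω t ≤ κ * (ε * C.trace)} :=
    Nat.sInf_mem ⟨_, Or.inl rfl⟩
  have hle : stopTime C ε κ ω ≤ ⌊iterBound n ε⌋₊ := Nat.sInf_le (Or.inl rfl)
  -- At the iteration cap at least one step has been made, as the convergence estimate requires.
  have hf1 : 1 ≤ ⌊iterBound n ε⌋₊ := Nat.le_floor (by push_cast; linarith)
  unfold covariance
  -- On an early stop the true Frank-Wolfe gap, which bounds the distance to the optimum, exceeds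
  -- the computed one by at most the oracle error: `κ + 0.24`. At the cap the convergence estimate
  -- gives `0.24 + 0.5`.
  rcases hle.lt_or_eq with hlt | heq
  · have hgap := hmem.resolve_left hlt.ne
    have h1 := h _ hlt Y hY
    rw [gap] at hgap
    have h2 := objective_le_linearization hn hε hC (iterate C ε ω (stopTime C ε κ ω)).2 Y
    rw [Matrix.mul_sub, trace_sub] at h2 hgap
    have h3 := mul_le_mul_of_nonneg_right haκ hεC
    linarith
  · rw [heq]
    obtain ⟨m, hm⟩ := Nat.exists_eq_add_of_le hf1
    rw [add_comm] at hm
    rw [hm] at h ⊢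
    have h1 := frankWolfe_convergence hn hε hC hY m h
    have h2 : 2 * curvatureBound C ε / ((m + 1 : ℕ) + 2) ≤ 1 / 2 * (ε * C.trace) := by
      have h3 : iterBound n ε ≤ (m + 1 : ℕ) + 2 := by
        rw [← hm]
        have := Nat.lt_floor_add_one (iterBound n ε)
        linarith
      rw [curvatureBound_eq hε hn, div_le_iff₀ (by positivity)]
      have := mul_le_mul_of_nonneg_left h3 hεC
      linarith
    have h3 := mul_le_mul_of_nonneg_right ha1 hεC
    linarith

end FrankWolfe

end MaxCutFW

namespace MaxCutFW

/-! ### Independence of the random numbers -/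

section TapeLaw

variable {n : ℕ}

instance : IsProbabilityMeasure (tapeLaw n) := by unfold tapeLaw; infer_instance

open Classical in
/-- The numbers named in `S` are taken from `ω'`, all others from `ω`. -/
def mix (S : Set (Seed n)) (ω' ω : Tape n) : Tape n := fun i => if i ∈ S then ω' i else ω i

theorem mix_of_mem {S : Set (Seed n)} {i : Seed n} (h : i ∈ S) (ω' ω : Tape n) :
    mix S ω' ω i = ω' i := if_pos h

theorem mix_of_notMem {S : Set (Seed n)} {i : Seed n} (h : i ∉ S) (ω' ω : Tape n) :
    mix S ω' ω i = ω i := if_neg h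

theorem measurable_mix (S : Set (Seed n)) :
    Measurable fun p : Tape n × Tape n => mix S p.1 p.2 := by
  refine measurable_pi_lambda _ fun i => ?_
  unfold mix
  split_ifs
  · exact (measurable_pi_apply i).comp measurable_fst
  · exact (measurable_pi_apply i).comp measurable_snd

/-- On a finite cylinder the product measure splits into the coordinates inside and outside `S`, and
each part sees only one of the two copies. Conditioning on the coordinates in `S` thus becomes
Fubini's theorem. -/
theorem map_mix (S : Set (Seed n)) :
    ((tapeLaw n).prod (tapeLaw n)).map (fun p => mix S p.1 p.2) = tapeLaw n := by
  classical
  refine Measure.eq_infinitePi _ fun s t ht => ?_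
  rw [Measure.map_apply (measurable_mix S) (MeasurableSet.pi s.countable_toSet fun i _ => ht i)]
  have hpre : (fun p : Tape n × Tape n => mix S p.1 p.2) ⁻¹' Set.pi s t =
      Set.pi (s.filter (· ∈ S) : Finset _) t ×ˢ Set.pi (s.filter (· ∉ S) : Finset _) t := by
    ext p
    simp only [Set.mem_preimage, Set.mem_pi, Set.mem_prod, Finset.mem_coe, Finset.mem_filter]
    constructor
    · intro h
      exact ⟨fun i hi => by simpa [mix_of_mem hi.2] using h i hi.1,
        fun i hi => by simpa [mix_of_notMem hi.2] using h i hi.1⟩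
    · rintro ⟨h1, h2⟩ i hi
      by_cases hS : i ∈ S
      · rw [mix_of_mem hS]; exact h1 i ⟨hi, hS⟩
      · rw [mix_of_notMem hS]; exact h2 i ⟨hi, hS⟩
  rw [hpre, Measure.prod_prod, tapeLaw, Measure.infinitePi_pi _ fun i _ => ht i,
    Measure.infinitePi_pi _ fun i _ => ht i, Finset.prod_filter_mul_prod_filter_not]

theorem integrable_mix (S : Set (Seed n)) {f : Tape n → ℝ} (hf : Integrable f (tapeLaw n)) :
    Integrable (fun p : Tape n × Tape n => f (mix S p.1 p.2))
      ((tapeLaw n).prod (tapeLaw n)) := by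
  have : Integrable f (((tapeLaw n).prod (tapeLaw n)).map fun p => mix S p.1 p.2) := by
    rwa [map_mix]
  exact this.comp_measurable (measurable_mix S)

theorem integral_mix (S : Set (Seed n)) {f : Tape n → ℝ} (hf : Integrable f (tapeLaw n)) :
    ∫ ω, f ω ∂tapeLaw n = ∫ ω', ∫ ω, f (mix S ω' ω) ∂tapeLaw n ∂tapeLaw n := by
  rw [← integral_prod (fun p : Tape n × Tape n => f (mix S p.1 p.2)) (integrable_mix S hf)]
  conv_lhs => rw [← map_mix S]
  rw [integral_map (measurable_mix S).aemeasurable]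
  rw [map_mix]
  exact hf.aestronglyMeasurable

/-- Conditioning on the coordinates outside `S`: a bound that is uniform in them survives
integration. -/
theorem tapeLaw_real_le_of_mix (S : Set (Seed n)) {B : Set (Tape n)} (hB : MeasurableSet B) {q : ℝ}
    (h : ∀ ω, (tapeLaw n).real {ω' | mix S ω' ω ∈ B} ≤ q) : (tapeLaw n).real B ≤ q := by
  have hq : 0 ≤ q := measureReal_nonneg.trans (h 0)
  refine ENNReal.toReal_le_of_le_ofReal hq ?_
  conv_lhs => rw [← map_mix S]
  rw [Measure.map_apply (measurable_mix S) hB, Measure.prod_apply_symm (measurable_mix S hB)]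
  calc _ ≤ ∫⁻ _, ENNReal.ofReal q ∂tapeLaw n := lintegral_mono fun ω => by
        rw [← ofReal_measureReal]
        exact ENNReal.ofReal_le_ofReal (h ω)
    _ = _ := by simp

theorem indepFun_of_dependsOn {α β : Type*} [MeasurableSpace α] [MeasurableSpace β]
    {S : Set (Seed n)} {f : Tape n → α} {g : Tape n → β} (hf : Measurable f) (hg : Measurable g)
    (hfS : DependsOn f S) (hgS : DependsOn g Sᶜ) : IndepFun f g (tapeLaw n) := by
  rw [indepFun_iff_map_prod_eq_prod_map_map hf.aemeasurable hg.aemeasurable,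
    Measure.map_prod_map _ _ hf hg]
  conv_lhs => rw [← map_mix S]
  rw [Measure.map_map (hf.prodMk hg) (measurable_mix S)]
  congr 1
  ext1 p
  exact Prod.ext (hfS fun i hi => mix_of_mem hi _ _) (hgS fun i hi => mix_of_notMem hi _ _)

theorem measurable_vector (σ : Fin 2) (j : ℕ) : Measurable fun ω : Tape n => ω.vector σ j :=
  measurable_pi_lambda _ fun _ => measurable_pi_apply _

theorem map_vector (σ : Fin 2) (j : ℕ) :
    (tapeLaw n).map (fun ω => ω.vector σ j) = Measure.pi fun _ : Fin n => gaussianReal 0 1 := by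
  classical
  refine (Measure.pi_eq fun s hs => ?_).symm
  rw [Measure.map_apply (measurable_vector σ j) (MeasurableSet.univ_pi hs)]
  have hinj : Function.Injective fun i : Fin n => (Sum.inl (σ, j, i) : Seed n) := fun a b h => by
    simpa using h
  let t : Seed n → Set ℝ := Sum.elim (fun p => s p.2.2) fun _ => Set.univ
  have hpre : (fun ω : Tape n => ω.vector σ j) ⁻¹' Set.univ.pi s =
      Set.pi ((Finset.univ.image fun i : Fin n => (Sum.inl (σ, j, i) : Seed n)) : Finset _) t := by
    ext ω
    simp [Set.mem_pi, Tape.vector, t]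
  rw [hpre, tapeLaw, Measure.infinitePi_pi, Finset.prod_image fun a _ b _ h => hinj h]
  · rfl
  · rintro (p | p) _
    · exact hs _
    · exact MeasurableSet.univ

/-! ### Gaussian laws of linear functionals -/

/-- `Y` is a centered Gaussian random variable with variance `v`. -/
def IsCentredGaussian (Y : Tape n → ℝ) (v : ℝ) : Prop :=
  0 ≤ v ∧ Measurable Y ∧ (tapeLaw n).map Y = gaussianReal 0 v.toNNReal

theorem isCentredGaussian_eval (s : Seed n) (a : ℝ) :
    IsCentredGaussian (fun ω : Tape n => a * ω s) (a ^ 2) := by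
  refine ⟨sq_nonneg a, measurable_const.mul (measurable_pi_apply s), ?_⟩
  have h1 : (tapeLaw n).map (fun ω => ω s) = gaussianReal 0 1 := Measure.infinitePi_map_eval _ s
  have h2 : (fun ω : Tape n => a * ω s) = (fun x => a * x) ∘ fun ω => ω s := rfl
  rw [h2, ← Measure.map_map (measurable_const_mul a) (measurable_pi_apply s), h1,
    gaussianReal_map_const_mul]
  congr 1
  · ring
  · ext; simp [Real.coe_toNNReal _ (sq_nonneg a)]

theorem IsCentredGaussian.add {Y Z : Tape n → ℝ} {v w : ℝ} (hY : IsCentredGaussian Y v)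
    (hZ : IsCentredGaussian Z w) {S : Set (Seed n)} (hYS : DependsOn Y S) (hZS : DependsOn Z Sᶜ) :
    IsCentredGaussian (fun ω => Y ω + Z ω) (v + w) := by
  refine ⟨add_nonneg hY.1 hZ.1, hY.2.1.add hZ.2.1, ?_⟩
  have h := gaussianReal_add_gaussianReal_of_indepFun
    (indepFun_of_dependsOn hY.2.1 hZ.2.1 hYS hZS) hY.2.2 hZ.2.2
  rw [add_zero, ← Real.toNNReal_add hY.1 hZ.1] at h
  exact h

theorem IsCentredGaussian.const_mul {Y : Tape n → ℝ} {v : ℝ} (hY : IsCentredGaussian Y v) (a : ℝ) :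
    IsCentredGaussian (fun ω => a * Y ω) (a ^ 2 * v) := by
  refine ⟨mul_nonneg (sq_nonneg a) hY.1, hY.2.1.const_mul a, ?_⟩
  have h2 : (fun ω : Tape n => a * Y ω) = (fun x => a * x) ∘ Y := rfl
  rw [h2, ← Measure.map_map (measurable_const_mul a) hY.2.1, hY.2.2, gaussianReal_map_const_mul]
  congr 1
  · ring
  · ext
    simp [Real.coe_toNNReal _ (sq_nonneg a), Real.toNNReal_mul (sq_nonneg a)]

theorem dependsOn_eval {S : Set (Seed n)} {s : Seed n} (hs : s ∈ S) (a : ℝ) :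
    DependsOn (fun ω : Tape n => a * ω s) S := fun _ _ h => by simp only [h s hs]

theorem isCentredGaussian_dotProduct_vector (x : Fin n → ℝ) (σ : Fin 2) (j : ℕ) :
    IsCentredGaussian (fun ω : Tape n => x ⬝ᵥ ω.vector σ j) (x ⬝ᵥ x) := by
  have h : ∀ F : Finset (Fin n), IsCentredGaussian
      (fun ω : Tape n => ∑ i ∈ F, x i * ω (Sum.inl (σ, j, i))) (∑ i ∈ F, x i * x i) := by
    classical
    intro F
    induction F using Finset.induction_on with
    -- The empty sum is written as `0` times some coordinate, a Gaussian of variance zero.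
    | empty => simpa using isCentredGaussian_eval (n := n) (Sum.inr 0) 0
    | insert i F hi ih =>
      simp only [Finset.sum_insert hi]
      rw [← sq]
      refine (isCentredGaussian_eval _ _).add ih (S := {Sum.inl (σ, j, i)})
        (dependsOn_eval (Set.mem_singleton _) _) fun ω ω' h => ?_
      refine Finset.sum_congr rfl fun l hl => ?_
      rw [h]
      simp only [Set.mem_compl_iff, Set.mem_singleton_iff, Sum.inl.injEq, Prod.mk.injEq, true_and]
      rintro rfl
      exact hi hl
  exact h Finset.univ

end TapeLaw

/-! ### Measurability -/

section Measurability

variable {n : ℕ} (C : Matrix (Fin n) (Fin n) ℝ) (ε : ℝ)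

theorem continuous_lseGrad (M : ℝ) : Continuous fun x : Fin n → ℝ => lseGrad M x := by
  refine continuous_pi fun i => ?_
  unfold lseGrad
  refine Continuous.div (by fun_prop) (by unfold expSum; fun_prop) fun x =>
    (expSum_pos (Fin.pos i) M x).ne'

theorem continuous_gradMatrix : Continuous fun v : Fin n → ℝ => gradMatrix C ε v := by
  unfold gradMatrix
  have h : Continuous fun v : Fin n → ℝ => lseGrad (penaltyM n ε) (v - 1) :=
    (continuous_lseGrad (n := n) (penaltyM n ε)).comp
      (continuous_id.sub (continuous_const (y := (1 : Fin n → ℝ))))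
  have h2 : Continuous fun v : Fin n → ℝ =>
      penaltyBeta C • diagonal (lseGrad (penaltyM n ε) (v - 1)) :=
    (continuous_const_smul (penaltyBeta C)).comp h.matrix_diagonal
  exact continuous_const.sub h2

theorem continuous_quadForm_gradMatrix :
    Continuous fun p : (Fin n → ℝ) × (Fin n → ℝ) => p.2 ⬝ᵥ gradMatrix C ε p.1 *ᵥ p.2 :=
  continuous_snd.dotProduct (((continuous_gradMatrix C ε).comp continuous_fst).matrix_mulVec
    continuous_snd)

theorem measurable_powerVector :
    Measurable fun p : (Fin n → ℝ) × (Fin n → ℝ) => powerVector C ε p.1 p.2 := by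
  unfold powerVector
  simp only
  have hy : Continuous fun p : (Fin n → ℝ) × (Fin n → ℝ) =>
      ((gradMatrix C ε p.1 + (5 * C.trace) • (1 : Matrix (Fin n) (Fin n) ℝ)) ^ powerSteps n ε) *ᵥ
        p.2 :=
    ((((continuous_gradMatrix C ε).comp continuous_fst).add continuous_const).pow _).matrix_mulVec
      continuous_snd
  exact (hy.dotProduct hy).sqrt.measurable.inv.smul hy.measurable

theorem measurable_lmo : Measurable fun p : (Fin n → ℝ) × (Fin n → ℝ) => lmo C ε p.1 p.2 := by
  have hw := measurable_powerVector C ε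
  have hq := (continuous_quadForm_gradMatrix C ε).measurable.comp (measurable_fst.prodMk hw)
  unfold lmo
  exact Measurable.ite (measurableSet_le measurable_const hq) hw measurable_const

theorem measurable_lmo_comp {Ω : Type*} [MeasurableSpace Ω] {f g : Ω → Fin n → ℝ}
    (hf : Measurable f) (hg : Measurable g) : Measurable fun ω => lmo C ε (f ω) (g ω) :=
  Measurable.comp (g := fun p : (Fin n → ℝ) × (Fin n → ℝ) => lmo C ε p.1 p.2)
    (f := fun ω => (f ω, g ω)) (measurable_lmo C ε) (hf.prodMk hg)

theorem measurable_quadForm_comp {Ω : Type*} [MeasurableSpace Ω] {f g : Ω → Fin n → ℝ}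
    (hf : Measurable f) (hg : Measurable g) :
    Measurable fun ω => g ω ⬝ᵥ gradMatrix C ε (f ω) *ᵥ g ω :=
  Measurable.comp
    (g := fun p : (Fin n → ℝ) × (Fin n → ℝ) => p.2 ⬝ᵥ gradMatrix C ε p.1 *ᵥ p.2)
    (f := fun ω => (f ω, g ω)) (continuous_quadForm_gradMatrix C ε).measurable (hf.prodMk hg)

/-- The condition ranges over uncountably many `Y`. It is closed in `Y`, so a countable dense set of
feasible matrices decides it. -/
theorem measurableSet_oracleAccurate (δ : ℝ) :
    MeasurableSet {p : (Fin n → ℝ) × (Fin n → ℝ) | OracleAccurate C ε δ p.1 p.2} := by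
  let F := {Y : Matrix (Fin n) (Fin n) ℝ // Feasible Y}
  have hsec : SecondCountableTopology (Matrix (Fin n) (Fin n) ℝ) :=
    inferInstanceAs (SecondCountableTopology (Fin n → Fin n → ℝ))
  have hsep : SecondCountableTopology F := Topology.IsInducing.subtypeVal.secondCountableTopology
  have hne : Nonempty F := ⟨⟨0, PosSemidef.zero, by simp⟩⟩
  have hset : {p : (Fin n → ℝ) × (Fin n → ℝ) | OracleAccurate C ε δ p.1 p.2} =
      ⋂ k : ℕ, {p | ((gradMatrix C ε p.1)ᵀ * (TopologicalSpace.denseSeq F k).1).trace - δ ≤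
        n * (lmo C ε p.1 p.2 ⬝ᵥ gradMatrix C ε p.1 *ᵥ lmo C ε p.1 p.2)} := by
    ext p
    simp only [Set.mem_ofPred_eq, Set.mem_iInter, OracleAccurate, trace_transpose_mul_direction]
    refine ⟨fun h k => h _ (TopologicalSpace.denseSeq F k).2, fun h Y hY => ?_⟩
    have hcl : IsClosed {Y : F | ((gradMatrix C ε p.1)ᵀ * Y.1).trace - δ ≤
        n * (lmo C ε p.1 p.2 ⬝ᵥ gradMatrix C ε p.1 *ᵥ lmo C ε p.1 p.2)} :=
      isClosed_le (((continuous_const.matrix_mul continuous_subtype_val).matrix_trace).sub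
        continuous_const) continuous_const
    have huniv := hcl.closure_subset_iff.2 (Set.range_subset_iff.2 h)
    rw [(TopologicalSpace.denseRange_denseSeq F).closure_range] at huniv
    exact huniv (Set.mem_univ (⟨Y, hY⟩ : F))
  rw [hset]
  refine MeasurableSet.iInter fun k => measurableSet_le ?_ ?_
  · exact (((((continuous_gradMatrix C ε).comp continuous_fst).matrix_transpose.matrix_mul
      continuous_const).matrix_trace).sub continuous_const).measurable
  · exact (measurable_quadForm_comp C ε measurable_fst (measurable_lmo C ε)).const_mul _

theorem measurable_iterate_snd (t : ℕ) (i j : Fin n) :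
    Measurable fun ω : Tape n => (iterate C ε ω t).2 i j := by
  induction t generalizing i j with
  | zero => exact measurable_const
  | succ t ih =>
    have hw : Measurable fun ω : Tape n =>
        lmo C ε (iterate C ε ω t).2.diag (ω.start t) :=
      measurable_lmo_comp C ε (measurable_pi_lambda _ fun i => ih i i) (measurable_vector 1 t)
    simp only [iterate_succ_snd, Matrix.add_apply, Matrix.smul_apply, direction, vecMulVec_apply,
      smul_eq_mul]
    have hwi : ∀ i, Measurable fun ω : Tape n =>
      lmo C ε (iterate C ε ω t).2.diag (ω.start t) i := fun i => measurable_pi_iff.1 hw i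
    exact ((ih i j).const_mul _).add ((((hwi i).mul (hwi j)).const_mul _).const_mul _)

theorem measurable_iterate_diag (t : ℕ) :
    Measurable fun ω : Tape n => (iterate C ε ω t).2.diag :=
  measurable_pi_lambda _ fun i => measurable_iterate_snd C ε t i i

theorem measurable_iterate_lmo (t : ℕ) :
    Measurable fun ω : Tape n => lmo C ε (iterate C ε ω t).2.diag (ω.start t) :=
  measurable_lmo_comp C ε (measurable_iterate_diag C ε t) (measurable_vector 1 t)

theorem measurable_iterate_fst (t : ℕ) : Measurable fun ω : Tape n => (iterate C ε ω t).1 := by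
  induction t with
  | zero => exact measurable_vector 0 0
  | succ t ih =>
    have hz : Measurable fun ω : Tape n => ω.zeta t := measurable_pi_apply _
    have hw := measurable_iterate_lmo C ε t
    have h : Measurable fun ω : Tape n => √(1 - stepSize t) • (iterate C ε ω t).1 +
        (√(stepSize t) * ω.zeta t) •
          (√(n : ℝ) • lmo C ε (iterate C ε ω t).2.diag (ω.start t)) :=
      (ih.const_smul (√(1 - stepSize t))).add
        ((hz.const_mul (√(stepSize t))).smul (hw.const_smul (√(n : ℝ))))
    exact h

theorem measurableSet_accurateAt (t : ℕ) : MeasurableSet {ω : Tape n | AccurateAt C ε ω t} := by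
  have h := (measurableSet_oracleAccurate C ε (24 / 100 * (ε * C.trace))).preimage
    ((measurable_iterate_diag C ε t).prodMk (measurable_vector 1 t))
  convert! h using 1

theorem gap_eq (ω : Tape n) (t : ℕ) : gap C ε ω t =
    n * (lmo C ε (iterate C ε ω t).2.diag (ω.start t) ⬝ᵥ
      gradMatrix C ε (iterate C ε ω t).2.diag *ᵥ lmo C ε (iterate C ε ω t).2.diag (ω.start t)) -
    ((Cᵀ * (iterate C ε ω t).2).trace - penaltyBeta C *
      lseGrad (penaltyM n ε) ((iterate C ε ω t).2.diag - 1) ⬝ᵥ (iterate C ε ω t).2.diag) := by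
  rw [gap, Matrix.mul_sub, trace_sub, trace_transpose_mul_direction, trace_gradMatrix_mul]

theorem measurable_gap (t : ℕ) : Measurable fun ω : Tape n => gap C ε ω t := by
  simp only [gap_eq]
  have hd := measurable_iterate_diag C ε t
  have h1 : Measurable fun ω : Tape n => (Cᵀ * (iterate C ε ω t).2).trace := by
    simp only [Matrix.trace, diag_apply, mul_apply]
    exact Finset.measurable_sum _ fun i _ => Finset.measurable_sum _ fun j _ =>
      (measurable_iterate_snd C ε t j i).const_mul _
  have h2 : Continuous fun v : Fin n → ℝ => lseGrad (penaltyM n ε) (v - 1) ⬝ᵥ v :=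
    ((continuous_lseGrad (penaltyM n ε)).comp (continuous_id.sub continuous_const)).dotProduct
      continuous_id
  exact ((measurable_quadForm_comp C ε hd (measurable_iterate_lmo C ε t)).const_mul _).sub
    (h1.sub ((h2.measurable.comp hd).const_mul _))

theorem stopTime_spec (κ : ℝ) (ω : Tape n) : stopTime C ε κ ω ∈
    {t | t = ⌊iterBound n ε⌋₊ ∨ gap C ε ω t ≤ κ * (ε * C.trace)} :=
  Nat.sInf_mem ⟨_, Or.inl rfl⟩

theorem stopTime_le (κ : ℝ) (ω : Tape n) : stopTime C ε κ ω ≤ ⌊iterBound n ε⌋₊ :=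
  Nat.sInf_le (Or.inl rfl)

theorem measurable_stopTime (κ : ℝ) : Measurable fun ω : Tape n => stopTime C ε κ ω := by
  refine measurable_of_Iic fun t => ?_
  have : (fun ω : Tape n => stopTime C ε κ ω) ⁻¹' Set.Iic t =
      ⋃ s ∈ Set.Iic t, {ω | s = ⌊iterBound n ε⌋₊ ∨ gap C ε ω s ≤ κ * (ε * C.trace)} := by
    ext ω
    simp only [Set.mem_preimage, Set.mem_Iic, Set.mem_iUnion, exists_prop]
    exact ⟨fun h => ⟨_, h, stopTime_spec C ε κ ω⟩, fun ⟨s, hs, h⟩ => (Nat.sInf_le h).trans hs⟩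
  rw [this]
  refine MeasurableSet.biUnion (Set.to_countable _) fun s _ => ?_
  exact (MeasurableSet.const _).union (measurableSet_le (measurable_gap C ε s) measurable_const)

theorem measurable_cut (κ : ℝ) : Measurable fun ω : Tape n => cut C ε κ ω := by
  have hpair : Measurable fun ω : Tape n =>
      (sample C ε κ ω, (covariance C ε κ ω).diag) := by
    -- The time index is countable, so joint measurability reduces to fixed times; the random
    -- stopping time can then be inserted.
    have h : Measurable fun p : ℕ × Tape n => ((iterate C ε p.2 p.1).1, (iterate C ε p.2 p.1).2.diag) :=
      measurable_from_prod_countable_right fun t =>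
        (measurable_iterate_fst C ε t).prodMk (measurable_iterate_diag C ε t)
    exact h.comp ((measurable_stopTime C ε κ).prodMk measurable_id)
  have hround : Measurable fun p : ((Fin n → ℝ) × (Fin n → ℝ)) × (Fin n → ℝ) =>
      roundSample p.1.1 p.1.2 p.2 := by
    refine measurable_pi_lambda _ fun i => ?_
    have hm : Measurable fun p : ((Fin n → ℝ) × (Fin n → ℝ)) × (Fin n → ℝ) => ⨆ j, p.1.2 j :=
      Measurable.iSup fun j => by fun_prop
    unfold roundSample
    refine Measurable.ite (measurableSet_le measurable_const ?_) measurable_const measurable_const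
    fun_prop
  exact hround.comp (hpair.prodMk (measurable_vector 0 1))

end Measurability

end MaxCutFW

namespace MaxCutFW

/-! ### Conditioning on the random starts of the oracle -/

section Conditioning

variable {n : ℕ} {C : Matrix (Fin n) (Fin n) ℝ} {ε : ℝ}

/-- Neither the initial sample nor the numbers `ζ` enter the covariance recursion. All conditioning
arguments rest on this. -/
theorem iterate_snd_congr {ω ω' : Tape n} {t : ℕ} (h : ∀ s < t, ω.start s = ω'.start s) :
    (iterate C ε ω t).2 = (iterate C ε ω' t).2 := by
  induction t with
  | zero => rfl
  | succ t ih =>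
    rw [iterate_succ_snd, iterate_succ_snd, ih fun s hs => h s (by omega), h t (by omega)]

/-- The stopping rule looks at the covariances and the oracle only, so stopping does not bias the
Gaussian sample. -/
theorem stopTime_congr {ω ω' : Tape n} (h : ∀ s, ω.start s = ω'.start s) (κ : ℝ) :
    stopTime C ε κ ω = stopTime C ε κ ω' := by
  have hg : ∀ t, gap C ε ω t = gap C ε ω' t := fun t => by
    rw [gap_eq, gap_eq, iterate_snd_congr fun s _ => h s, h t]
  simp only [stopTime, hg]

/-- `X_t` uses only the starts of earlier calls. With everything but the start of call `t` frozen,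
the gradient is fixed and the start is a fresh Gaussian vector, so the bound for a single call
applies. -/
theorem accurateAt_prob (hn : 0 < n) (hε : 0 < ε) (hε3 : ε < 1 / 3) (hC : IsDiagDominant C)
    (t : ℕ) : (tapeLaw n).real {ω | ¬ AccurateAt C ε ω t} ≤ 76 / 100 * (ε / iterBound n ε) := by
  refine tapeLaw_real_le_of_mix {s | ∃ i, s = Sum.inl (1, t, i)} (B := {ω | ¬ AccurateAt C ε ω t})
    (measurableSet_accurateAt C ε t).compl fun ω => ?_
  have hset : {ω' | mix {s | ∃ i, s = Sum.inl (1, t, i)} ω' ω ∈ {ω | ¬ AccurateAt C ε ω t}} =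
      (fun ω' : Tape n => ω'.vector 1 t) ⁻¹'
        {b | ¬ OracleAccurate C ε (24 / 100 * (ε * C.trace)) (iterate C ε ω t).2.diag b} := by
    ext ω'
    have h1 : (mix {s | ∃ i, s = Sum.inl (1, t, i)} ω' ω).start t = ω'.vector 1 t :=
      funext fun i => mix_of_mem (by exact ⟨i, rfl⟩) _ _
    have h2 : (iterate C ε (mix {s | ∃ i, s = Sum.inl (1, t, i)} ω' ω) t).2 = (iterate C ε ω t).2 :=
      iterate_snd_congr fun s hs => funext fun i => mix_of_notMem (by
        rintro ⟨l, hl⟩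
        simp only [Sum.inl.injEq, Prod.mk.injEq, true_and] at hl
        omega) _ _
    simp only [Set.mem_ofPred_eq, Set.mem_preimage, AccurateAt, h1, h2]
  have hmeas : MeasurableSet
      {b | ¬ OracleAccurate C ε (24 / 100 * (ε * C.trace)) (iterate C ε ω t).2.diag b} :=
    ((measurableSet_oracleAccurate C ε _).preimage
      (measurable_const.prodMk measurable_id)).compl
  rw [hset, ← map_measureReal_apply (measurable_vector 1 t) hmeas, map_vector]
  exact oracleAccurate_prob hn hε hε3 hC _

/-- Union bound over at most `T` calls. The `0.24 ε` left below `ε` is what the expected value of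
the cut needs later. -/
theorem all_accurate_prob (hn : 0 < n) (hε : 0 < ε) (hε3 : ε < 1 / 3) (hC : IsDiagDominant C) :
    1 - 76 / 100 * ε ≤
      (tapeLaw n).real {ω | ∀ t < ⌊iterBound n ε⌋₊, AccurateAt C ε ω t} := by
  have hT := iterBound_pos hn hε
  have hset : {ω : Tape n | ∀ t < ⌊iterBound n ε⌋₊, AccurateAt C ε ω t} =
      (⋃ t ∈ Finset.range ⌊iterBound n ε⌋₊, {ω | ¬ AccurateAt C ε ω t})ᶜ := by
    ext ω; simp
  have hm : MeasurableSet (⋃ t ∈ Finset.range ⌊iterBound n ε⌋₊, {ω | ¬ AccurateAt C ε ω t}) :=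
    Finset.measurableSet_biUnion _ fun t _ => (measurableSet_accurateAt C ε t).compl
  rw [hset, probReal_compl_eq_one_sub hm]
  have h1 : (tapeLaw n).real (⋃ t ∈ Finset.range ⌊iterBound n ε⌋₊, {ω | ¬ AccurateAt C ε ω t}) ≤
      ∑ t ∈ Finset.range ⌊iterBound n ε⌋₊, 76 / 100 * (ε / iterBound n ε) :=
    (measureReal_biUnion_finset_le _ _).trans
      (Finset.sum_le_sum fun t _ => accurateAt_prob hn hε hε3 hC t)
  rw [Finset.sum_const, Finset.card_range, nsmul_eq_mul] at h1
  have h2 : (⌊iterBound n ε⌋₊ : ℝ) * (76 / 100 * (ε / iterBound n ε)) ≤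
      iterBound n ε * (76 / 100 * (ε / iterBound n ε)) :=
    mul_le_mul_of_nonneg_right (Nat.floor_le hT.le) (by positivity)
  have h3 : iterBound n ε * (76 / 100 * (ε / iterBound n ε)) = 76 / 100 * ε := by field_simp
  linarith

/-- The names of the random starts of the oracle. -/
def startSeeds (n : ℕ) : Set (Seed n) := {s | ∃ j i, s = Sum.inl (1, j, i)}

/-- The tape with the random starts of `ω₀`. -/
def withStarts (ω₀ ω : Tape n) : Tape n := mix (startSeeds n) ω₀ ω

theorem withStarts_start (ω₀ ω : Tape n) (t : ℕ) : (withStarts ω₀ ω).start t = ω₀.start t :=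
  funext fun i => mix_of_mem (by exact ⟨t, i, rfl⟩) _ _

theorem withStarts_zeta (ω₀ ω : Tape n) (t : ℕ) : (withStarts ω₀ ω).zeta t = ω (Sum.inr t) :=
  mix_of_notMem (by rintro ⟨j, i, h⟩; simp at h) _ _

theorem withStarts_vector (ω₀ ω : Tape n) (t : ℕ) :
    (withStarts ω₀ ω).vector 0 t = ω.vector 0 t :=
  funext fun i => mix_of_notMem (by rintro ⟨j, i, h⟩; simp at h) _ _

theorem withStarts_iterate_snd (ω₀ ω : Tape n) (t : ℕ) :
    (iterate C ε (withStarts ω₀ ω) t).2 = (iterate C ε ω₀ t).2 :=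
  iterate_snd_congr fun s _ => withStarts_start ω₀ ω s

theorem withStarts_stopTime (ω₀ ω : Tape n) (κ : ℝ) :
    stopTime C ε κ (withStarts ω₀ ω) = stopTime C ε κ ω₀ :=
  stopTime_congr (withStarts_start ω₀ ω) κ

theorem iterate_fst_succ (ω₀ ω : Tape n) (t : ℕ) :
    (iterate C ε (withStarts ω₀ ω) (t + 1)).1 =
      √(1 - stepSize t) • (iterate C ε (withStarts ω₀ ω) t).1 +
        (√(stepSize t) * ω (Sum.inr t)) •
          (√(n : ℝ) • lmo C ε (iterate C ε ω₀ t).2.diag (ω₀.start t)) := by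
  rw [← withStarts_iterate_snd ω₀ ω, ← withStarts_start ω₀ ω, ← withStarts_zeta ω₀ ω]
  rfl

theorem quadForm_direction (w x : Fin n → ℝ) :
    x ⬝ᵥ direction w *ᵥ x = n * (x ⬝ᵥ w) ^ 2 := by
  rw [direction, smul_mulVec, dotProduct_smul, vecMulVec_mulVec, smul_eq_mul]
  simp only [dotProduct_smul, dotProduct_comm w x]
  rw [sq]
  rfl

/-- Names of the numbers that enter the sample `z_t`, for given random starts. -/
def sampleSeeds (n t : ℕ) : Set (Seed n) :=
  {s | (∃ i, s = Sum.inl (0, 0, i)) ∨ ∃ j < t, s = Sum.inr j}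

theorem dependsOn_iterate_fst (ω₀ : Tape n) (t : ℕ) :
    DependsOn (fun ω : Tape n => (iterate C ε (withStarts ω₀ ω) t).1) (sampleSeeds n t) := by
  induction t with
  | zero =>
    intro ω ω' h
    change (withStarts ω₀ ω).vector 0 0 = (withStarts ω₀ ω').vector 0 0
    rw [withStarts_vector, withStarts_vector]
    exact funext fun i => h _ (Or.inl ⟨i, rfl⟩)
  | succ t ih =>
    intro ω ω' h
    have h1 : (iterate C ε (withStarts ω₀ ω) t).1 = (iterate C ε (withStarts ω₀ ω') t).1 :=
      ih fun s hs => h s (hs.imp_right fun ⟨j, hj, hs⟩ => ⟨j, by omega, hs⟩)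
    have h2 : ω (Sum.inr t) = ω' (Sum.inr t) := h _ (Or.inr ⟨t, by omega, rfl⟩)
    simp only [iterate_fst_succ, h1, h2]

/-- For given random starts, `z_t` is Gaussian with covariance `X_t`. -/
theorem isCentredGaussian_sample (ω₀ : Tape n) (t : ℕ) (x : Fin n → ℝ) :
    IsCentredGaussian (fun ω : Tape n => x ⬝ᵥ (iterate C ε (withStarts ω₀ ω) t).1)
      (x ⬝ᵥ (iterate C ε ω₀ t).2 *ᵥ x) := by
  induction t with
  | zero =>
    have h : ∀ ω : Tape n, (iterate C ε (withStarts ω₀ ω) 0).1 = ω.vector 0 0 := fun ω =>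
      withStarts_vector ω₀ ω 0
    have h' : (iterate C ε ω₀ 0).2 = 1 := rfl
    simp only [h, h', one_mulVec]
    exact isCentredGaussian_dotProduct_vector x 0 0
  | succ t ih =>
    set w := lmo C ε (iterate C ε ω₀ t).2.diag (ω₀.start t) with hw
    have hv : x ⬝ᵥ (iterate C ε ω₀ (t + 1)).2 *ᵥ x =
        √(1 - stepSize t) ^ 2 * (x ⬝ᵥ (iterate C ε ω₀ t).2 *ᵥ x) +
          (√(stepSize t) * √(n : ℝ) * (x ⬝ᵥ w)) ^ 2 := by
      rw [iterate_succ_snd, add_mulVec, dotProduct_add, smul_mulVec, smul_mulVec, dotProduct_smul,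
        dotProduct_smul, quadForm_direction, mul_pow, mul_pow,
        Real.sq_sqrt (sub_nonneg.2 (stepSize_le_one t)), Real.sq_sqrt (stepSize_nonneg t),
        Real.sq_sqrt (Nat.cast_nonneg n), smul_eq_mul, smul_eq_mul]
      ring
    have hf : ∀ ω : Tape n, x ⬝ᵥ (iterate C ε (withStarts ω₀ ω) (t + 1)).1 =
        √(1 - stepSize t) * (x ⬝ᵥ (iterate C ε (withStarts ω₀ ω) t).1) +
          √(stepSize t) * √(n : ℝ) * (x ⬝ᵥ w) * ω (Sum.inr t) := fun ω => by
      rw [iterate_fst_succ, dotProduct_add, dotProduct_smul, dotProduct_smul, dotProduct_smul,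
        smul_eq_mul, smul_eq_mul, smul_eq_mul]
      ring
    simp only [hf]
    rw [hv]
    -- `ζ_t` is not among the numbers that enter `z_t`, so the two variances add, in the same convex
    -- combination as the covariances.
    refine (ih.const_mul _).add (isCentredGaussian_eval _ _) (S := sampleSeeds n t) ?_ ?_
    · intro ω ω' h
      simp only [(dependsOn_iterate_fst (C := C) (ε := ε) ω₀ t) h]
    · refine dependsOn_eval ?_ _
      rintro (⟨i, h⟩ | ⟨j, hj, h⟩)
      · simp at h
      · simp only [Sum.inr.injEq] at h
        omega

/-- The correlation matrix after the rounding noise has been added. -/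
def correlation (X : Matrix (Fin n) (Fin n) ℝ) : Matrix (Fin n) (Fin n) ℝ :=
  (⨆ j, X.diag j)⁻¹ • X + diagonal fun i => 1 - X.diag i / ⨆ j, X.diag j

/-- The vector whose signs are returned. -/
def signArgument (C : Matrix (Fin n) (Fin n) ℝ) (ε κ : ℝ) (ω : Tape n) : Fin n → ℝ := fun i =>
  sample C ε κ ω i / √(⨆ j, (covariance C ε κ ω).diag j) +
    √(1 - (covariance C ε κ ω).diag i / ⨆ j, (covariance C ε κ ω).diag j) * ω.rounding i

theorem le_iSup_diag (X : Matrix (Fin n) (Fin n) ℝ) (i : Fin n) : X i i ≤ ⨆ j, X.diag j :=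
  le_ciSup (f := fun j => X.diag j) (Set.finite_range _).bddAbove i

theorem div_iSup_diag_le_one {X : Matrix (Fin n) (Fin n) ℝ} (hX : X.PosSemidef) (i : Fin n) :
    X.diag i / ⨆ j, X.diag j ≤ 1 :=
  div_le_one_of_le₀ (le_iSup_diag X i) (hX.diag_nonneg.trans (le_iSup_diag X i))

/-- For given random starts, the vector whose signs are returned is Gaussian. -/
theorem isCentredGaussian_signArgument (κ : ℝ) (ω₀ : Tape n) (u : Fin n → ℝ) :
    IsCentredGaussian (fun ω : Tape n => u ⬝ᵥ signArgument C ε κ (withStarts ω₀ ω))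
      (u ⬝ᵥ correlation (covariance C ε κ ω₀) *ᵥ u) := by
  set t := stopTime C ε κ ω₀ with ht
  have hX : covariance C ε κ ω₀ = (iterate C ε ω₀ t).2 := rfl
  set X := (iterate C ε ω₀ t).2 with hXdef
  have hP : X.PosSemidef := (iterate_feasible C ε ω₀ t).1
  rw [hX]
  set m := ⨆ j, X.diag j with hm
  have hm0 : 0 ≤ m := Real.iSup_nonneg fun j => hP.diag_nonneg
  set y : Fin n → ℝ := fun i => u i * √(1 - X.diag i / m) with hy
  have hcov : ∀ ω, covariance C ε κ (withStarts ω₀ ω) = X := fun ω => by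
    rw [covariance, withStarts_stopTime, withStarts_iterate_snd]
  have hsam : ∀ ω, sample C ε κ (withStarts ω₀ ω) = (iterate C ε (withStarts ω₀ ω) t).1 := fun ω => by
    rw [sample, withStarts_stopTime]
  have hf : ∀ ω : Tape n, u ⬝ᵥ signArgument C ε κ (withStarts ω₀ ω) =
      (√m)⁻¹ * (u ⬝ᵥ (iterate C ε (withStarts ω₀ ω) t).1) + y ⬝ᵥ ω.vector 0 1 := fun ω => by
    have hr : (withStarts ω₀ ω).rounding = ω.vector 0 1 := withStarts_vector ω₀ ω 1
    simp only [signArgument, hcov, hsam, hr, dotProduct, Finset.mul_sum, ← Finset.sum_add_distrib]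
    refine Finset.sum_congr rfl fun i _ => ?_
    rw [← hm, hy]
    ring
  have hv : u ⬝ᵥ correlation X *ᵥ u = (√m)⁻¹ ^ 2 * (u ⬝ᵥ X *ᵥ u) + y ⬝ᵥ y := by
    rw [correlation, add_mulVec, dotProduct_add, smul_mulVec, dotProduct_smul, smul_eq_mul, inv_pow,
      Real.sq_sqrt hm0]
    congr 1
    simp only [dotProduct, mulVec_diagonal]
    refine Finset.sum_congr rfl fun i _ => ?_
    have h : √(1 - X.diag i / m) * √(1 - X.diag i / m) = 1 - X.diag i / m :=
      Real.mul_self_sqrt (sub_nonneg.2 (div_iSup_diag_le_one hP i))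
    rw [← hm, ← h, hy]
    ring
  simp only [hf]
  rw [hv]
  -- The rounding noise is vector `1` of stream `0`, while the sample uses vector `0` of that stream
  -- and the scalar stream: they are independent.
  refine ((isCentredGaussian_sample ω₀ t u).const_mul _).add
    (isCentredGaussian_dotProduct_vector y 0 1) (S := sampleSeeds n t) ?_ ?_
  · intro ω ω' h
    simp only [(dependsOn_iterate_fst (C := C) (ε := ε) ω₀ t) h]
  · intro ω ω' h
    have : Tape.vector ω 0 1 = Tape.vector ω' 0 1 := funext fun i => h _ (by
      rintro (⟨i, h⟩ | ⟨j, -, h⟩) <;> simp at h)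
    simp only [this]

end Conditioning

/-! ### Signs of correlated Gaussian random variables -/

section Signs

open scoped ENNReal

theorem gaussian_prod_eq_withDensity :
    (gaussianReal 0 1).prod (gaussianReal 0 1) = (volume : Measure (ℝ × ℝ)).withDensity
      fun p => ENNReal.ofReal ((2 * Real.pi)⁻¹ * Real.exp (-(p.1 ^ 2 + p.2 ^ 2) / 2)) := by
  rw [gaussianReal_of_var_ne_zero _ one_ne_zero,
    prod_withDensity (measurable_gaussianPDF _ _) (measurable_gaussianPDF _ _)]
  congr 1
  ext1 p
  rw [gaussianPDF, gaussianPDF, ← ENNReal.ofReal_mul (gaussianPDFReal_nonneg _ _ _)]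
  congr 1
  simp only [gaussianPDFReal, NNReal.coe_one, mul_one, sub_zero]
  rw [mul_mul_mul_comm, ← mul_inv, Real.mul_self_sqrt (by positivity), ← Real.exp_add]
  congr 2
  ring

/-- The radial part of the density of a standard Gaussian vector in the plane. -/
def radialMass : ℝ≥0∞ :=
  ∫⁻ r in Set.Ioi (0 : ℝ), ENNReal.ofReal r *
    ENNReal.ofReal ((2 * Real.pi)⁻¹ * Real.exp (-r ^ 2 / 2))

/-- The density depends on the radius alone, so in polar coordinates the mass of a cone is a radial
integral times the measure of its angles. -/
theorem gaussian_prod_cone {A : Set (ℝ × ℝ)} (hA : MeasurableSet A) {Φ : Set ℝ}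
    (hΦ : MeasurableSet Φ)
    (h : ∀ r > 0, ∀ φ ∈ Set.Ioo (-Real.pi) Real.pi,
      ((r * Real.cos φ, r * Real.sin φ) ∈ A ↔ φ ∈ Φ)) :
    ((gaussianReal 0 1).prod (gaussianReal 0 1)) A =
      radialMass * volume (Φ ∩ Set.Ioo (-Real.pi) Real.pi) := by
  rw [gaussian_prod_eq_withDensity, withDensity_apply _ hA, ← lintegral_indicator hA,
    ← lintegral_comp_polarCoord_symm]
  have h1 : ∀ p ∈ polarCoord.target,
      ENNReal.ofReal p.1 • A.indicator (fun p : ℝ × ℝ =>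
        ENNReal.ofReal ((2 * Real.pi)⁻¹ * Real.exp (-(p.1 ^ 2 + p.2 ^ 2) / 2)))
          (polarCoord.symm p) =
      (ENNReal.ofReal p.1 * ENNReal.ofReal ((2 * Real.pi)⁻¹ * Real.exp (-p.1 ^ 2 / 2))) *
        Φ.indicator 1 p.2 := by
    rintro ⟨r, φ⟩ ⟨hr, hφ⟩
    have hmem := h r hr φ hφ
    have hsq : (r * Real.cos φ) ^ 2 + (r * Real.sin φ) ^ 2 = r ^ 2 := by
      rw [mul_pow, mul_pow, ← mul_add, Real.cos_sq_add_sin_sq, mul_one]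
    rw [polarCoord_symm_apply]
    simp only [smul_eq_mul]
    by_cases hin : φ ∈ Φ
    · rw [Set.indicator_of_mem (hmem.2 hin), Set.indicator_of_mem hin, hsq]
      simp
    · rw [Set.indicator_of_notMem (fun h => hin (hmem.1 h)), Set.indicator_of_notMem hin]
      simp
  rw [setLIntegral_congr_fun polarCoord.open_target.measurableSet h1, polarCoord_target,
    Measure.volume_eq_prod, ← Measure.prod_restrict,
    lintegral_prod_mul (f := fun r : ℝ => ENNReal.ofReal r *
      ENNReal.ofReal ((2 * Real.pi)⁻¹ * Real.exp (-r ^ 2 / 2))) (g := Φ.indicator 1) (by fun_prop) ((measurable_one.indicator hΦ).aemeasurable),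
    lintegral_indicator_one hΦ, Measure.restrict_apply hΦ]
  rfl

/-- The radial integral need not be evaluated: the whole plane is a cone of mass one. -/
theorem radialMass_mul : radialMass * ENNReal.ofReal (2 * Real.pi) = 1 := by
  have h := gaussian_prod_cone MeasurableSet.univ MeasurableSet.univ
    (fun r _ φ _ => by simp : ∀ r > 0, ∀ φ ∈ Set.Ioo (-Real.pi) Real.pi,
      ((r * Real.cos φ, r * Real.sin φ) ∈ (Set.univ : Set (ℝ × ℝ)) ↔ φ ∈ Set.univ))
  rw [measure_univ, Set.univ_inter, Real.volume_Ioo] at h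
  rw [h]
  congr 2
  ring

/-- Together with `cos_wedge_of_mem_Ioo` this encloses the angles of the wedge between two intervals
of the same length `θ`, so the boundary angles need no attention. -/
theorem mem_Ico_of_cos_wedge {θ φ : ℝ} (hθ0 : 0 ≤ θ)
    (hφ : φ ∈ Set.Ioo (-Real.pi) Real.pi) (h : 0 ≤ Real.cos φ) (h' : Real.cos (φ - θ) < 0) :
    φ ∈ Set.Ico (-(Real.pi / 2)) (θ - Real.pi / 2) := by
  have hpi := Real.pi_pos
  obtain ⟨h1, h2⟩ := hφ
  have h3 : -(Real.pi / 2) ≤ φ := by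
    by_contra h3
    have := Real.cos_neg_of_pi_div_two_lt_of_lt (x := -φ) (by linarith) (by linarith)
    rw [Real.cos_neg] at this
    linarith
  refine ⟨h3, ?_⟩
  have h4 : φ ≤ Real.pi / 2 := by
    by_contra h4
    have := Real.cos_neg_of_pi_div_two_lt_of_lt (x := φ) (by linarith) (by linarith)
    linarith
  by_contra h6
  have := Real.cos_nonneg_of_neg_pi_div_two_le_of_le (x := φ - θ) (by linarith) (by linarith)
  linarith

theorem cos_wedge_of_mem_Ioo {θ φ : ℝ} (hθ : θ ≤ Real.pi)
    (hφ : φ ∈ Set.Ioo (-(Real.pi / 2)) (θ - Real.pi / 2)) :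
    0 ≤ Real.cos φ ∧ Real.cos (φ - θ) < 0 := by
  obtain ⟨h3, h4⟩ := hφ
  refine ⟨Real.cos_nonneg_of_neg_pi_div_two_le_of_le h3.le (by linarith), ?_⟩
  have := Real.cos_neg_of_pi_div_two_lt_of_lt (x := -(φ - θ)) (by linarith) (by linarith)
  rwa [Real.cos_neg] at this

theorem gaussian_prod_wedge {θ : ℝ} (hθ0 : 0 ≤ θ) (hθ : θ ≤ Real.pi) :
    ((gaussianReal 0 1).prod (gaussianReal 0 1)).real
      {p : ℝ × ℝ | 0 ≤ p.1 ∧ Real.cos θ * p.1 + Real.sin θ * p.2 < 0} = θ / (2 * Real.pi) := by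
  have hpi := Real.pi_pos
  have hA : MeasurableSet {p : ℝ × ℝ | 0 ≤ p.1 ∧ Real.cos θ * p.1 + Real.sin θ * p.2 < 0} :=
    (measurableSet_le measurable_const measurable_fst).inter
      (measurableSet_lt (f := fun p : ℝ × ℝ => Real.cos θ * p.1 + Real.sin θ * p.2)
        (by fun_prop) measurable_const)
  have hΦ : MeasurableSet {φ : ℝ | 0 ≤ Real.cos φ ∧ Real.cos (φ - θ) < 0} :=
    (measurableSet_le measurable_const Real.measurable_cos).inter
      (measurableSet_lt (f := fun φ : ℝ => Real.cos (φ - θ)) (by fun_prop) measurable_const)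
  have hcone := gaussian_prod_cone hA hΦ fun r hr φ hφ => by
      simp only [Set.mem_ofPred_eq, Real.cos_sub]
      have h1 : Real.cos θ * (r * Real.cos φ) + Real.sin θ * (r * Real.sin φ) =
          r * (Real.cos φ * Real.cos θ + Real.sin φ * Real.sin θ) := by ring
      have h2 : ∀ x : ℝ, r * x < 0 ↔ x < 0 := fun x =>
        ⟨fun h => by by_contra h'; exact absurd (mul_nonneg hr.le (not_lt.1 h')) (not_le.2 h),
          mul_neg_of_pos_of_neg hr⟩
      simp only [h1, h2, mul_nonneg_iff_of_pos_left hr]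
  have hvol : volume ({φ : ℝ | 0 ≤ Real.cos φ ∧ Real.cos (φ - θ) < 0} ∩
      Set.Ioo (-Real.pi) Real.pi) = ENNReal.ofReal θ := by
    have e : θ - Real.pi / 2 - -(Real.pi / 2) = θ := by ring
    refine le_antisymm ?_ ?_
    · refine (measure_mono (t := Set.Ico (-(Real.pi / 2)) (θ - Real.pi / 2)) ?_).trans ?_
      · rintro φ ⟨⟨h1, h2⟩, h3⟩
        exact mem_Ico_of_cos_wedge hθ0 h3 h1 h2
      · rw [Real.volume_Ico, e]
    · refine le_trans ?_ (measure_mono (s := Set.Ioo (-(Real.pi / 2)) (θ - Real.pi / 2)) ?_)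
      · rw [Real.volume_Ioo, e]
      · intro φ hφ
        exact ⟨cos_wedge_of_mem_Ioo hθ hφ, by linarith [hφ.1], by linarith [hφ.2]⟩
  rw [hvol] at hcone
  rw [measureReal_def, hcone, ENNReal.toReal_mul, ENNReal.toReal_ofReal hθ0]
  have h := congrArg ENNReal.toReal radialMass_mul
  rw [ENNReal.toReal_mul, ENNReal.toReal_ofReal (by positivity), ENNReal.toReal_one] at h
  rw [eq_div_iff (by positivity), mul_right_comm, h, one_mul]

theorem map_gaussian_prod_linear (a b : ℝ) :
    ((gaussianReal 0 1).prod (gaussianReal 0 1)).map (fun p : ℝ × ℝ => a * p.1 + b * p.2) =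
      gaussianReal 0 (a ^ 2 + b ^ 2).toNNReal := by
  have hind : IndepFun (fun p : ℝ × ℝ => a * p.1) (fun p : ℝ × ℝ => b * p.2)
      ((gaussianReal 0 1).prod (gaussianReal 0 1)) :=
    indepFun_prod (measurable_const_mul a) (measurable_const_mul b)
  have h1 : ((gaussianReal 0 1).prod (gaussianReal 0 1)).map (fun p : ℝ × ℝ => a * p.1) =
      gaussianReal 0 (a ^ 2).toNNReal := by
    have : (fun p : ℝ × ℝ => a * p.1) = (fun x => a * x) ∘ Prod.fst := rfl
    rw [this, ← Measure.map_map (measurable_const_mul a) measurable_fst, Measure.map_fst_prod,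
      measure_univ, one_smul, gaussianReal_map_const_mul]
    congr 1
    · ring
    · ext; simp [Real.coe_toNNReal _ (sq_nonneg a)]
  have h2 : ((gaussianReal 0 1).prod (gaussianReal 0 1)).map (fun p : ℝ × ℝ => b * p.2) =
      gaussianReal 0 (b ^ 2).toNNReal := by
    have : (fun p : ℝ × ℝ => b * p.2) = (fun x => b * x) ∘ Prod.snd := rfl
    rw [this, ← Measure.map_map (measurable_const_mul b) measurable_snd, Measure.map_snd_prod,
      measure_univ, one_smul, gaussianReal_map_const_mul]
    congr 1
    · ring
    · ext; simp [Real.coe_toNNReal _ (sq_nonneg b)]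
  have h := gaussianReal_add_gaussianReal_of_indepFun hind h1 h2
  rw [add_zero, ← Real.toNNReal_add (sq_nonneg a) (sq_nonneg b)] at h
  exact h

variable {Ω : Type*} [MeasurableSpace Ω] {P : Measure Ω} [IsProbabilityMeasure P]

/-- The joint law of two jointly Gaussian random variables with unit variance. -/
theorem map_pair_gaussian {U V : Ω → ℝ} (hU : Measurable U) (hV : Measurable V) {θ : ℝ}
    (h : ∀ s r : ℝ, P.map (fun ω => s * U ω + r * V ω) =
      gaussianReal 0 (s ^ 2 + 2 * Real.cos θ * s * r + r ^ 2).toNNReal) :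
    P.map (fun ω => (U ω, V ω)) = ((gaussianReal 0 1).prod (gaussianReal 0 1)).map
      fun p => (p.1, Real.cos θ * p.1 + Real.sin θ * p.2) := by
  have : IsProbabilityMeasure (P.map fun ω => (U ω, V ω)) :=
    Measure.isProbabilityMeasure_map (hU.prodMk hV).aemeasurable
  have hlin : Measurable fun p : ℝ × ℝ => (p.1, Real.cos θ * p.1 + Real.sin θ * p.2) := by fun_prop
  have : IsProbabilityMeasure (((gaussianReal 0 1).prod (gaussianReal 0 1)).map
      fun p : ℝ × ℝ => (p.1, Real.cos θ * p.1 + Real.sin θ * p.2)) :=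
    Measure.isProbabilityMeasure_map hlin.aemeasurable
  -- Cramér-Wold: a law in the plane is determined by the laws of its linear functionals, which are
  -- Gaussian on both sides.
  refine Measure.ext_of_charFunDual ?_
  ext L
  have hL : ∀ x y : ℝ, L (x, y) = L (1, 0) * x + L (0, 1) * y := fun x y => by
    have : ((x, y) : ℝ × ℝ) = x • (1, 0) + y • (0, 1) := by simp
    rw [this, map_add, map_smul, map_smul, smul_eq_mul, smul_eq_mul]
    ring
  rw [charFunDual_eq_charFun_map_one, charFunDual_eq_charFun_map_one,
    Measure.map_map (by fun_prop) (hU.prodMk hV), Measure.map_map (by fun_prop) hlin]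
  congr 1
  have e1 : (L ∘ fun ω => (U ω, V ω)) = fun ω => L (1, 0) * U ω + L (0, 1) * V ω := by
    ext ω; exact hL _ _
  have e2 : (L ∘ fun p : ℝ × ℝ => (p.1, Real.cos θ * p.1 + Real.sin θ * p.2)) =
      fun p => (L (1, 0) + L (0, 1) * Real.cos θ) * p.1 + (L (0, 1) * Real.sin θ) * p.2 := by
    ext p
    rw [Function.comp_apply, hL]
    ring
  rw [e1, e2, h, map_gaussian_prod_linear]
  congr 2
  have := Real.sin_sq_add_cos_sq θ
  linear_combination (-(L (0, 1)) ^ 2) * this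

theorem prob_sign_change {U V : Ω → ℝ} (hU : Measurable U) (hV : Measurable V) {θ : ℝ}
    (hθ0 : 0 ≤ θ) (hθ : θ ≤ Real.pi)
    (h : ∀ s r : ℝ, P.map (fun ω => s * U ω + r * V ω) =
      gaussianReal 0 (s ^ 2 + 2 * Real.cos θ * s * r + r ^ 2).toNNReal) :
    P.real {ω | 0 ≤ U ω ∧ V ω < 0} = θ / (2 * Real.pi) := by
  have hA : MeasurableSet {p : ℝ × ℝ | 0 ≤ p.1 ∧ p.2 < 0} :=
    (measurableSet_le measurable_const measurable_fst).inter
      (measurableSet_lt measurable_snd measurable_const)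
  have h1 : P.real {ω | 0 ≤ U ω ∧ V ω < 0} =
      (P.map fun ω => (U ω, V ω)).real {p : ℝ × ℝ | 0 ≤ p.1 ∧ p.2 < 0} := by
    rw [map_measureReal_apply (hU.prodMk hV) hA]
    rfl
  rw [h1, map_pair_gaussian hU hV h, map_measureReal_apply (by fun_prop) hA]
  exact gaussian_prod_wedge hθ0 hθ

/-- Sheppard's formula for the signs of correlated Gaussian random variables. -/
theorem integral_sign_mul_sign {U V : Ω → ℝ} (hU : Measurable U) (hV : Measurable V) {θ : ℝ}
    (hθ0 : 0 ≤ θ) (hθ : θ ≤ Real.pi)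
    (h : ∀ s r : ℝ, P.map (fun ω => s * U ω + r * V ω) =
      gaussianReal 0 (s ^ 2 + 2 * Real.cos θ * s * r + r ^ 2).toNNReal) :
    ∫ ω, (if 0 ≤ U ω then (1 : ℝ) else -1) * (if 0 ≤ V ω then 1 else -1) ∂P =
      1 - 2 / Real.pi * θ := by
  have h1 := prob_sign_change hU hV hθ0 hθ h
  have h2 := prob_sign_change (P := P) hV hU hθ0 hθ fun s r => by
    have := h r s
    simp only [add_comm (r * U _)] at this
    rw [this]
    congr 2
    ring
  have hA : MeasurableSet {ω | 0 ≤ U ω ∧ V ω < 0} :=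
    (measurableSet_le measurable_const hU).inter (measurableSet_lt hV measurable_const)
  have hB : MeasurableSet {ω | 0 ≤ V ω ∧ U ω < 0} :=
    (measurableSet_le measurable_const hV).inter (measurableSet_lt hU measurable_const)
  -- The product of signs is `-1` exactly on two disjoint events, each of probability `θ / (2 π)`.
  have hf : ∀ ω, (if 0 ≤ U ω then (1 : ℝ) else -1) * (if 0 ≤ V ω then 1 else -1) =
      1 - (2 * {ω | 0 ≤ U ω ∧ V ω < 0}.indicator (fun _ => (1 : ℝ)) ω +
        2 * {ω | 0 ≤ V ω ∧ U ω < 0}.indicator (fun _ => (1 : ℝ)) ω) := fun ω => by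
    simp only [Set.indicator, Set.mem_ofPred_eq]
    rcases le_or_gt 0 (U ω) with hu | hu <;> rcases le_or_gt 0 (V ω) with hv | hv
    · rw [if_pos hu, if_pos hv, if_neg (fun h => absurd h.2 (not_lt.2 hv)),
        if_neg (fun h => absurd h.2 (not_lt.2 hu))]; norm_num
    · rw [if_pos hu, if_neg (not_le.2 hv), if_pos ⟨hu, hv⟩,
        if_neg (fun h => absurd h.2 (not_lt.2 hu))]; norm_num
    · rw [if_neg (not_le.2 hu), if_pos hv, if_neg (fun h => absurd h.2 (not_lt.2 hv)),
        if_pos ⟨hv, hu⟩]; norm_num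
    · rw [if_neg (not_le.2 hu), if_neg (not_le.2 hv), if_neg (fun h => absurd h.1 (not_le.2 hu)),
        if_neg (fun h => absurd h.1 (not_le.2 hv))]; norm_num
  simp only [hf]
  have i1 : Integrable ({ω | 0 ≤ U ω ∧ V ω < 0}.indicator fun _ => (1 : ℝ)) P :=
    (integrable_const 1).indicator hA
  have i2 : Integrable ({ω | 0 ≤ V ω ∧ U ω < 0}.indicator fun _ => (1 : ℝ)) P :=
    (integrable_const 1).indicator hB
  have i3 : Integrable (fun ω => 2 * {ω | 0 ≤ U ω ∧ V ω < 0}.indicator (fun _ => (1 : ℝ)) ω +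
      2 * {ω | 0 ≤ V ω ∧ U ω < 0}.indicator (fun _ => (1 : ℝ)) ω) P :=
    (i1.const_mul 2).add (i2.const_mul 2)
  rw [integral_sub (integrable_const _) i3,
    integral_add (i1.const_mul 2) (i2.const_mul 2), integral_const_mul, integral_const_mul,
    integral_indicator_const _ hA, integral_indicator_const _ hB, h1, h2]
  have := Real.pi_pos
  simp
  field_simp
  ring

end Signs

end MaxCutFW

namespace MaxCutFW

/-! ### The Goemans-Williamson constant -/

/-- Cleared of the denominator, the inequality also covers `θ = 0`, which occurs for correlations
`±1`. -/
theorem alphaGW_mul_le {θ : ℝ} (h0 : 0 ≤ θ) (hθ : θ ≤ Real.pi) :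
    alphaGW * (1 - Real.cos θ) ≤ 2 / Real.pi * θ := by
  have hpi := Real.pi_pos
  rcases h0.eq_or_lt with rfl | h0
  · simp
  have hcos : 0 < 1 - Real.cos θ := by
    have := Real.cos_lt_cos_of_nonneg_of_le_pi le_rfl hθ h0
    rw [Real.cos_zero] at this
    linarith
  have hbdd : BddBelow
      ((fun θ : ℝ => 2 / Real.pi * (θ / (1 - Real.cos θ))) '' Set.Ioc 0 Real.pi) := by
    refine ⟨0, ?_⟩
    rintro _ ⟨x, hx, rfl⟩
    have := Real.cos_le_one x
    exact mul_nonneg (by positivity) (div_nonneg hx.1.le (by linarith))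
  have h : alphaGW ≤ 2 / Real.pi * (θ / (1 - Real.cos θ)) := csInf_le hbdd ⟨θ, ⟨h0, hθ⟩, rfl⟩
  calc alphaGW * (1 - Real.cos θ) ≤ 2 / Real.pi * (θ / (1 - Real.cos θ)) * (1 - Real.cos θ) :=
        mul_le_mul_of_nonneg_right h hcos.le
    _ = _ := by field_simp

theorem alphaGW_nonneg : 0 ≤ alphaGW := by
  refine Real.sInf_nonneg ?_
  rintro _ ⟨x, hx, rfl⟩
  have := Real.cos_le_one x
  have := Real.pi_pos
  exact mul_nonneg (by positivity) (div_nonneg hx.1.le (by linarith))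

theorem alphaGW_le_one : alphaGW ≤ 1 := by
  have h := alphaGW_mul_le Real.pi_pos.le le_rfl
  rw [Real.cos_pi, div_mul_cancel₀ _ Real.pi_pos.ne'] at h
  linarith

/-! ### Expected value of the signs of a Gaussian vector -/

section SignVector

variable {n : ℕ}

def signVector (y : Fin n → ℝ) : Fin n → ℝ := fun i => if 0 ≤ y i then 1 else -1

theorem isSignVector_signVector (y : Fin n → ℝ) : IsSignVector (signVector y) := fun i => by
  unfold signVector
  split_ifs
  · exact Or.inl rfl
  · exact Or.inr rfl

theorem IsSignVector.mul_self {x : Fin n → ℝ} (hx : IsSignVector x) (i : Fin n) :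
    x i * x i = 1 := by
  rcases hx i with h | h <;> rw [h] <;> norm_num

theorem IsSignVector.abs_eq {x : Fin n → ℝ} (hx : IsSignVector x) (i : Fin n) : |x i| = 1 := by
  rcases hx i with h | h <;> rw [h] <;> norm_num

theorem IsSignVector.abs_quadForm_le {x : Fin n → ℝ} (hx : IsSignVector x)
    (C : Matrix (Fin n) (Fin n) ℝ) : |x ⬝ᵥ C *ᵥ x| ≤ ∑ i, ∑ j, |C i j| := by
  rw [quadForm_eq_sum]
  refine (Finset.abs_sum_le_sum_abs _ _).trans (Finset.sum_le_sum fun i _ => ?_)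
  refine (Finset.abs_sum_le_sum_abs _ _).trans (Finset.sum_le_sum fun j _ => ?_)
  rw [abs_mul, abs_mul, hx.abs_eq, hx.abs_eq, one_mul, mul_one]

theorem quadForm_le_maxCut {x : Fin n → ℝ} (hx : IsSignVector x) (C : Matrix (Fin n) (Fin n) ℝ) :
    x ⬝ᵥ C *ᵥ x ≤ maxCut C := by
  refine le_csSup ⟨∑ i, ∑ j, |C i j|, ?_⟩ ⟨x, hx, rfl⟩
  rintro _ ⟨y, hy, rfl⟩
  exact (abs_le.1 (hy.abs_quadForm_le C)).2

theorem maxCut_le {C : Matrix (Fin n) (Fin n) ℝ} {b : ℝ}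
    (h : ∀ x : Fin n → ℝ, IsSignVector x → x ⬝ᵥ C *ᵥ x ≤ b) : maxCut C ≤ b := by
  refine csSup_le ⟨_, 1, fun i => Or.inl rfl, rfl⟩ ?_
  rintro _ ⟨y, hy, rfl⟩
  exact h y hy

/-- The vector `Y` is centred Gaussian with covariance matrix `R`. -/
def IsGaussianVector (Y : Tape n → Fin n → ℝ) (R : Matrix (Fin n) (Fin n) ℝ) : Prop :=
  ∀ u : Fin n → ℝ, IsCentredGaussian (fun ω => u ⬝ᵥ Y ω) (u ⬝ᵥ R *ᵥ u)

variable {Y : Tape n → Fin n → ℝ} {R : Matrix (Fin n) (Fin n) ℝ}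

theorem IsGaussianVector.measurable (hY : IsGaussianVector Y R) (i : Fin n) :
    Measurable fun ω => Y ω i := by
  have := (hY (Pi.single i 1)).2.1
  simpa only [single_one_dotProduct] using this

theorem IsGaussianVector.integral_sign (hY : IsGaussianVector Y R) (hR : R.IsSymm)
    (hdiag : ∀ i, R i i = 1) (i j : Fin n) (hij : |R i j| ≤ 1) :
    ∫ ω, signVector (Y ω) i * signVector (Y ω) j ∂tapeLaw n =
      1 - 2 / Real.pi * Real.arccos (R i j) := by
  refine integral_sign_mul_sign (hY.measurable i) (hY.measurable j) (Real.arccos_nonneg _)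
    (Real.arccos_le_pi _) fun s r => ?_
  have h := (hY (s • Pi.single i 1 + r • Pi.single j 1)).2.2
  have h1 : ∀ ω, (s • Pi.single i 1 + r • Pi.single j 1) ⬝ᵥ Y ω = s * Y ω i + r * Y ω j := fun ω => by
    simp [add_dotProduct, smul_dotProduct]
  have h2 : (s • Pi.single i 1 + r • Pi.single j 1) ⬝ᵥ
      R *ᵥ (s • Pi.single i (1 : ℝ) + r • Pi.single j 1) =
      s ^ 2 + 2 * Real.cos (Real.arccos (R i j)) * s * r + r ^ 2 := by
    rw [Real.cos_arccos (abs_le.1 hij).1 (abs_le.1 hij).2]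
    simp only [add_dotProduct, smul_dotProduct, single_one_dotProduct, mulVec_add, mulVec_smul,
      mulVec_single_one, Pi.add_apply, Pi.smul_apply, col_apply, smul_eq_mul, hdiag, hR.apply i j]
    ring
  rw [h2] at h
  simp only [h1] at h
  exact h

theorem measurable_signVector (hY : IsGaussianVector Y R) (i : Fin n) :
    Measurable fun ω => signVector (Y ω) i :=
  Measurable.ite (measurableSet_le measurable_const (hY.measurable i)) measurable_const
    measurable_const

theorem IsGaussianVector.integral_quadForm (hY : IsGaussianVector Y R) (hR : R.IsSymm)
    (hdiag : ∀ i, R i i = 1) (hle : ∀ i j, |R i j| ≤ 1) (C : Matrix (Fin n) (Fin n) ℝ) :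
    ∫ ω, signVector (Y ω) ⬝ᵥ C *ᵥ signVector (Y ω) ∂tapeLaw n =
      ∑ i, ∑ j, C i j * (1 - 2 / Real.pi * Real.arccos (R i j)) := by
  have hint : ∀ i j, Integrable
      (fun ω => C i j * (signVector (Y ω) i * signVector (Y ω) j)) (tapeLaw n) := fun i j => by
    refine Integrable.const_mul ?_ _
    refine Integrable.of_bound
      ((measurable_signVector hY i).mul (measurable_signVector hY j)).aestronglyMeasurable 1 ?_
    refine Filter.Eventually.of_forall fun ω => ?_
    rw [Real.norm_eq_abs, abs_mul, (isSignVector_signVector _).abs_eq,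
      (isSignVector_signVector _).abs_eq, one_mul]
  simp only [quadForm_eq_sum]
  rw [integral_finsetSum _ fun i _ => integrable_finsetSum _ fun j _ => hint i j]
  refine Finset.sum_congr rfl fun i _ => ?_
  rw [integral_finsetSum _ fun j _ => hint i j]
  refine Finset.sum_congr rfl fun j _ => ?_
  rw [integral_const_mul, hY.integral_sign hR hdiag i j (hle i j)]

/-- The Goemans-Williamson bound for diagonally dominant matrices. -/
theorem IsGaussianVector.goemansWilliamson (hY : IsGaussianVector Y R) (hR : R.IsSymm)
    (hdiag : ∀ i, R i i = 1) (hle : ∀ i j, |R i j| ≤ 1) {C : Matrix (Fin n) (Fin n) ℝ}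
    (hC : IsDiagDominant C) :
    alphaGW * ∑ i, ∑ j, C i j * R i j ≤
      ∫ ω, signVector (Y ω) ⬝ᵥ C *ᵥ signVector (Y ω) ∂tapeLaw n := by
  rw [hY.integral_quadForm hR hdiag hle, sum_sum_eq_diag_add, sum_sum_eq_diag_add, Finset.mul_sum]
  refine Finset.sum_le_sum fun i _ => ?_
  have hpi := Real.pi_pos
  rw [hdiag, Real.arccos_one, mul_zero, sub_zero, mul_one, mul_add, Finset.mul_sum]
  -- A dominant form is a sum of terms `|C i j| (x i ± x j)²` and a nonnegative diagonal part.
  -- Negative entries use the defining inequality of `alphaGW` at the angle `arccos (R i j)`,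
  -- nonnegative ones at its supplement.
  have hterm : ∀ j, alphaGW * (C i j * R i j) + alphaGW * |C i j| ≤
      C i j * (1 - 2 / Real.pi * Real.arccos (R i j)) + |C i j| := fun j => by
    have hr := abs_le.1 (hle i j)
    have h1 := alphaGW_mul_le (Real.arccos_nonneg (R i j)) (Real.arccos_le_pi _)
    have h2 := alphaGW_mul_le (θ := Real.pi - Real.arccos (R i j))
      (sub_nonneg.2 (Real.arccos_le_pi _)) (sub_le_self _ (Real.arccos_nonneg _))
    rw [Real.cos_arccos hr.1 hr.2] at h1
    rw [Real.cos_pi_sub, Real.cos_arccos hr.1 hr.2, mul_sub (2 / Real.pi), div_mul_cancel₀ _ hpi.ne'] at h2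
    rcases abs_cases (C i j) with ⟨h3, h4⟩ | ⟨h3, h4⟩ <;> rw [h3]
    · have := mul_le_mul_of_nonneg_left h2 h4
      linarith
    · have := mul_le_mul_of_nonneg_left h1 (neg_nonneg.2 h4.le)
      linarith
  have hsum := Finset.sum_le_sum fun j (_ : j ∈ Finset.univ.erase i) => hterm j
  rw [Finset.sum_add_distrib, Finset.sum_add_distrib, ← Finset.mul_sum _ _ alphaGW] at hsum
  -- The surplus on the diagonal is unaffected by rounding, so `alphaGW ≤ 1` is enough for it.
  have h5 := mul_le_mul_of_nonneg_right alphaGW_le_one (sub_nonneg.2 (hC.2 i))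
  rw [← Finset.mul_sum] at hsum ⊢
  linarith

theorem isGaussianVector_vector (σ : Fin 2) (j : ℕ) :
    IsGaussianVector (fun ω : Tape n => ω.vector σ j) 1 := fun u => by
  rw [one_mulVec]
  exact isCentredGaussian_dotProduct_vector u σ j

theorem integrable_quadForm_of_isSignVector {Z : Tape n → Fin n → ℝ} (hZ : Measurable Z)
    (hs : ∀ ω, IsSignVector (Z ω)) (C : Matrix (Fin n) (Fin n) ℝ) :
    Integrable (fun ω => Z ω ⬝ᵥ C *ᵥ Z ω) (tapeLaw n) := by
  have hc : Continuous fun x : Fin n → ℝ => x ⬝ᵥ C *ᵥ x :=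
    continuous_id.dotProduct (continuous_const.matrix_mulVec continuous_id)
  refine Integrable.of_bound (hc.measurable.comp hZ).aestronglyMeasurable (∑ i, ∑ j, |C i j|) ?_
  exact Filter.Eventually.of_forall fun ω => (hs ω).abs_quadForm_le C

theorem integral_quadForm_le_maxCut {Z : Tape n → Fin n → ℝ} (hZ : Measurable Z)
    (hs : ∀ ω, IsSignVector (Z ω)) (C : Matrix (Fin n) (Fin n) ℝ) :
    ∫ ω, Z ω ⬝ᵥ C *ᵥ Z ω ∂tapeLaw n ≤ maxCut C := by
  have := integral_mono (integrable_quadForm_of_isSignVector hZ hs C)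
    (integrable_const (maxCut C)) fun ω => quadForm_le_maxCut (hs ω) C
  simpa using this

/-- Independent uniform signs have expected value `Tr C`. This is the sign formula with identity
correlation, since `arccos 0 = π / 2`. -/
theorem trace_le_maxCut (C : Matrix (Fin n) (Fin n) ℝ) : C.trace ≤ maxCut C := by
  have hY := isGaussianVector_vector (n := n) 0 0
  have hle : ∀ i j : Fin n, |(1 : Matrix (Fin n) (Fin n) ℝ) i j| ≤ 1 := fun i j => by
    rw [one_apply]; split_ifs <;> simp
  have h1 := hY.integral_quadForm isSymm_one one_apply_eq hle C
  have h2 := integral_quadForm_le_maxCut (Z := fun ω => signVector (ω.vector 0 0))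
    (measurable_pi_lambda _ fun i => measurable_signVector hY i)
    (fun ω => isSignVector_signVector _) C
  rw [h1] at h2
  refine le_trans (le_of_eq ?_) h2
  refine Finset.sum_congr rfl fun i _ => ?_
  rw [Finset.sum_eq_single i]
  · simp
  · intro j _ hj
    rw [one_apply_ne hj.symm, Real.arccos_zero]
    have := Real.pi_pos.ne'
    field_simp
    ring
  · simp

theorem maxCut_le_two_trace {C : Matrix (Fin n) (Fin n) ℝ} (hC : IsDiagDominant C) :
    maxCut C ≤ 2 * C.trace :=
  maxCut_le fun _ hx => (abs_le.1 (hx.abs_quadForm_le C)).2.trans hC.sum_abs_le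

end SignVector

/-! ### The value of the rounded solution -/

section Rounding

variable {n : ℕ} {C : Matrix (Fin n) (Fin n) ℝ} {ε : ℝ}

/-- Positivity is tested on the sum and the difference of two unit vectors. -/
theorem abs_entry_le_of_posSemidef {X : Matrix (Fin n) (Fin n) ℝ} (hX : X.PosSemidef) {m : ℝ}
    (hm : ∀ i, X i i ≤ m) (i j : Fin n) : |X i j| ≤ m := by
  have hsymm : X j i = X i j := by simpa using hX.1.apply i j
  have h : ∀ s : ℝ, 0 ≤ X i i + s * (2 * X i j) + s ^ 2 * X j j := fun s => by
    have := hX.dotProduct_mulVec_nonneg (Pi.single i 1 + s • Pi.single j 1)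
    simp only [star_trivial, add_dotProduct, smul_dotProduct, single_one_dotProduct, mulVec_add,
      mulVec_smul, mulVec_single_one, Pi.add_apply, Pi.smul_apply, col_apply, smul_eq_mul,
      hsymm] at this
    linarith
  have h1 := h 1
  have h2 := h (-1)
  have := hm i
  have := hm j
  rw [abs_le]
  constructor <;> linarith

theorem correlation_isSymm {X : Matrix (Fin n) (Fin n) ℝ} (hX : X.PosSemidef) :
    (correlation X).IsSymm := by
  have h : Xᵀ = X := by
    have := hX.1
    rwa [Matrix.IsHermitian, conjTranspose_eq_transpose_of_trivial] at this
  rw [Matrix.IsSymm, correlation, transpose_add, transpose_smul, diagonal_transpose, h]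

/-- This also holds when all variances vanish: division by zero then makes the correlation matrix
the identity. -/
theorem correlation_diag (X : Matrix (Fin n) (Fin n) ℝ) (i : Fin n) : correlation X i i = 1 := by
  rw [correlation, Matrix.add_apply, Matrix.smul_apply, diagonal_apply_eq, smul_eq_mul, diag_apply]
  ring

theorem correlation_off_diag (X : Matrix (Fin n) (Fin n) ℝ) {i j : Fin n} (hij : i ≠ j) :
    correlation X i j = X i j / ⨆ j, X.diag j := by
  rw [correlation, Matrix.add_apply, Matrix.smul_apply, diagonal_apply_ne _ hij, smul_eq_mul,
    add_zero]
  ring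

theorem abs_correlation_le_one {X : Matrix (Fin n) (Fin n) ℝ} (hX : X.PosSemidef) (i j : Fin n) :
    |correlation X i j| ≤ 1 := by
  rcases eq_or_ne i j with rfl | hij
  · rw [correlation_diag, abs_one]
  · have h0 : 0 ≤ ⨆ j, X.diag j := Real.iSup_nonneg fun j => hX.diag_nonneg
    rw [correlation_off_diag X hij, abs_div, abs_of_nonneg h0]
    exact div_le_one_of_le₀ (abs_entry_le_of_posSemidef hX (le_iSup_diag X) i j) h0

theorem trace_transpose_mul_eq_sum (A B : Matrix (Fin n) (Fin n) ℝ) :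
    (Aᵀ * B).trace = ∑ i, ∑ j, A i j * B i j := by
  rw [Finset.sum_comm]
  rfl

/-- Compared with `X` divided by its largest diagonal entry, the noise only raises the diagonal to
`1`, where `C` is nonnegative. -/
theorem trace_div_le_sum_correlation (hC : IsDiagDominant C) {X : Matrix (Fin n) (Fin n) ℝ}
    (hX : X.PosSemidef) :
    (Cᵀ * X).trace / (⨆ j, X.diag j) ≤ ∑ i, ∑ j, C i j * correlation X i j := by
  rw [trace_transpose_mul_eq_sum, Finset.sum_div]
  refine Finset.sum_le_sum fun i _ => ?_
  rw [Finset.sum_div]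
  refine Finset.sum_le_sum fun j _ => ?_
  rcases eq_or_ne i j with rfl | hij
  · rw [correlation_diag, mul_div_assoc]
    exact mul_le_mul_of_nonneg_left (div_iSup_diag_le_one hX i) (hC.diag_nonneg i)
  · rw [correlation_off_diag X hij, mul_div_assoc]

/-- The price that every matrix with unit diagonal pays for the penalty; `β` and `M` are matched to
make it exactly `ε Tr C`. -/
theorem penalty_lse_zero (hn : 0 < n) (hε : 0 < ε) (C : Matrix (Fin n) (Fin n) ℝ) :
    penaltyBeta C * lse (penaltyM n ε) (0 : Fin n → ℝ) = ε * C.trace := by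
  have := (log_two_mul_pos hn).ne'
  rw [lse_zero, penaltyBeta, penaltyM]
  field_simp

/-- Comparison with the matrices `x xᵀ` of sign vectors costs `ε Tr C` for the penalty and `1.24 ε
Tr C` for approximate optimality. The penalty value `τ` bounds all deviations `|X i i - 1|`, so
rescaling costs at most `opt τ ≤ 2 Tr C τ`, covered by the subtracted `4 Tr C τ`. -/
theorem isApproxOptimal_trace_ge (hn : 0 < n) (hε : 0 < ε) (hε3 : ε < 1 / 3)
    (hC : IsDiagDominant C) {X : Matrix (Fin n) (Fin n) ℝ}
    (hX : IsApproxOptimal C ε (124 / 100 * (ε * C.trace)) X) :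
    (1 - 224 / 100 * ε) * maxCut C * (⨆ j, X.diag j) ≤ (Cᵀ * X).trace := by
  have : Nonempty (Fin n) := ⟨⟨0, hn⟩⟩
  have hM := penaltyM_pos hn hε
  have htr := hC.trace_nonneg
  set τ := lse (penaltyM n ε) (X.diag - 1) with hτ
  have hdiag : ∀ i, |X i i - 1| ≤ τ := fun i => abs_le_lse hM (X.diag - 1) i
  have hτ0 : 0 ≤ τ := (abs_nonneg _).trans (hdiag ⟨0, hn⟩)
  have hm : (⨆ j, X.diag j) ≤ 1 + τ := ciSup_le fun i => by
    have := (abs_le.1 (hdiag i)).2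
    rw [diag_apply]
    linarith
  have hopt : maxCut C ≤ (Cᵀ * X).trace - 4 * C.trace * τ + 224 / 100 * (ε * C.trace) := by
    refine maxCut_le fun x hx => ?_
    have hxx : (vecMulVec x x).diag = 1 := funext fun i => hx.mul_self i
    have hfeas : Feasible (vecMulVec x x) := by
      refine ⟨by simpa using posSemidef_vecMulVec_self_star x, ?_⟩
      have h : (vecMulVec x x).trace = ∑ i, (vecMulVec x x).diag i := rfl
      rw [h, hxx]
      simp
    have h := hX.2 _ hfeas
    rw [objective, objective, hxx, sub_self, penalty_lse_zero hn hε, ← hτ, penaltyBeta, mul_vecMulVec,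
      trace_vecMulVec, mulVec_transpose, ← dotProduct_mulVec] at h
    linarith
  have h1 := trace_le_maxCut C
  have h2 := maxCut_le_two_trace hC
  have h3 : (1 - 224 / 100 * ε) * maxCut C * (⨆ j, X.diag j) ≤
      (1 - 224 / 100 * ε) * maxCut C * (1 + τ) :=
    mul_le_mul_of_nonneg_left hm (mul_nonneg (by linarith) (htr.trans h1))
  have h4 : ε * C.trace ≤ ε * maxCut C := mul_le_mul_of_nonneg_left h1 hε.le
  have h5 : maxCut C * τ ≤ 2 * C.trace * τ := mul_le_mul_of_nonneg_right h2 hτ0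
  have h6 : 0 ≤ ε * (maxCut C * τ) := mul_nonneg hε.le (mul_nonneg (htr.trans h1) hτ0)
  have h7 : 0 ≤ C.trace * τ := mul_nonneg htr hτ0
  linarith

theorem isSignVector_cut (κ : ℝ) (ω : Tape n) : IsSignVector (cut C ε κ ω) :=
  isSignVector_signVector _

/-- The expected value of the cut for given random starts of the oracle. -/
theorem conditional_value_ge (hn : 0 < n) (hε : 0 < ε) (hε3 : ε < 1 / 3) (hC : IsDiagDominant C)
    {κ : ℝ} {ω₀ : Tape n}
    (h : IsApproxOptimal C ε (124 / 100 * (ε * C.trace)) (covariance C ε κ ω₀)) :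
    alphaGW * ((1 - 224 / 100 * ε) * maxCut C) ≤
      ∫ ω, cut C ε κ (withStarts ω₀ ω) ⬝ᵥ C *ᵥ cut C ε κ (withStarts ω₀ ω) ∂tapeLaw n := by
  have hX := h.1.1
  have htr := isApproxOptimal_trace_ge hn hε hε3 hC h
  set X := covariance C ε κ ω₀
  have hY : IsGaussianVector (fun ω => signArgument C ε κ (withStarts ω₀ ω)) (correlation X) :=
    fun u => isCentredGaussian_signArgument κ ω₀ u
  have hgw := hY.goemansWilliamson (correlation_isSymm hX) (correlation_diag X)
    (abs_correlation_le_one hX) hC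
  have hm0 : 0 ≤ ⨆ j, X.diag j := Real.iSup_nonneg fun j => hX.diag_nonneg
  rcases hm0.eq_or_lt with hm | hm
  -- Degenerate case: all variances vanish, so `X = 0` and its penalty is at least `4 Tr C`.
  -- Approximate optimality against the identity then forces `Tr C = 0`, hence `opt = 0`.
  · have hdiag : ∀ i, X i i ≤ 0 := fun i => (le_iSup_diag X i).trans hm.symm.le
    have htau : 1 ≤ lse (penaltyM n ε) (X.diag - 1) := by
      refine le_trans ?_ (abs_le_lse (penaltyM_pos hn hε) (X.diag - 1) ⟨0, hn⟩)
      have := hdiag ⟨0, hn⟩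
      rw [Pi.sub_apply, diag_apply, Pi.one_apply, abs_of_nonpos (by linarith)]
      linarith
    have hzero : X = 0 := by
      ext i j
      have := abs_entry_le_of_posSemidef hX hdiag i j
      simpa using this
    have hobj := h.2 1 ⟨PosSemidef.one, by simp⟩
    have hone : (1 : Matrix (Fin n) (Fin n) ℝ).diag - 1 = 0 := by ext i; simp
    rw [objective, objective, hone, hzero, Matrix.mul_zero, trace_zero, Matrix.mul_one,
      trace_transpose] at hobj
    rw [← hzero, penalty_lse_zero hn hε, penaltyBeta] at hobj
    have h0 := hC.trace_nonneg
    have h1 := mul_le_mul_of_nonneg_left htau h0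
    have h2 := mul_le_mul_of_nonneg_right hε3.le h0
    have htr0 : C.trace = 0 := by linarith
    have hmax : maxCut C = 0 := by
      have := trace_le_maxCut C
      have := maxCut_le_two_trace hC
      linarith
    rw [hmax, mul_zero, mul_zero]
    exact integral_nonneg fun ω => hC.quadForm_nonneg _
  · refine le_trans (mul_le_mul_of_nonneg_left ?_ alphaGW_nonneg) hgw
    refine le_trans ?_ (trace_div_le_sum_correlation hC hX)
    rwa [le_div_iff₀ hm]

theorem expected_cut_ge (hn : 0 < n) (hε : 0 < ε) (hε3 : ε < 1 / 3) (hC : IsDiagDominant C)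
    {κ : ℝ} (hκ : κ ≤ 1) :
    alphaGW * (1 - 3 * ε) * maxCut C ≤
      ∫ ω, cut C ε κ ω ⬝ᵥ C *ᵥ cut C ε κ ω ∂tapeLaw n := by
  have hint := integrable_quadForm_of_isSignVector (measurable_cut C ε κ)
    (fun ω => isSignVector_cut κ ω) C
  -- The random starts become the outer variable; the inner integral is the conditional expectation
  -- given them.
  rw [integral_mix (startSeeds n) hint]
  set G := {ω : Tape n | ∀ t < ⌊iterBound n ε⌋₊, AccurateAt C ε ω t} with hG
  have hGm : MeasurableSet G := by
    have : G = ⋂ t ∈ Finset.range ⌊iterBound n ε⌋₊, {ω | AccurateAt C ε ω t} := by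
      ext ω; simp [hG]
    rw [this]
    exact Finset.measurableSet_biInter _ fun t _ => measurableSet_accurateAt C ε t
  set c := alphaGW * ((1 - 224 / 100 * ε) * maxCut C) with hc
  have hmax : 0 ≤ maxCut C := hC.trace_nonneg.trans (trace_le_maxCut C)
  have hc0 : 0 ≤ alphaGW * maxCut C := mul_nonneg alphaGW_nonneg hmax
  have hmono : ∫ ω, G.indicator (fun _ => c) ω ∂tapeLaw n ≤
      ∫ ω', ∫ ω, cut C ε κ (mix (startSeeds n) ω' ω) ⬝ᵥ
        C *ᵥ cut C ε κ (mix (startSeeds n) ω' ω) ∂tapeLaw n ∂tapeLaw n := by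
    refine integral_mono ((integrable_const c).indicator hGm)
      (integrable_mix (startSeeds n) hint).integral_prod_left fun ω' => ?_
    by_cases hω : ω' ∈ G
    · rw [Set.indicator_of_mem hω]
      exact conditional_value_ge hn hε hε3 hC
        (covariance_approxOptimal hn hε hε3 hC hω (by norm_num) (by linarith))
    · rw [Set.indicator_of_notMem hω]
      -- Inaccurate starts still give a nonnegative value, because a diagonally dominant matrix is
      -- positive semidefinite.
      exact integral_nonneg fun ω => hC.quadForm_nonneg _
  refine le_trans ?_ hmono
  rw [integral_indicator_const _ hGm, smul_eq_mul]
  have hP := all_accurate_prob (C := C) hn hε hε3 hC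
  have h1 : (1 - 76 / 100 * ε) * c ≤ (tapeLaw n).real G * c :=
    mul_le_mul_of_nonneg_right hP (mul_nonneg alphaGW_nonneg (mul_nonneg (by linarith) hmax))
  refine le_trans ?_ h1
  rw [hc]
  -- Since `0.76 + 2.24 = 3`, the two losses exceed `1 - 3 ε` by a nonnegative multiple of `ε ^ 2`.
  have h2 : 0 ≤ alphaGW * maxCut C * ε ^ 2 := mul_nonneg hc0 (sq_nonneg ε)
  linarith

end Rounding

end MaxCutFW

namespace MaxCutFW

/-! ### The program

Vector registers: `0` holds `z_t`, `1` holds `diag X_t`, `2` is the work space of the oracle. Scalar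
registers: `0` the trace of `C`, `1` the value of `expSum`, `2` the counter `t`, `3` the value
`⟨C, X_t⟩`, `4` a squared norm, `5` and `6` the two parts of the Rayleigh quotient `7`, `8` a Gaussian
number, `9` the penalty part of `⟨X_t, J_t⟩`, `10` the largest variance, `11` the flag. -/

namespace Implementation

abbrev VExpr : Type := Expr (Fin 3 ⊕ Fin 16)

def vec (j : Fin 3) : VExpr := .var (.inl j)

def scal (a : Fin 16) : VExpr := .var (.inr a)

/-- `∂ᵢ φ_M(diag X - 𝟙)`. -/
def gradExpr (M : ℝ) : VExpr :=
  .div (.sub (.exp (.mul (.const M) (.sub (vec 1) (.const 1))))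
    (.exp (.mul (.const M) (.sub (.const 0) (.sub (vec 1) (.const 1)))))) (scal 1)

def expSumExpr (M : ℝ) : VExpr :=
  .add (.exp (.mul (.const M) (.sub (vec 1) (.const 1))))
    (.exp (.mul (.const M) (.sub (.const 0) (.sub (vec 1) (.const 1)))))

/-- The diagonal matrix that is added to `C` in the power method. -/
def shiftExpr (M : ℝ) : VExpr :=
  .sub (.mul (.const 5) (scal 0)) (.mul (.mul (.const 4) (scal 0)) (gradExpr M))

def powerCode (M : ℝ) (K : ℕ) : Code 3 16 :=
  .seq (.sum 1 (expSumExpr M)) <| .seq (.gaussVector 2 1) <|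
  .seq (.repeatN K (.matvec 2 (shiftExpr M))) <| .seq (.sum 4 (.mul (vec 2) (vec 2))) <|
  .setVector 2 (.mul (.div (.const 1) (.sqrt (scal 4))) (vec 2))

/-- Scalar `5` is reset together with the Rayleigh quotient: the update of `⟨C, X_t⟩` needs the form
of the selected vector. -/
def selectCode (M : ℝ) : Code 3 16 :=
  .seq (.quadForm 5 2) <| .seq (.sum 6 (.mul (gradExpr M) (.mul (vec 2) (vec 2)))) <|
  .seq (.setScalar 7 (.sub (.var 5) (.mul (.mul (.const 4) (.var 0)) (.var 6)))) <|
  .seq (.setVector 2 (.ifNonneg (scal 7) (vec 2) (.const 0))) <|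
  .seq (.setScalar 5 (.ifNonneg (.var 7) (.var 5) (.const 0)))
    (.setScalar 7 (.ifNonneg (.var 7) (.var 7) (.const 0)))

def flagCode (n : ℕ) (M ε κ : ℝ) : Code 3 16 :=
  .seq (.sum 9 (.mul (gradExpr M) (vec 1)))
    (.setScalar 11 (.ifNonneg (.sub (.mul (.const κ) (.mul (.const ε) (.var 0)))
      (.sub (.mul (.const n) (.var 7))
        (.sub (.var 3) (.mul (.mul (.const 4) (.var 0)) (.var 9))))) (.const (-1)) (.const 1)))

/-- The step size as an expression. -/
def stepExpr {V : Type} (t : Expr V) : Expr V := .div (.const 2) (.add t (.const 2))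

/-- The sample and the variances change only for a nonnegative flag, so the round that detects a
small gap leaves them intact. The counter is increased last because the step size reads it. -/
def updateCode (n : ℕ) : Code 3 16 :=
  .seq (.gaussScalar 8) <|
  .seq (.setVector 0 (.ifNonneg (scal 11)
    (.add (.mul (.sqrt (.sub (.const 1) (stepExpr (scal 2)))) (vec 0))
      (.mul (.mul (.sqrt (stepExpr (scal 2))) (scal 8)) (.mul (.sqrt (.const n)) (vec 2))))
    (vec 0))) <|
  .seq (.setVector 1 (.ifNonneg (scal 11)
    (.add (.mul (.sub (.const 1) (stepExpr (scal 2))) (vec 1))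
      (.mul (stepExpr (scal 2)) (.mul (.const n) (.mul (vec 2) (vec 2))))) (vec 1))) <|
  .seq (.setScalar 3
    (.add (.mul (.sub (.const 1) (stepExpr (.var 2))) (.var 3))
      (.mul (stepExpr (.var 2)) (.mul (.const n) (.var 5)))))
    (.setScalar 2 (.add (.var 2) (.const 1)))

/-- The implementation of the algorithm. -/
def program (n : ℕ) (ε κ : ℝ) : Program 3 16 where
  init := .seq (.gaussVector 0 0) <| .seq (.setVector 1 (.const 1)) <| .seq (.trace 0)
    (.setScalar 3 (.var 0))
  body := .seq (powerCode (penaltyM n ε) (powerSteps n ε)) <| .seq (selectCode (penaltyM n ε)) <|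
    .seq (flagCode n (penaltyM n ε) ε κ) (updateCode n)
  final := .seq (.max 10 1) <| .seq (.gaussVector 2 0) <|
    .setVector 2 (.ifNonneg (.add (.div (vec 0) (.sqrt (scal 10)))
      (.mul (.sqrt (.sub (.const 1) (.div (vec 1) (scal 10)))) (vec 2))) (.const 1) (.const (-1)))
  maxRounds := ⌊iterBound n ε⌋₊
  flag := 11
  out := 2

/-! ### Correctness and cost of the program -/

section Correctness

variable {n : ℕ} {C : Matrix (Fin n) (Fin n) ℝ} {ω : Tape n}

/-- The registers that are kept from one round to the next. -/
structure Holds (C : Matrix (Fin n) (Fin n) ℝ) (m : Machine n 3 16) (z v : Fin n → ℝ) (t c : ℝ)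
    (d e : ℕ) : Prop where
  sample : m.vec 0 = z
  diag : m.vec 1 = v
  trace : m.scal 0 = C.trace
  counter : m.scal 2 = t
  value : m.scal 3 = c
  drawnZero : m.drawnVectors 0 = 1
  drawnOne : m.drawnVectors 1 = d
  drawnScalars : m.drawnScalars = e

theorem coord_inl (m : Machine n 3 16) (l : Fin n) (j : Fin 3) :
    m.coord l (.inl j) = m.vec j l := rfl

theorem coord_inr (m : Machine n 3 16) (l : Fin n) (a : Fin 16) :
    m.coord l (.inr a) = m.scal a := rfl

theorem eval_gradExpr (M : ℝ) (m : Machine n 3 16) (hS : m.scal 1 = expSum M (m.vec 1 - 1))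
    (l : Fin n) : (gradExpr M).eval (m.coord l) = lseGrad M (m.vec 1 - 1) l := by
  simp [gradExpr, vec, scal, Expr.eval, coord_inl, coord_inr, lseGrad, hS]

theorem sum_eval_expSumExpr (M : ℝ) (m : Machine n 3 16) :
    ∑ l, (expSumExpr M).eval (m.coord l) = expSum M (m.vec 1 - 1) := by
  rw [expSum_eq_sum]
  simp [expSumExpr, vec, Expr.eval, coord_inl]

theorem eval_shiftExpr (ε : ℝ) (m : Machine n 3 16)
    (hS : m.scal 1 = expSum (penaltyM n ε) (m.vec 1 - 1)) (htr : m.scal 0 = C.trace) :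
    C + diagonal (fun l => (shiftExpr (penaltyM n ε)).eval (m.coord l)) =
      gradMatrix C ε (m.vec 1) + (5 * C.trace) • (1 : Matrix (Fin n) (Fin n) ℝ) := by
  have h : (fun l => (shiftExpr (penaltyM n ε)).eval (m.coord l)) = fun l =>
      5 * C.trace - penaltyBeta C * lseGrad (penaltyM n ε) (m.vec 1 - 1) l := by
    funext l
    rw [← eval_gradExpr _ m hS]
    simp [shiftExpr, scal, Expr.eval, coord_inr, htr, penaltyBeta]
  rw [h, gradMatrix, smul_one_eq_diagonal, ← diagonal_smul, sub_add_eq_add_sub, add_sub_assoc,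
    diagonal_sub]
  rfl

/-- The shift does not read the register that the loop overwrites, so all in-place products use the
same matrix. -/
theorem exec_power (M : ℝ) (K : ℕ) (m : Machine n 3 16) :
    (Code.repeatN K (.matvec 2 (shiftExpr M))).exec C ω m =
      { m with
        vec := Function.update m.vec 2
          ((C + diagonal fun l => (shiftExpr M).eval (m.coord l)) ^ K *ᵥ m.vec 2)
        matvecs := m.matvecs + K } := by
  induction K with
  | zero => simp [Code.exec]
  | succ K ih =>
    simp only [Code.exec] at ih ⊢
    rw [Function.iterate_succ_apply', ih]
    have h : ∀ l y, (shiftExpr M).eval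
        (Machine.coord { m with vec := Function.update m.vec 2 y, matvecs := m.matvecs + K } l) =
        (shiftExpr M).eval (m.coord l) := fun l y => by
      simp [shiftExpr, gradExpr, vec, scal, Expr.eval, coord_inl, coord_inr]
    simp only [h, Function.update_self, Function.update_idem, mulVec_mulVec, ← pow_succ']
    rfl

theorem exec_powerCode {ε : ℝ} {m : Machine n 3 16} {z v : Fin n → ℝ} {t c : ℝ} {d e : ℕ}
    (h : Holds C m z v t c d e) :
    Holds C ((powerCode (penaltyM n ε) (powerSteps n ε)).exec C ω m) z v t c (d + 1) e ∧
    ((powerCode (penaltyM n ε) (powerSteps n ε)).exec C ω m).vec 2 =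
      powerVector C ε v (ω.start d) ∧
    ((powerCode (penaltyM n ε) (powerSteps n ε)).exec C ω m).scal 1 =
      expSum (penaltyM n ε) (v - 1) := by
  obtain ⟨hz, hv, htr, ht, hc, h0, h1, he⟩ := h
  have hexec : ∀ (a b : Code 3 16) (m : Machine n 3 16),
    (Code.seq a b).exec C ω m = b.exec C ω (a.exec C ω m) := fun _ _ _ => rfl
  rw [powerCode, hexec, hexec, hexec, exec_power]
  set m₁ := (Code.gaussVector 2 1).exec C ω
    ((Code.sum 1 (expSumExpr (penaltyM n ε))).exec C ω m) with hm₁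
  have e1 : m₁.vec 1 = v := by simp [hm₁, Code.exec, hv]
  have e2 : m₁.vec 0 = z := by simp [hm₁, Code.exec, hz]
  have e3 : m₁.scal 1 = expSum (penaltyM n ε) (v - 1) := by
    simp [hm₁, Code.exec, sum_eval_expSumExpr, hv]
  have e4 : m₁.scal 0 = C.trace := by simp [hm₁, Code.exec, htr]
  have e5 : m₁.scal 2 = t := by simp [hm₁, Code.exec, ht]
  have e6 : m₁.scal 3 = c := by simp [hm₁, Code.exec, hc]
  have e7 : m₁.drawnVectors 0 = 1 := by simp [hm₁, Code.exec, h0]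
  have e8 : m₁.drawnVectors 1 = d + 1 := by simp [hm₁, Code.exec, h1]
  have e9 : m₁.drawnScalars = e := by simp [hm₁, Code.exec, he]
  have e10 : m₁.vec 2 = ω.start d := by simp [hm₁, Code.exec, h1, Tape.start]
  rw [eval_shiftExpr ε m₁ (by rw [e3, e1]) e4, e10, e1]
  refine ⟨⟨?_, ?_, ?_, ?_, ?_, ?_, ?_, ?_⟩, ?_, ?_⟩
  · simp [Code.exec, e2]
  · simp [Code.exec, e1]
  · simp [Code.exec, e4]
  · simp [Code.exec, e5]
  · simp [Code.exec, e6]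
  · simp [Code.exec, e7]
  · simp [Code.exec, e8]
  · simp [Code.exec, e9]
  · rw [powerVector]
    generalize (gradMatrix C ε v + (5 * C.trace) • (1 : Matrix (Fin n) (Fin n) ℝ)) ^
      powerSteps n ε *ᵥ ω.start d = y
    ext l
    simp [Code.exec, Expr.eval, coord_inl, coord_inr, vec, scal, dotProduct]
  · simp [Code.exec, e3]

theorem exec_selectCode {ε : ℝ} {m : Machine n 3 16} {z v b : Fin n → ℝ} {t c : ℝ} {d e : ℕ}
    (h : Holds C m z v t c d e) (hS : m.scal 1 = expSum (penaltyM n ε) (v - 1))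
    (hy : m.vec 2 = powerVector C ε v b) :
    Holds C ((selectCode (penaltyM n ε)).exec C ω m) z v t c d e ∧
    ((selectCode (penaltyM n ε)).exec C ω m).scal 1 = expSum (penaltyM n ε) (v - 1) ∧
    ((selectCode (penaltyM n ε)).exec C ω m).vec 2 = lmo C ε v b ∧
    ((selectCode (penaltyM n ε)).exec C ω m).scal 5 = lmo C ε v b ⬝ᵥ C *ᵥ lmo C ε v b ∧
    ((selectCode (penaltyM n ε)).exec C ω m).scal 7 =
      lmo C ε v b ⬝ᵥ gradMatrix C ε v *ᵥ lmo C ε v b := by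
  obtain ⟨hz, hv, htr, ht, hc, h0, h1, he⟩ := h
  have hexec : ∀ (a b : Code 3 16) (m : Machine n 3 16),
    (Code.seq a b).exec C ω m = b.exec C ω (a.exec C ω m) := fun _ _ _ => rfl
  rw [selectCode, hexec, hexec, hexec]
  have hlmo : lmo C ε v b = if 0 ≤ powerVector C ε v b ⬝ᵥ gradMatrix C ε v *ᵥ powerVector C ε v b
    then powerVector C ε v b else 0 := rfl
  rw [hlmo]
  clear hlmo
  generalize powerVector C ε v b = w at hy ⊢
  have hsum : ∑ l, (gradExpr (penaltyM n ε)).eval (m.coord l) * (w l * w l) =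
      ∑ l, lseGrad (penaltyM n ε) (v - 1) l * w l ^ 2 :=
    Finset.sum_congr rfl fun l _ => by rw [eval_gradExpr _ m (by rw [hS, hv]), hv, sq]
  set m₁ := (Code.setScalar 7 (.sub (.var 5) (.mul (.mul (.const 4) (.var 0)) (.var 6)))).exec C ω
    ((Code.sum 6 (.mul (gradExpr (penaltyM n ε)) (.mul (vec 2) (vec 2)))).exec C ω
      ((Code.quadForm 5 2).exec C ω m)) with hm₁
  have e1 : m₁.vec 1 = v := by simp [hm₁, Code.exec, hv]
  have e2 : m₁.vec 0 = z := by simp [hm₁, Code.exec, hz]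
  have e3 : m₁.scal 1 = expSum (penaltyM n ε) (v - 1) := by simp [hm₁, Code.exec, hS]
  have e4 : m₁.scal 0 = C.trace := by simp [hm₁, Code.exec, htr]
  have e5 : m₁.scal 2 = t := by simp [hm₁, Code.exec, ht]
  have e6 : m₁.scal 3 = c := by simp [hm₁, Code.exec, hc]
  have e7 : m₁.drawnVectors 0 = 1 := by simp [hm₁, Code.exec, h0]
  have e8 : m₁.drawnVectors 1 = d := by simp [hm₁, Code.exec, h1]
  have e9 : m₁.drawnScalars = e := by simp [hm₁, Code.exec, he]
  have e10 : m₁.vec 2 = w := by simp [hm₁, Code.exec, hy]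
  have e11 : m₁.scal 5 = w ⬝ᵥ C *ᵥ w := by simp [hm₁, Code.exec, hy]
  have e12 : m₁.scal 7 = w ⬝ᵥ gradMatrix C ε v *ᵥ w := by
    have hcoord : ∀ x l, (gradExpr (penaltyM n ε)).eval
        (Machine.coord { m with scal := Function.update m.scal 5 x, matvecs := m.matvecs + 1 } l) =
        (gradExpr (penaltyM n ε)).eval (m.coord l) := fun x l => by
      simp [gradExpr, vec, scal, Expr.eval, coord_inl, coord_inr]
    have h7 : m₁.scal 7 = w ⬝ᵥ C *ᵥ w - 4 * C.trace *
        ∑ l, (gradExpr (penaltyM n ε)).eval (m.coord l) * (w l * w l) := by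
      simp only [hm₁, Code.exec, Expr.eval, hcoord]
      simp [coord_inl, vec, Expr.eval, hy, htr]
    rw [quadForm_gradMatrix, h7, hsum, penaltyBeta]
  clear_value m₁
  refine ⟨⟨?_, ?_, ?_, ?_, ?_, ?_, ?_, ?_⟩, ?_, ?_, ?_, ?_⟩
  · simp [Code.exec, e2]
  · simp [Code.exec, e1]
  · simp [Code.exec, e4]
  · simp [Code.exec, e5]
  · simp [Code.exec, e6]
  · simp [Code.exec, e7]
  · simp [Code.exec, e8]
  · simp [Code.exec, e9]
  · simp [Code.exec, e3]
  · ext l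
    simp only [Code.exec, Expr.eval, coord_inl, coord_inr, vec, scal, e10, e12,
      Function.update_self]
    split_ifs <;> rfl
  · by_cases h : 0 ≤ w ⬝ᵥ gradMatrix C ε v *ᵥ w <;> simp [Code.exec, Expr.eval, e11, e12, h]
  · by_cases h : 0 ≤ w ⬝ᵥ gradMatrix C ε v *ᵥ w <;> simp [Code.exec, Expr.eval, e12, h]

theorem exec_flagCode {ε κ : ℝ} {m : Machine n 3 16} {z v : Fin n → ℝ} {t c : ℝ} {d e : ℕ}
    (h : Holds C m z v t c d e) (hS : m.scal 1 = expSum (penaltyM n ε) (v - 1)) :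
    Holds C ((flagCode n (penaltyM n ε) ε κ).exec C ω m) z v t c d e ∧
    ((flagCode n (penaltyM n ε) ε κ).exec C ω m).vec 2 = m.vec 2 ∧
    ((flagCode n (penaltyM n ε) ε κ).exec C ω m).scal 5 = m.scal 5 ∧
    ((flagCode n (penaltyM n ε) ε κ).exec C ω m).scal 11 =
      if n * m.scal 7 - (c - penaltyBeta C * lseGrad (penaltyM n ε) (v - 1) ⬝ᵥ v) ≤
        κ * (ε * C.trace) then -1 else 1 := by
  obtain ⟨hz, hv, htr, ht, hc, h0, h1, he⟩ := h
  refine ⟨⟨?_, ?_, ?_, ?_, ?_, ?_, ?_, ?_⟩, ?_, ?_, ?_⟩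
  · simp [flagCode, Code.exec, hz]
  · simp [flagCode, Code.exec, hv]
  · simp [flagCode, Code.exec, htr]
  · simp [flagCode, Code.exec, ht]
  · simp [flagCode, Code.exec, hc]
  · simp [flagCode, Code.exec, h0]
  · simp [flagCode, Code.exec, h1]
  · simp [flagCode, Code.exec, he]
  · simp [flagCode, Code.exec]
  · simp [flagCode, Code.exec]
  · have hg : ∑ l, (gradExpr (penaltyM n ε)).eval (m.coord l) * (vec 1).eval (m.coord l) =
        lseGrad (penaltyM n ε) (v - 1) ⬝ᵥ v := by
      refine Finset.sum_congr rfl fun l _ => ?_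
      rw [eval_gradExpr _ m (by rw [hS, hv]), hv]
      simp [vec, Expr.eval, coord_inl, hv]
    simp [flagCode, Code.exec, Expr.eval, hg, htr, hc, penaltyBeta]

theorem exec_updateCode {m : Machine n 3 16} {z v w : Fin n → ℝ} {t : ℕ} {c q : ℝ} {d e : ℕ}
    (h : Holds C m z v t c d e) (hw : m.vec 2 = w) (hq : m.scal 5 = q) (hflag : 0 ≤ m.scal 11) :
    Holds C ((updateCode n).exec C ω m)
      (√(1 - stepSize t) • z + (√(stepSize t) * ω.zeta e) • (√(n : ℝ) • w))
      ((1 - stepSize t) • v + stepSize t • (direction w).diag) (t + 1 : ℕ)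
      ((1 - stepSize t) * c + stepSize t * (n * q)) d (e + 1) ∧
    ((updateCode n).exec C ω m).scal 11 = m.scal 11 := by
  obtain ⟨hz, hv, htr, ht, hc, h0, h1, he⟩ := h
  refine ⟨⟨?_, ?_, ?_, ?_, ?_, ?_, ?_, ?_⟩, ?_⟩
  · ext l
    simp [updateCode, stepExpr, Code.exec, Expr.eval, coord_inl, coord_inr, vec, scal, hflag, hz, ht, hw,
      he, stepSize, Tape.zeta]
  · ext l
    simp [updateCode, stepExpr, Code.exec, Expr.eval, coord_inl, coord_inr, vec, scal, hflag, hv, ht, hw,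
      stepSize, direction]
  · simp [updateCode, Code.exec, htr]
  · simp [updateCode, Code.exec, Expr.eval, ht]
  · simp [updateCode, stepExpr, Code.exec, Expr.eval, ht, hc, hq, stepSize]
  · simp [updateCode, Code.exec, h0]
  · simp [updateCode, Code.exec, h1]
  · simp [updateCode, Code.exec, he]
  · simp [updateCode, Code.exec]

theorem exec_updateCode_of_neg {m : Machine n 3 16} (hflag : ¬ 0 ≤ m.scal 11) :
    ((updateCode n).exec C ω m).vec 0 = m.vec 0 ∧ ((updateCode n).exec C ω m).vec 1 = m.vec 1 ∧
    ((updateCode n).exec C ω m).drawnVectors = m.drawnVectors ∧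
    ((updateCode n).exec C ω m).scal 11 = m.scal 11 := by
  refine ⟨?_, ?_, ?_, ?_⟩
  · ext l
    simp [updateCode, Code.exec, Expr.eval, coord_inl, coord_inr, vec, scal, hflag]
  · ext l
    simp [updateCode, Code.exec, Expr.eval, coord_inl, coord_inr, vec, scal, hflag]
  · simp [updateCode, Code.exec]
  · simp [updateCode, Code.exec]

/-- The additional product is the quadratic form of the Rayleigh quotient, for which `powerSteps`
leaves room. -/
theorem exec_body_matvecs (ε κ : ℝ) (m : Machine n 3 16) :
    ((program n ε κ).body.exec C ω m).matvecs = m.matvecs + (powerSteps n ε + 1) := by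
  have hexec : ∀ (a b : Code 3 16) (m : Machine n 3 16),
    (Code.seq a b).exec C ω m = b.exec C ω (a.exec C ω m) := fun _ _ _ => rfl
  simp only [program, powerCode, hexec, exec_power]
  simp [selectCode, flagCode, updateCode, Code.exec, add_assoc]

/-- The registers before round `t + 1`. -/
def Ready (C : Matrix (Fin n) (Fin n) ℝ) (ε : ℝ) (ω : Tape n) (t : ℕ) (m : Machine n 3 16) : Prop :=
  Holds C m (iterate C ε ω t).1 (iterate C ε ω t).2.diag t (Cᵀ * (iterate C ε ω t).2).trace t t

theorem exec_body {ε κ : ℝ} {t : ℕ} {m : Machine n 3 16} (h : Ready C ε ω t m) :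
    (¬ gap C ε ω t ≤ κ * (ε * C.trace) →
      Ready C ε ω (t + 1) ((program n ε κ).body.exec C ω m) ∧
      0 ≤ ((program n ε κ).body.exec C ω m).scal 11) ∧
    (gap C ε ω t ≤ κ * (ε * C.trace) →
      ((program n ε κ).body.exec C ω m).vec 0 = (iterate C ε ω t).1 ∧
      ((program n ε κ).body.exec C ω m).vec 1 = (iterate C ε ω t).2.diag ∧
      ((program n ε κ).body.exec C ω m).drawnVectors 0 = 1 ∧
      ((program n ε κ).body.exec C ω m).scal 11 < 0) := by
  obtain ⟨a1, a2, a3⟩ := exec_powerCode (ω := ω) (ε := ε) h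
  obtain ⟨b1, b2, b3, b4, b5⟩ := exec_selectCode (ω := ω) a1 a3 a2
  obtain ⟨c1, c2, c3, c4⟩ := exec_flagCode (ω := ω) (κ := κ) b1 b2
  have hbody : (program n ε κ).body.exec C ω m = (updateCode n).exec C ω
    ((flagCode n (penaltyM n ε) ε κ).exec C ω ((selectCode (penaltyM n ε)).exec C ω
      ((powerCode (penaltyM n ε) (powerSteps n ε)).exec C ω m))) := rfl
  rw [hbody]
  set m₃ := (flagCode n (penaltyM n ε) ε κ).exec C ω ((selectCode (penaltyM n ε)).exec C ω
      ((powerCode (penaltyM n ε) (powerSteps n ε)).exec C ω m))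
  rw [b5, ← gap_eq] at c4
  rw [b3] at c2
  rw [b4] at c3
  constructor
  · intro hgap
    rw [if_neg hgap] at c4
    obtain ⟨d1, d2⟩ := exec_updateCode (ω := ω) c1 c2 c3 (by rw [c4]; norm_num)
    refine ⟨?_, by rw [d2, c4]; norm_num⟩
    have hX := iterate_succ_snd C ε ω t
    -- `⟨C, X_t⟩` follows the linear recursion of the covariances, so one scalar register replaces
    -- the matrix.
    have htr : (Cᵀ * (iterate C ε ω (t + 1)).2).trace =
        (1 - stepSize t) * (Cᵀ * (iterate C ε ω t).2).trace +
          stepSize t * (n * (lmo C ε (iterate C ε ω t).2.diag (ω.start t) ⬝ᵥ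
            C *ᵥ lmo C ε (iterate C ε ω t).2.diag (ω.start t))) := by
      rw [hX, Matrix.mul_add, trace_add, Matrix.mul_smul, Matrix.mul_smul, trace_smul, trace_smul,
        trace_transpose_mul_direction, smul_eq_mul, smul_eq_mul]
    rw [Ready, htr, hX, diag_add, diag_smul, diag_smul]
    exact d1
  · intro hgap
    rw [if_pos hgap] at c4
    obtain ⟨d1, d2, d3, d4⟩ := exec_updateCode_of_neg (C := C) (ω := ω) (m := m₃)
      (by rw [c4]; norm_num)
    exact ⟨d1.trans c1.sample, d2.trans c1.diag, by rw [d3, c1.drawnZero], by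
      rw [d4, c4]; norm_num⟩

theorem after_ready {ε κ : ℝ} {t : ℕ} (ht : t ≤ stopTime C ε κ ω) :
    Ready C ε ω t ((program n ε κ).after C ω t) ∧
      0 ≤ ((program n ε κ).after C ω t).scal 11 := by
  induction t with
  | zero =>
    refine ⟨⟨?_, ?_, ?_, ?_, ?_, ?_, ?_, ?_⟩, ?_⟩
    · simp [Program.after, program, Code.exec, iterate, Tape.initial]
    · ext l; simp [Program.after, program, Code.exec, iterate, Expr.eval]
    · simp [Program.after, program, Code.exec]
    · simp [Program.after, program, Code.exec]
    · simp [Program.after, program, Code.exec, iterate, Expr.eval]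
    · simp [Program.after, program, Code.exec]
    · simp [Program.after, program, Code.exec]
    · simp [Program.after, program, Code.exec]
    · simp [Program.after, program, Code.exec]
  | succ t ih =>
    obtain ⟨h1, h2⟩ := ih (by omega)
    have hgap : ¬ gap C ε ω t ≤ κ * (ε * C.trace) := fun hg => by
      have : stopTime C ε κ ω ≤ t := Nat.sInf_le (Or.inr hg)
      omega
    have hstep : (program n ε κ).after C ω (t + 1) =
        (program n ε κ).body.exec C ω ((program n ε κ).after C ω t) := if_pos h2
    rw [hstep]
    exact (exec_body h1).1 hgap

/-- What the final part of the program needs. -/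
theorem after_sample {ε κ : ℝ} {t : ℕ} (ht : stopTime C ε κ ω ≤ t) (htT : t ≤ ⌊iterBound n ε⌋₊) :
    ((program n ε κ).after C ω t).vec 0 = sample C ε κ ω ∧
    ((program n ε κ).after C ω t).vec 1 = (covariance C ε κ ω).diag ∧
    ((program n ε κ).after C ω t).drawnVectors 0 = 1 ∧
    (stopTime C ε κ ω < t → ((program n ε κ).after C ω t).scal 11 < 0) := by
  induction t, ht using Nat.le_induction with
  | base =>
    obtain ⟨h, -⟩ := after_ready (C := C) (ω := ω) (ε := ε) (κ := κ) le_rfl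
    exact ⟨h.sample, h.diag, h.drawnZero, fun h => absurd h (lt_irrefl _)⟩
  | succ t ht ih =>
    obtain ⟨h1, h2, h3, h4⟩ := ih (by omega)
    rcases ht.lt_or_eq with hlt | heq
    · have hneg := h4 hlt
      have hstep : (program n ε κ).after C ω (t + 1) = (program n ε κ).after C ω t :=
        if_neg (not_le.2 hneg)
      rw [hstep]
      exact ⟨h1, h2, h3, fun _ => hneg⟩
    · obtain ⟨h, hflag⟩ := after_ready (C := C) (ω := ω) (ε := ε) (κ := κ) le_rfl
      rw [heq] at h hflag
      -- Below the iteration cap the algorithm can only have stopped because of the gap. The program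
      -- still runs that round, which lowers the flag without touching the sample.
      have hgap : gap C ε ω t ≤ κ * (ε * C.trace) := by
        have := stopTime_spec C ε κ ω
        rw [heq] at this
        exact this.resolve_left (by omega)
      have hstep : (program n ε κ).after C ω (t + 1) =
          (program n ε κ).body.exec C ω ((program n ε κ).after C ω t) := if_pos hflag
      obtain ⟨k1, k2, k3, k4⟩ := (exec_body h).2 hgap
      rw [hstep, sample, covariance, heq]
      exact ⟨k1, k2, k3, fun _ => k4⟩

/-- The oracle draws from stream `1` only, so whatever the number of rounds the next vector of
stream `0` is the rounding vector. -/
theorem program_output (ε κ : ℝ) : (program n ε κ).output C ω = cut C ε κ ω := by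
  obtain ⟨h1, h2, h3, -⟩ := after_sample (C := C) (ω := ω) (κ := κ) (stopTime_le C ε κ ω) le_rfl
  ext l
  rw [Program.output, Program.finish]
  change (((program n ε κ).final).exec C ω
    ((program n ε κ).after C ω ⌊iterBound n ε⌋₊)).vec 2 l = _
  generalize (program n ε κ).after C ω ⌊iterBound n ε⌋₊ = m at h1 h2 h3
  simp [program, Code.exec, Expr.eval, coord_inl, coord_inr, vec, scal, h1, h2, h3, cut, roundSample,
    Tape.rounding]
  rfl

theorem finish_matvecs (ε κ : ℝ) : ((program n ε κ).finish C ω).matvecs =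
    ((program n ε κ).after C ω (program n ε κ).maxRounds).matvecs := rfl

theorem after_zero_matvecs (ε κ : ℝ) : ((program n ε κ).after C ω 0).matvecs = 0 := rfl

theorem after_succ_matvecs (hn : 0 < n) {ε : ℝ} (hε : 0 < ε) (hε3 : ε < 1 / 3) (κ : ℝ) (r : ℕ) :
    (((program n ε κ).after C ω (r + 1)).matvecs : ℝ) ≤
      ((program n ε κ).after C ω r).matvecs + matvecBound n ε := by
  have hL := log_ratio_ge hn hε hε3
  have h1 : (1 : ℝ) ≤ n := by exact_mod_cast hn
  have h2 : (1 : ℝ) ≤ n / ε := by rw [le_div_iff₀ hε]; linarith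
  have h3 : 1 ≤ matvecBound n ε := by unfold matvecBound; nlinarith
  have hstep : (program n ε κ).after C ω (r + 1) =
      if 0 ≤ ((program n ε κ).after C ω r).scal 11 then
        (program n ε κ).body.exec C ω ((program n ε κ).after C ω r)
      else (program n ε κ).after C ω r := rfl
  rw [hstep]
  split_ifs
  -- The bound is at least one, so the truncated subtraction in `powerSteps` is exact and a round
  -- uses its floor.
  · rw [exec_body_matvecs, powerSteps, Nat.sub_add_cancel (Nat.le_floor (by exact_mod_cast h3))]
    push_cast
    have := Nat.floor_le (zero_le_one.trans h3)
    linarith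
  · linarith

end Correctness

end Implementation

end MaxCutFW

end

/-! ### The main theorem -/

open MaxCutFW in
theorem theorem4p1 (n : ℕ) (hn : 0 < n) (ε : ℝ) (hε : 0 < ε) (hε3 : ε < 1 / 3)
    (κ : ℝ) (hκ : κ ≤ 1) :
    (∀ C : Matrix (Fin n) (Fin n) ℝ, IsDiagDominant C →
      -- accuracy of the linear maximisation oracle, with `η = 1` and `p = ε / T(n, ε)`
      (∀ t < ⌊iterBound n ε⌋₊, ∀ v : Fin n → ℝ,
        1 - ε / iterBound n ε ≤
          (Measure.pi fun _ : Fin n => gaussianReal 0 1).real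
            {b | ∀ Y, Feasible Y →
              ((gradMatrix C ε v)ᵀ * Y).trace - 1 / 2 * 1 * stepSize t * curvatureBound C ε ≤
                ((gradMatrix C ε v)ᵀ * direction (lmo C ε v b)).trace}) ∧
      -- optimality of the covariance of the returned sample
      (κ ≤ 3 / 4 →
        1 - ε ≤ (tapeLaw n).real {ω | IsApproxOptimal C ε (ε * C.trace) (covariance C ε κ ω)}) ∧
      -- the number of iterations
      (∀ ω, (stopTime C ε κ ω : ℝ) ≤ iterBound n ε) ∧
      -- the random cut
      (∀ ω, IsSignVector (cut C ε κ ω)) ∧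
      Integrable (fun ω => cut C ε κ ω ⬝ᵥ C *ᵥ cut C ε κ ω) (tapeLaw n) ∧
      alphaGW * (1 - 3 * ε) * maxCut C ≤ ∫ ω, cut C ε κ ω ⬝ᵥ C *ᵥ cut C ε κ ω ∂(tapeLaw n) ∧
      ∫ ω, cut C ε κ ω ⬝ᵥ C *ᵥ cut C ε κ ω ∂(tapeLaw n) ≤ maxCut C) ∧
    -- implementation of the procedure
    ∃ (k : ℕ) (P : Program k 16) (iz iv : Fin k),
      P.vectorMemory n ≤ 3 * n ∧
      (P.maxRounds : ℝ) ≤ iterBound n ε ∧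
      ∀ C : Matrix (Fin n) (Fin n) ℝ, IsDiagDominant C → ∀ ω : Tape n,
        P.output C ω = cut C ε κ ω ∧
        (∀ t ≤ stopTime C ε κ ω,
          (P.after C ω t).vec iz = (iterate C ε ω t).1 ∧
          (P.after C ω t).vec iv = (iterate C ε ω t).2.diag) ∧
        (∀ r, ((P.after C ω (r + 1)).matvecs : ℝ) ≤
          (P.after C ω r).matvecs + matvecBound n ε) ∧
        (P.after C ω 0).matvecs = 0 ∧
        (P.finish C ω).matvecs = (P.after C ω P.maxRounds).matvecs := by
  have hT := iterBound_pos hn hε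
  refine ⟨fun C hC => ⟨fun t ht v => ?_, fun hκ34 => ?_, fun ω => ?_, isSignVector_cut κ,
    integrable_quadForm_of_isSignVector (measurable_cut C ε κ) (isSignVector_cut κ) C,
    expected_cut_ge hn hε hε3 hC hκ,
    integral_quadForm_le_maxCut (measurable_cut C ε κ) (isSignVector_cut κ) C⟩,
    3, Implementation.program n ε κ, 0, 1, le_rfl, Nat.floor_le hT.le, fun C _ ω =>
    ⟨Implementation.program_output (C := C) (ω := ω) ε κ, fun t ht => ?_, fun r =>
      Implementation.after_succ_matvecs (C := C) (ω := ω) hn hε hε3 κ r,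
      Implementation.after_zero_matvecs (C := C) (ω := ω) ε κ,
      Implementation.finish_matvecs (C := C) (ω := ω) ε κ⟩⟩
  · have hm : MeasurableSet
        {b : Fin n → ℝ | OracleAccurate C ε (24 / 100 * (ε * C.trace)) v b} :=
      measurable_prodMk_left (measurableSet_oracleAccurate C ε (24 / 100 * (ε * C.trace)))
    have h1 := oracleAccurate_prob hn hε hε3 hC v
    have h2 := probReal_compl_eq_one_sub (μ := Measure.pi fun _ : Fin n => gaussianReal 0 1) hm
    rw [Set.compl_ofPred] at h2
    have h3 : 0 ≤ ε / iterBound n ε := by positivity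
    refine le_trans (by linarith : 1 - ε / iterBound n ε ≤
      (Measure.pi fun _ : Fin n => gaussianReal 0 1).real
        {b | OracleAccurate C ε (24 / 100 * (ε * C.trace)) v b})
      (measureReal_mono fun b hb Y hY => ?_)
    -- The uniform accuracy `0.24 ε Tr C` is within the tolerance of every call before the cap.
    exact (sub_le_sub_left (stepSize_mul_curvatureBound_ge hn hε hε3 hC ht) _).trans (hb Y hY)
  · refine le_trans (by linarith) ((all_accurate_prob hn hε hε3 hC).trans
      (measureReal_mono fun ω hω => ?_))
    -- Here `κ + 0.24 ≤ 0.99`, so the error factor `1` is admissible.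
    have h := covariance_approxOptimal hn hε hε3 hC hω (κ := κ) (a := 1) (by norm_num)
      (by linarith)
    rwa [one_mul] at h
  · exact (Nat.cast_le.2 (stopTime_le C ε κ ω)).trans (Nat.floor_le hT.le)
  · have h := (Implementation.after_ready (C := C) (ω := ω) ht).1
    exact ⟨h.sample, h.diag⟩
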